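/- Let $s\ge 3$ be an integer, let $T>0$, and for $f\in L^2(\mathbb R)$ (complex-valued) let $\hat f=\mathcal F f$, $\mathcal F f(\xi)=\frac1{\sqrt{2\pi}}\int_{\mathbb R}e^{-ix\xi}f(x)\,dx$ (in the sense of Plancherel), $\|f\|_s=\big(\int_{\mathbb R}(1+\xi^2)^s|\hat f(\xi)|^2\,d\xi\big)^{1/2}$, and $H^s(\mathbb R)=\{f\in L^2(\mathbb R):\|f\|_s<\infty\}$. Let $\varphi\in H^s(\mathbb R)$, put $E(t)(\xi)=e^{i\xi^3t}$, and for $u:[0,T]\to H^s(\mathbb R)$ and $t\in[0,T]$ let $$\bar S(u,\varphi)(t)=\mathcal F^{-1}\big(E(t)\,\mathcal F\varphi\big)-\int_0^t\mathcal F^{-1}\Big(E(t-\tau)\,\mathcal F\Big(\tfrac{d}{dx}\big(\tfrac12u(\tau)^2+\tfrac13u(\tau)^3\big)\Big)\Big)\,d\tau ,$$ where the integral is a Bochner integral in $L^2(\mathbb R)$. Let $v^0=\bar S(0,\varphi)$, $v^{j+1}=\bar S(v^j,\varphi)$ for $j\ge 0$, and $\alpha_T^s=\sqrt s\cdot 2^s\cdot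 T^{1/2}+1$. Suppose that $$\alpha_T^s\,T^{1/2}\big[8(3+T)^{3/2}\|\varphi\|_s^2+4(3+T)\|\varphi\|_s\big]\le\tfrac12 .$$ Then all iterates are well defined on $[0,T]$ (for every $j\ge0$ and $t\in[0,T]$ one has $v^j(t)\in H^s(\mathbb R)$, and the integrand in $\bar S(v^j,\varphi)(t)$ is integrable on $[0,t]$), and $$\|v^{j+1}(t)-v^j(t)\|_s\le 2^{-j}(3+T)^{1/2}\|\varphi\|_s\qquad\text{for all } j\ge0,\ t\in[0,T].$$ Consequently the iteration converges geometrically in $H^s$, uniformly on $[0,T]$: there is $v:[0,T]\to H^s(\mathbb R)$ with $\|v^j(t)-v(t)\|_s\le 2\cdot2^{-j}(3+T)^{1/2}\|\varphi\|_s$ for all $j\ge0$ and $t\in[0,T]$. -/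

import Mathlib

open MeasureTheory Set
open scoped FourierTransform

noncomputable section

namespace CombinedKdV

/-- The Hilbert space `L²(ℝ)` of complex-valued square-integrable functions on the line. -/
abbrev L2 : Type := Lp ℂ 2 (volume : Measure ℝ)

/-! ### Fourier convention

The Fourier transform `F f (ξ) = (2π)^{-1/2} ∫ e^{-ixξ} f(x) dx` is related to Mathlib's transform
`𝓕 f (η) = ∫ e^{-2πixη} f(x) dx` by `F f (ξ) = (2π)^{-1/2} 𝓕 f (ξ / 2π)`.
With `ξ = 2πη` one gets `∫ w(ξ) |F f (ξ)|² dξ = ∫ w(2πη) |𝓕 f (η)|² dη`, and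
`F⁻¹ (m · F f) = 𝓕⁻ (m(2π ·) · 𝓕 f)`. Below, `𝓕` is the `L²` (Plancherel) transform. -/

/-- The density `(1 + ξ²)^s |f̂(ξ)|²`, at the frequency `ξ = 2πη`. -/
def sobDensity (s : ℕ) (f : L2) (η : ℝ) : ℝ :=
  (1 + (2 * Real.pi * η) ^ 2) ^ s * ‖(𝓕 f : L2) η‖ ^ 2

/-- `f ∈ H^s(ℝ)`: `f ∈ L²(ℝ)` and `∫ (1 + ξ²)^s |f̂(ξ)|² dξ < ∞`. -/
def MemHs (s : ℕ) (f : L2) : Prop := Integrable (sobDensity s f) volume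

/-- The Sobolev norm `‖f‖_s = (∫ (1 + ξ²)^s |f̂(ξ)|² dξ)^{1/2}` (meaningful when `MemHs s f`). -/
def hsNorm (s : ℕ) (f : L2) : ℝ := Real.sqrt (∫ η, sobDensity s f η)

open Classical in
/-- The class in `L²(ℝ)` of a function `g`; the junk value `0` if `g` is not in `L²`. -/
def toL2 (g : ℝ → ℂ) : L2 :=
  if h : MemLp g 2 (volume : Measure ℝ) then h.toLp g else 0

/-- The Fourier multiplier `f ↦ F⁻¹ (m · F f)` (meaningful when `m · F f` is in `L²`). -/
def fourierMul (m : ℝ → ℂ) (f : L2) : L2 :=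
  𝓕⁻ (toL2 fun η => m (2 * Real.pi * η) * (𝓕 f : L2) η)

/-- The Airy group `W(t) f = F⁻¹ (E(t) · F f)`, where `E(t)(ξ) = e^{iξ³t}`. -/
def airy (t : ℝ) (f : L2) : L2 :=
  fourierMul (fun ξ => Complex.exp (Complex.I * ((ξ ^ 3 * t : ℝ) : ℂ))) f

/-- The derivative `d/dx` on `H¹(ℝ)`, with Fourier symbol `iξ`. -/
def ddx (f : L2) : L2 := fourierMul (fun ξ => Complex.I * (ξ : ℂ)) f

/-- The pointwise nonlinearity `u²/2 + u³/3`. -/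
def nonlin (u : L2) : L2 := toL2 fun x => u x ^ 2 / 2 + u x ^ 3 / 3

/-- The integrand
`F⁻¹ (E(t-τ) · F (d/dx (u(τ)²/2 + u(τ)³/3)))` of the combined KdV integral equation. -/
def duhamelIntegrand (u : ℝ → L2) (t τ : ℝ) : L2 := airy (t - τ) (ddx (nonlin (u τ)))

/-- The integral operator
`S̄(u,φ)(t) = F⁻¹ (E(t) · F φ) - ∫₀ᵗ F⁻¹ (E(t-τ) · F (d/dx (u(τ)²/2 + u(τ)³/3))) dτ`,
with a Bochner integral in `L²(ℝ)`. -/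
def Sbar (u : ℝ → L2) (φ : L2) (t : ℝ) : L2 :=
  airy t φ - ∫ τ in (0 : ℝ)..t, duhamelIntegrand u t τ

/-- The Picard iterates `v⁰ = S̄(0,φ)`, `v^{j+1} = S̄(v^j,φ)`. -/
def picard (φ : L2) : ℕ → ℝ → L2
  | 0 => Sbar (fun _ => 0) φ
  | j + 1 => Sbar (picard φ j) φ

/-- The constant `α_T^s = √s · 2^s · T^{1/2} + 1`. -/
def alpha (s : ℕ) (T : ℝ) : ℝ := Real.sqrt s * 2 ^ s * T ^ (1 / 2 : ℝ) + 1

end CombinedKdV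

end

noncomputable section

namespace CombinedKdV

open scoped InnerProductSpace ComplexConjugate ENNReal

/-! The map `u ↦ Sbar u φ` contracts by the factor 1/2 on a ball of radius `2‖φ‖_s` in a space of
paths on `[0, T]`. A path has size at most `a` there (`AdmPath`) when it is continuous in `L²`,
bounded by `a` in `H^s`, and has a maximal function `sup_t |u(t, x)|` of `L²_x` norm at most `(1 +
T) a`. The maximal function serves to recover the derivative lost in the Duhamel term.

The recovery is Kato's local smoothing in dual form: for band-limited `ψ`, the function `(W(t - τ)
d/dx)* ψ` is bounded by `‖ψ‖` in `L^∞_x L²_τ` (`lintegral_katoRep_sq_le`, by Plancherel in the time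
frequency). It is paired with `J^s` of the nonlinearity. The Leibniz rule writes `J^s(gh) = g J^s h
+ h J^s g + remainder`. In the first two terms the bare factor lies in `L²_x L^∞_t` and the other in
`L^∞_t L²_x`, so two Cauchy–Schwarz inequalities give `√T (1 + T)` times the sizes. The remainder
lies in `H¹` (`memHs_leibnizRem`) and can bear the derivative, at the cost of a factor `T`. Cubic
terms use the rule twice. By duality (`memHs_of_inner_le`, `memHs_duhamel`) this bounds the Duhamel
term in `H^s`.

The maximal function is controlled by elementary means: a mild solution bounded in `H³` is Lipschitz
in time with values in `L²` (`lipschitz_mild`), because the generator has order three, and a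
Lipschitz path in `L²` has a square-integrable maximal function (`hasMaj_of_lipschitz`). This is
where `s ≥ 3` enters the analysis.

With explicit constants, the smallness hypothesis implies the contraction condition
(`contraction_of_small`). The iteration then gives differences of size at most `2^{-j} ‖φ‖_s / 2`.
The iterates converge in `L²`, and closedness of `H^s` balls in `L²` upgrades the limit and its
error bounds to `H^s`. -/

theorem continuous_integral_mul {k : ℝ → ℂ} (hk : MemLp k 2 volume) :
    Continuous fun f : L2 => ∫ x, k x * f x := by
  have h : (fun f : L2 => ∫ x, k x * f x) = fun f : L2 => ⟪hk.star.toLp _, f⟫_ℂ := by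
    funext f
    rw [L2.inner_def]
    refine integral_congr_ae ?_
    filter_upwards [hk.star.coeFn_toLp] with x hx
    rw [hx]
    simp [mul_comm]
  rw [h]
  exact continuous_const.inner continuous_id

/-! ### The `L²` Fourier transform, Fourier integrals and convolutions -/

theorem denseRange_schwartz :
    DenseRange (fun f : SchwartzMap ℝ ℂ => (f.toLp 2 : L2)) :=
  SchwartzMap.denseRange_toLpCLM (F := ℂ) (E := ℝ) (p := 2) (μ := volume) ENNReal.ofNat_ne_top

theorem coeFn_schwartz_toLp (H : SchwartzMap ℝ ℂ) : (H.toLp 2 : L2) =ᵐ[volume] H :=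
  H.coeFn_toLp 2 volume

/-- Both sides are `L²`-continuous in `f`, so density reduces the claim to Schwartz `f`. Testing
against Schwartz functions is how the Plancherel transform is identified with the Fourier integral
below. -/
theorem integral_fourier_mul_schwartz (f : L2) (φ : SchwartzMap ℝ ℂ) :
    ∫ x, φ x * (𝓕 f : L2) x = ∫ x, (𝓕 φ) x * f x := by
  refine denseRange_schwartz.induction_on
    (p := fun f : L2 => ∫ x, φ x * (𝓕 f : L2) x = ∫ x, (𝓕 φ) x * f x) f
    (isClosed_eq ?_ (continuous_integral_mul ((𝓕 φ).memLp 2))) ?_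
  · exact (continuous_integral_mul (φ.memLp 2)).comp
      (Lp.fourierTransformₗᵢ ℝ ℂ).continuous
  · intro g
    rw [SchwartzMap.toLp_fourier_eq]
    have h1 : ∫ x, φ x * ((𝓕 g).toLp 2 : L2) x = ∫ x, φ x * (𝓕 g) x := by
      refine integral_congr_ae ?_
      filter_upwards [(𝓕 g).coeFn_toLp 2] with x hx
      rw [hx]
    have h2 : ∫ x, (𝓕 φ) x * (g.toLp 2 : L2) x = ∫ x, (𝓕 φ) x * g x := by
      refine integral_congr_ae ?_
      filter_upwards [g.coeFn_toLp 2] with x hx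
      rw [hx]
    rw [h1, h2, SchwartzMap.integral_fourier_mul_eq]

theorem ae_eq_of_integral_schwartz_mul {f g : ℝ → ℂ} (hf : LocallyIntegrable f volume)
    (hg : LocallyIntegrable g volume)
    (h : ∀ φ : SchwartzMap ℝ ℂ, ∫ x, φ x * f x = ∫ x, φ x * g x) : f =ᵐ[volume] g := by
  refine ae_eq_of_integral_contDiff_smul_eq hf hg fun k hk hk' => ?_
  have hc : HasCompactSupport fun x => (k x : ℂ) :=
    hk'.comp_left (g := ((↑) : ℝ → ℂ)) Complex.ofReal_zero
  have hd : ContDiff ℝ (⊤ : ℕ∞) fun x => (k x : ℂ) := Complex.ofRealCLM.contDiff.comp hk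
  have := h (hc.toSchwartzMap hd)
  simpa using this

theorem integral_fourier_mul_of_integrable {f : ℝ → ℂ} (hf : Integrable f)
    (φ : SchwartzMap ℝ ℂ) : ∫ x, φ x * 𝓕 f x = ∫ x, (𝓕 φ) x * f x := by
  have := VectorFourier.integral_bilin_fourierIntegral_eq_flip (ContinuousLinearMap.mul ℂ ℂ)
    (L := innerₗ ℝ) (μ := volume) (ν := volume) (e := Real.fourierChar)
    Real.continuous_fourierChar continuous_inner φ.integrable hf
  simp only [flip_innerₗ] at this
  simpa [SchwartzMap.fourier_coe] using! this.symm

theorem continuous_fourier_of_integrable {f : ℝ → ℂ} (hf : Integrable f) :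
    Continuous (𝓕 f) :=
  VectorFourier.fourierIntegral_continuous Real.continuous_fourierChar continuous_inner hf

/-- The `L²` Fourier transform agrees with the Fourier integral on `L¹ ∩ L²`. -/
theorem fourier_ae_eq {f : L2} (hf : Integrable f) : (𝓕 f : L2) =ᵐ[volume] 𝓕 (f : ℝ → ℂ) := by
  refine ae_eq_of_integral_schwartz_mul ?_ ?_ fun φ => ?_
  · exact (Lp.memLp _).locallyIntegrable (by norm_num)
  · exact (continuous_fourier_of_integrable hf).locallyIntegrable
  · rw [integral_fourier_mul_schwartz, integral_fourier_mul_of_integrable hf]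

theorem fourierInv_ae_eq_comp_neg (f : L2) :
    (𝓕⁻ f : L2) =ᵐ[volume] fun x => (𝓕 f : L2) (-x) := by
  have hc : Continuous fun f : L2 => (𝓕 f : L2) := (Lp.fourierTransformₗᵢ ℝ ℂ).continuous
  have hc' : Continuous fun f : L2 => (𝓕⁻ f : L2) := (Lp.fourierTransformₗᵢ ℝ ℂ).symm.continuous
  have mp : MeasurePreserving (fun x : ℝ => -x) volume volume := Measure.measurePreserving_neg _
  have key : ∀ f : L2, (𝓕⁻ f : L2) = Lp.compMeasurePreserving (fun x : ℝ => -x) mp (𝓕 f : L2) := by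
    intro f
    refine denseRange_schwartz.induction_on
      (p := fun f : L2 => (𝓕⁻ f : L2) = Lp.compMeasurePreserving (fun x : ℝ => -x) mp (𝓕 f : L2)) f
      (isClosed_eq hc' ?_) ?_
    · exact (Lp.isometry_compMeasurePreserving mp).continuous.comp hc
    · intro g
      rw [SchwartzMap.toLp_fourier_eq, SchwartzMap.toLp_fourierInv_eq]
      apply Lp.ext
      have h1 := (𝓕 g).coeFn_toLp 2
      filter_upwards [(𝓕⁻ g).coeFn_toLp 2, Lp.coeFn_compMeasurePreserving
        ((𝓕 g).toLp 2) mp, mp.quasiMeasurePreserving.ae h1] with x hx hx' hx''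
      rw [hx, hx', Function.comp_apply, hx'', SchwartzMap.fourierInv_coe, SchwartzMap.fourier_coe,
        Real.fourierInv_eq_fourier_neg]
  rw [key f]
  exact Lp.coeFn_compMeasurePreserving _ mp

theorem fourierInv_ae_eq {f : L2} (hf : Integrable f) :
    (𝓕⁻ f : L2) =ᵐ[volume] 𝓕⁻ (f : ℝ → ℂ) := by
  have mp : MeasurePreserving (fun x : ℝ => -x) volume volume := Measure.measurePreserving_neg _
  filter_upwards [fourierInv_ae_eq_comp_neg f, mp.quasiMeasurePreserving.ae (fourier_ae_eq hf)]
    with x h1 h2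
  rw [h1, h2, Real.fourierInv_eq_fourier_neg]

/-- Plancherel's theorem for a function in `L¹ ∩ L²`. -/
theorem eLpNorm_fourierInv_eq {f : ℝ → ℂ} (hf : Integrable f) (hf2 : MemLp f 2 volume) :
    eLpNorm (𝓕⁻ f) 2 volume = eLpNorm f 2 volume := by
  have h1 : Integrable (hf2.toLp f : L2) := hf.congr hf2.coeFn_toLp.symm
  have h2 := fourierInv_ae_eq h1
  have h3 : 𝓕⁻ ((hf2.toLp f : L2) : ℝ → ℂ) = 𝓕⁻ f := by
    funext x
    rw [Real.fourierInv_eq, Real.fourierInv_eq]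
    refine integral_congr_ae ?_
    filter_upwards [hf2.coeFn_toLp] with y hy
    rw [hy]
  rw [h3] at h2
  have h4 : ‖(𝓕⁻ (hf2.toLp f : L2) : L2)‖ = ‖(hf2.toLp f : L2)‖ :=
    (Lp.fourierTransformₗᵢ ℝ ℂ).symm.norm_map _
  rw [Lp.norm_def, Lp.norm_def, ENNReal.toReal_eq_toReal_iff' (Lp.eLpNorm_ne_top _)
    (Lp.eLpNorm_ne_top _), eLpNorm_congr_ae h2, eLpNorm_congr_ae hf2.coeFn_toLp] at h4
  exact h4

/-- The transform is moved from `g` onto `y ↦ ĥ(η - y)`, whose own transform is `e^{-2πixη} h(x)` by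
Fourier inversion. -/
theorem integral_mul_exp_eq_convolution_schwartz (g h : SchwartzMap ℝ ℂ) (η : ℝ) :
    ∫ y, (𝓕 g) y * (𝓕 h) (η - y) = 𝓕 (fun x => g x * h x) η := by
  let k : ℝ → ℂ := fun y => (𝓕 h) (η - y)
  have hk : Integrable k := (𝓕 h).integrable.comp_sub_left η
  have h1 := integral_fourier_mul_of_integrable hk g
  have h2 : ∀ x, 𝓕 k x = Real.fourierChar (-(x * η)) • h x := by
    intro x
    rw [Real.fourier_eq]
    have e1 : (∫ v, Real.fourierChar (-(inner ℝ v x)) • k v)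
        = ∫ v, Real.fourierChar (-(inner ℝ (η - v) x)) • (𝓕 h) v := by
      rw [← integral_sub_left_eq_self _ volume η]
      simp [k]
    rw [e1]
    have e2 : h x = ∫ v, Real.fourierChar (inner ℝ v x) • (𝓕 h) v := by
      have : (𝓕⁻ (𝓕 h)) x = h x := by rw [FourierTransform.fourierInv_fourier_eq]
      rw [← this, SchwartzMap.fourierInv_coe, Real.fourierInv_eq]
    rw [e2]
    simp only [Circle.smul_def]
    rw [← integral_smul]
    refine integral_congr_ae (Filter.Eventually.of_forall fun v => ?_)
    simp only [smul_eq_mul, ← mul_assoc]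
    rw [← Circle.coe_mul, ← AddChar.map_add_eq_mul]
    congr 3
    simp [mul_comm]
    ring_nf
  refine h1.symm.trans ?_
  rw [Real.fourier_eq]
  refine integral_congr_ae (Filter.Eventually.of_forall fun x => ?_)
  simp only [h2, Circle.smul_def, smul_eq_mul]
  rw [show inner ℝ x η = x * η by simp [mul_comm]]
  ring

theorem integrable_mul (g h : L2) : Integrable fun x => g x * h x :=
  (Lp.memLp g).integrable_mul (Lp.memLp h)

theorem memLp_comp_sub {k : ℝ → ℂ} (hk : MemLp k 2 volume) (η : ℝ) :
    MemLp (fun y => k (η - y)) 2 volume :=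
  hk.comp_measurePreserving (Measure.measurePreserving_sub_left volume η)

theorem integrable_convolution (g h : L2) (η : ℝ) : Integrable fun y => g y * h (η - y) :=
  (Lp.memLp g).integrable_mul (memLp_comp_sub (Lp.memLp h) η)

theorem memLp_fourierChar_smul (f : L2) (η : ℝ) :
    MemLp (fun x => (Real.fourierChar (-(inner ℝ x η)) : ℂ) * f x) 2 volume := by
  have hc : Continuous fun x : ℝ => (Real.fourierChar (-(inner ℝ x η)) : ℂ) := by fun_prop
  refine (Lp.memLp f).of_le (hc.aestronglyMeasurable.mul (Lp.aestronglyMeasurable f))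
    (Filter.Eventually.of_forall fun x => ?_)
  rw [norm_mul, Circle.norm_coe, one_mul]

theorem continuous_fourier_mul (h : L2) (η : ℝ) :
    Continuous fun g : L2 => 𝓕 (fun x => g x * h x) η := by
  refine (continuous_integral_mul (memLp_fourierChar_smul h η)).congr fun g => ?_
  rw [Real.fourier_eq]
  refine integral_congr_ae (Filter.Eventually.of_forall fun x => ?_)
  simp only [Circle.smul_def, smul_eq_mul]
  ring

theorem continuous_convolution (h : L2) (η : ℝ) :
    Continuous fun g : L2 => ∫ y, (𝓕 g : L2) y * h (η - y) := by
  have hF : Continuous fun f : L2 => (𝓕 f : L2) := (Lp.fourierTransformₗᵢ ℝ ℂ).continuous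
  have h1 : Continuous fun f : L2 => ∫ y, f y * h (η - y) := by
    refine (continuous_integral_mul (memLp_comp_sub (Lp.memLp h) η)).congr fun g => ?_
    simp only [mul_comm]
  exact h1.comp hF

theorem convolution_symm (g h : L2) (η : ℝ) :
    ∫ y, g y * h (η - y) = ∫ y, h y * g (η - y) := by
  rw [← integral_sub_left_eq_self _ volume η]
  simp [mul_comm]

theorem fourier_mul_eq_convolution_schwartz (g h : SchwartzMap ℝ ℂ) (η : ℝ) :
    𝓕 (fun x => (g.toLp 2 : L2) x * (h.toLp 2 : L2) x) η
      = ∫ y, (𝓕 (g.toLp 2 : L2) : L2) y * (𝓕 (h.toLp 2 : L2) : L2) (η - y) := by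
  have hl : 𝓕 (fun x => (g.toLp 2 : L2) x * (h.toLp 2 : L2) x) η = 𝓕 (fun x => g x * h x) η := by
    rw [Real.fourier_eq, Real.fourier_eq]
    refine integral_congr_ae ?_
    filter_upwards [g.coeFn_toLp 2, h.coeFn_toLp 2] with x h1 h2
    rw [h1, h2]
  rw [hl, ← integral_mul_exp_eq_convolution_schwartz, SchwartzMap.toLp_fourier_eq,
    SchwartzMap.toLp_fourier_eq]
  generalize (𝓕 g : SchwartzMap ℝ ℂ) = G
  generalize (𝓕 h : SchwartzMap ℝ ℂ) = H
  have hh : ∀ᵐ y ∂(volume : Measure ℝ), (H.toLp 2 : L2) y = H y := coeFn_schwartz_toLp H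
  refine integral_congr_ae ?_
  filter_upwards [G.coeFn_toLp 2,
    (Measure.measurePreserving_sub_left volume η).quasiMeasurePreserving.ae hh] with x h1 h2
  rw [h1, h2]

/-- The Fourier integral of a product of `L²` functions is the convolution of their transforms. -/
theorem fourier_mul_eq_convolution (g h : L2) (η : ℝ) :
    𝓕 (fun x => g x * h x) η = ∫ y, (𝓕 g : L2) y * (𝓕 h : L2) (η - y) := by
  have syml : ∀ g h : L2, 𝓕 (fun x => g x * h x) η = 𝓕 (fun x => h x * g x) η := by
    intro g h
    simp only [mul_comm]
  -- Density is used in one variable at a time: at fixed `η` both sides are continuous in each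
  -- factor separately.
  have step : ∀ (g : SchwartzMap ℝ ℂ) (h : L2), 𝓕 (fun x => (g.toLp 2 : L2) x * h x) η
      = ∫ y, (𝓕 (g.toLp 2 : L2) : L2) y * (𝓕 h : L2) (η - y) := by
    intro g h
    rw [syml, convolution_symm]
    have hcl := isClosed_eq (continuous_fourier_mul (g.toLp 2 : L2) η)
      (continuous_convolution (𝓕 (g.toLp 2 : L2) : L2) η)
    have hs : ∀ h : SchwartzMap ℝ ℂ, (h.toLp 2 : L2) ∈
        {h : L2 | 𝓕 (fun x => h x * (g.toLp 2 : L2) x) η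
          = ∫ y, (𝓕 h : L2) y * (𝓕 (g.toLp 2 : L2) : L2) (η - y)} :=
      fun h => fourier_mul_eq_convolution_schwartz h g η
    exact denseRange_schwartz.induction_on h hcl hs
  have hcl := isClosed_eq (continuous_fourier_mul h η) (continuous_convolution (𝓕 h : L2) η)
  have hs : ∀ g : SchwartzMap ℝ ℂ, (g.toLp 2 : L2) ∈ {g : L2 | 𝓕 (fun x => g x * h x) η
      = ∫ y, (𝓕 g : L2) y * (𝓕 h : L2) (η - y)} := fun g => step g h
  exact denseRange_schwartz.induction_on g hcl hs

/-! ### Calculus of Fourier multipliers on `L²` -/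

theorem toL2_ae {g : ℝ → ℂ} (h : MemLp g 2 volume) : (toL2 g : ℝ → ℂ) =ᵐ[volume] g := by
  rw [toL2, dif_pos h]
  exact h.coeFn_toLp

theorem toL2_congr {g g' : ℝ → ℂ} (h : g =ᵐ[volume] g') : toL2 g = toL2 g' := by
  by_cases hg : MemLp g 2 volume
  · have hg' := (memLp_congr_ae h).1 hg
    refine Lp.ext ?_
    filter_upwards [toL2_ae hg, toL2_ae hg', h] with x h1 h2 h3
    rw [h1, h2, h3]
  · have hg' : ¬ MemLp g' 2 volume := fun hh => hg ((memLp_congr_ae h).2 hh)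
    rw [toL2, toL2, dif_neg hg, dif_neg hg']

theorem fourier_fourierInv (f : L2) : (𝓕 (𝓕⁻ f : L2) : L2) = f :=
  (Lp.fourierTransformₗᵢ ℝ ℂ).apply_symm_apply f

theorem fourierInv_fourier (f : L2) : (𝓕⁻ (𝓕 f : L2) : L2) = f :=
  (Lp.fourierTransformₗᵢ ℝ ℂ).symm_apply_apply f

theorem fourier_injective {f g : L2} (h : (𝓕 f : L2) =ᵐ[volume] (𝓕 g : L2)) : f = g :=
  (Lp.fourierTransformₗᵢ ℝ ℂ).injective (Lp.ext h)

theorem fourier_add_ae (f g : L2) :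
    (𝓕 (f + g) : L2) =ᵐ[volume] fun η => (𝓕 f : L2) η + (𝓕 g : L2) η := by
  have : (𝓕 (f + g) : L2) = 𝓕 f + 𝓕 g := (Lp.fourierTransformₗᵢ ℝ ℂ).map_add f g
  rw [this]
  exact Lp.coeFn_add _ _

theorem fourier_sub_ae (f g : L2) :
    (𝓕 (f - g) : L2) =ᵐ[volume] fun η => (𝓕 f : L2) η - (𝓕 g : L2) η := by
  have : (𝓕 (f - g) : L2) = 𝓕 f - 𝓕 g := (Lp.fourierTransformₗᵢ ℝ ℂ).map_sub f g
  rw [this]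
  exact Lp.coeFn_sub _ _

theorem fourier_smul_ae (c : ℂ) (f : L2) :
    (𝓕 (c • f) : L2) =ᵐ[volume] fun η => c * (𝓕 f : L2) η := by
  have : (𝓕 (c • f) : L2) = c • 𝓕 f := (Lp.fourierTransformₗᵢ ℝ ℂ).map_smul c f
  rw [this]
  exact Lp.coeFn_smul _ _

/-- `m · F f` is square-integrable, so that `fourierMul m f` is meaningful. -/
def MulDom (m : ℝ → ℂ) (f : L2) : Prop :=
  MemLp (fun η => m (2 * Real.pi * η) * (𝓕 f : L2) η) 2 volume

theorem fourier_fourierMul (m : ℝ → ℂ) (f : L2) : (𝓕 (fourierMul m f) : L2) =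
    toL2 fun η => m (2 * Real.pi * η) * (𝓕 f : L2) η :=
  fourier_fourierInv _

theorem fourier_fourierMul_ae {m : ℝ → ℂ} {f : L2} (h : MulDom m f) :
    (𝓕 (fourierMul m f) : L2) =ᵐ[volume] fun η => m (2 * Real.pi * η) * (𝓕 f : L2) η := by
  rw [fourier_fourierMul]
  exact toL2_ae h

theorem MulDom.add {m : ℝ → ℂ} {f g : L2} (hf : MulDom m f) (hg : MulDom m g) :
    MulDom m (f + g) := by
  refine (memLp_congr_ae ?_).1 (MemLp.add hf hg)
  filter_upwards [fourier_add_ae f g] with η h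
  rw [h, mul_add]
  rfl

theorem MulDom.sub {m : ℝ → ℂ} {f g : L2} (hf : MulDom m f) (hg : MulDom m g) :
    MulDom m (f - g) := by
  refine (memLp_congr_ae ?_).1 (MemLp.sub hf hg)
  filter_upwards [fourier_sub_ae f g] with η h
  rw [h, mul_sub]
  rfl

theorem MulDom.smul {m : ℝ → ℂ} {f : L2} (hf : MulDom m f) (c : ℂ) : MulDom m (c • f) := by
  refine (memLp_congr_ae ?_).1 (MemLp.const_mul hf c)
  filter_upwards [fourier_smul_ae c f] with η h
  rw [h]
  ring

theorem fourierMul_add {m : ℝ → ℂ} {f g : L2} (hf : MulDom m f) (hg : MulDom m g) :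
    fourierMul m (f + g) = fourierMul m f + fourierMul m g := by
  apply fourier_injective
  filter_upwards [fourier_fourierMul_ae (hf.add hg), fourier_fourierMul_ae hf,
    fourier_fourierMul_ae hg, fourier_add_ae f g,
    fourier_add_ae (fourierMul m f) (fourierMul m g)] with η h1 h2 h3 h4 h5
  rw [h1, h5, h2, h3, h4, mul_add]

theorem fourierMul_sub {m : ℝ → ℂ} {f g : L2} (hf : MulDom m f) (hg : MulDom m g) :
    fourierMul m (f - g) = fourierMul m f - fourierMul m g := by
  apply fourier_injective
  filter_upwards [fourier_fourierMul_ae (hf.sub hg), fourier_fourierMul_ae hf,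
    fourier_fourierMul_ae hg, fourier_sub_ae f g,
    fourier_sub_ae (fourierMul m f) (fourierMul m g)] with η h1 h2 h3 h4 h5
  rw [h1, h5, h2, h3, h4, mul_sub]

theorem fourierMul_smul {m : ℝ → ℂ} {f : L2} (hf : MulDom m f) (c : ℂ) :
    fourierMul m (c • f) = c • fourierMul m f := by
  apply fourier_injective
  filter_upwards [fourier_fourierMul_ae (hf.smul c), fourier_fourierMul_ae hf,
    fourier_smul_ae c f, fourier_smul_ae c (fourierMul m f)] with η h1 h2 h4 h5
  rw [h1, h5, h2, h4]
  ring

theorem fourierMul_zero (m : ℝ → ℂ) : fourierMul m 0 = 0 := by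
  have h : MulDom m 0 := by
    refine (memLp_congr_ae ?_).1 (MemLp.zero (ε := ℂ))
    filter_upwards with η
    simp
  simpa using fourierMul_smul h 0

theorem fourierMul_fourierMul {m m' : ℝ → ℂ} {f : L2} (h : MulDom m' f) :
    fourierMul m (fourierMul m' f) = fourierMul (fun ξ => m ξ * m' ξ) f := by
  unfold fourierMul
  congr 1
  apply toL2_congr
  filter_upwards [fourier_fourierMul_ae h] with η h1
  simp only [fourierMul] at h1
  rw [h1, ← mul_assoc]

theorem MulDom.fourierMul_iff {m m' : ℝ → ℂ} {f : L2} (h : MulDom m' f) :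
    MulDom m (fourierMul m' f) ↔ MulDom (fun ξ => m ξ * m' ξ) f := by
  refine memLp_congr_ae ?_
  filter_upwards [fourier_fourierMul_ae h] with η h1
  rw [h1, ← mul_assoc]

theorem norm_fourierMul (m : ℝ → ℂ) (f : L2) :
    ‖fourierMul m f‖ = ‖toL2 fun η => m (2 * Real.pi * η) * (𝓕 f : L2) η‖ :=
  (Lp.fourierTransformₗᵢ ℝ ℂ).symm.norm_map _

theorem norm_fourier (f : L2) : ‖(𝓕 f : L2)‖ = ‖f‖ := Lp.norm_fourier_eq f

theorem aestronglyMeasurable_mul_fourier {m : ℝ → ℂ} (hm : Continuous m) (f : L2) :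
    AEStronglyMeasurable (fun η => m (2 * Real.pi * η) * (𝓕 f : L2) η) volume :=
  Continuous.aestronglyMeasurable (by fun_prop) |>.mul (Lp.aestronglyMeasurable _)

theorem MulDom.of_le {m m' : ℝ → ℂ} {f : L2} {C : ℝ} (hm : Continuous m) (h : MulDom m' f)
    (hle : ∀ ξ, ‖m ξ‖ ≤ C * ‖m' ξ‖) : MulDom m f := by
  refine MemLp.of_le_mul h (aestronglyMeasurable_mul_fourier hm f)
    (Filter.Eventually.of_forall fun η => (?_ : _ ≤ C * _))
  rw [norm_mul, norm_mul, ← mul_assoc]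
  gcongr
  exact hle _

theorem norm_fourierMul_le {m m' : ℝ → ℂ} {f : L2} {C : ℝ} (hm : Continuous m) (h : MulDom m' f)
    (hle : ∀ ξ, ‖m ξ‖ ≤ C * ‖m' ξ‖) : ‖fourierMul m f‖ ≤ C * ‖fourierMul m' f‖ := by
  rw [norm_fourierMul, norm_fourierMul]
  refine Lp.norm_le_mul_norm_of_ae_le_mul ?_
  filter_upwards [toL2_ae h, toL2_ae (MulDom.of_le hm h hle)] with η h1 h2
  rw [h1, h2, norm_mul, norm_mul, ← mul_assoc]
  gcongr
  exact hle _

theorem mulDom_one (f : L2) : MulDom (fun _ => 1) f := by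
  unfold MulDom
  simpa using Lp.memLp (𝓕 f : L2)

theorem fourierMul_one (f : L2) : fourierMul (fun _ => 1) f = f := by
  apply fourier_injective
  filter_upwards [fourier_fourierMul_ae (mulDom_one f)] with η h
  rw [h, one_mul]

theorem mulDom_of_bounded {m : ℝ → ℂ} (hm : Continuous m) {C : ℝ} (hle : ∀ ξ, ‖m ξ‖ ≤ C) (f : L2) :
    MulDom m f :=
  (mulDom_one f).of_le hm (C := C) (by simpa using hle)

theorem norm_fourierMul_le_of_bounded {m : ℝ → ℂ} (hm : Continuous m) {C : ℝ}
    (hle : ∀ ξ, ‖m ξ‖ ≤ C) (f : L2) : ‖fourierMul m f‖ ≤ C * ‖f‖ := by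
  have := norm_fourierMul_le hm (mulDom_one f) (C := C) (by simpa using hle)
  rwa [fourierMul_one] at this

theorem inner_eq_integral_fourier (f g : L2) :
    ⟪f, g⟫_ℂ = ∫ η, (𝓕 g : L2) η * conj ((𝓕 f : L2) η) := by
  rw [← Lp.inner_fourier_eq, L2.inner_def]
  simp

/-- By Plancherel the pairing sees the multipliers only through `conj m₁ · m₂`. Every passage to an
adjoint below, and every transfer of `J^s` or of a derivative across a pairing, is an instance. -/
theorem inner_fourierMul_fourierMul {m₁ m₂ m₃ m₄ : ℝ → ℂ} {f g : L2} (h₁ : MulDom m₁ f)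
    (h₂ : MulDom m₂ g) (h₃ : MulDom m₃ f) (h₄ : MulDom m₄ g)
    (h : ∀ ξ, conj (m₁ ξ) * m₂ ξ = conj (m₃ ξ) * m₄ ξ) :
    ⟪fourierMul m₁ f, fourierMul m₂ g⟫_ℂ = ⟪fourierMul m₃ f, fourierMul m₄ g⟫_ℂ := by
  rw [inner_eq_integral_fourier, inner_eq_integral_fourier]
  refine integral_congr_ae ?_
  filter_upwards [fourier_fourierMul_ae h₁, fourier_fourierMul_ae h₂, fourier_fourierMul_ae h₃,
    fourier_fourierMul_ae h₄] with η e1 e2 e3 e4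
  rw [e1, e2, e3, e4]
  simp only [map_mul]
  linear_combination (conj ((𝓕 f : L2) η) * (𝓕 g : L2) η) * h (2 * Real.pi * η)

theorem eLpNorm_two_sq {E : Type*} [NormedAddCommGroup E] (f : ℝ → E) : eLpNorm f 2 volume ^ 2 = ∫⁻ x, ‖f x‖ₑ ^ 2 := by
  have := eLpNorm_nnreal_pow_eq_lintegral (f := f) (μ := (volume : Measure ℝ)) (p := 2) (by norm_num)
  have h2 : (((2 : NNReal) : ℝ≥0∞)) = 2 := by norm_num
  rw [h2] at this
  simpa using this

theorem lintegral_enorm_sq (f : L2) : ∫⁻ x, ‖f x‖ₑ ^ 2 = ENNReal.ofReal (‖f‖ ^ 2) := by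
  rw [← eLpNorm_two_sq, ENNReal.ofReal_pow (norm_nonneg _), Lp.norm_def,
    ENNReal.ofReal_toReal (Lp.eLpNorm_ne_top _)]

/-! ### Band-limited functions -/

/-- The Fourier transform vanishes outside a bounded interval. -/
def BandLimited (ψ : L2) : Prop := ∃ N : ℝ, ∀ᵐ η : ℝ, N < |η| → (𝓕 ψ : L2) η = 0

/-- A continuous symbol is bounded on the compact frequency support. Hence every continuous
multiplier may be applied to a band-limited test function, whatever its growth. -/
theorem BandLimited.exists_bound {ψ : L2} (h : BandLimited ψ) {m : ℝ → ℂ} (hm : Continuous m) :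
    ∃ C : ℝ, 0 ≤ C ∧ ∀ᵐ η : ℝ, ‖m (2 * Real.pi * η) * (𝓕 ψ : L2) η‖ ≤ C * ‖(𝓕 ψ : L2) η‖ := by
  obtain ⟨N, hN⟩ := h
  have hc : Continuous fun η : ℝ => m (2 * Real.pi * η) := by fun_prop
  obtain ⟨C, hC⟩ := (isCompact_Icc (a := -N) (b := N)).exists_bound_of_continuousOn hc.continuousOn
  refine ⟨max C 0, le_max_right _ _, ?_⟩
  filter_upwards [hN] with η hη
  by_cases h1 : N < |η|
  · simp [hη h1]
  · rw [norm_mul]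
    gcongr
    exact (hC η (abs_le.1 (not_lt.1 h1))).trans (le_max_left _ _)

theorem BandLimited.mulDom {ψ : L2} (h : BandLimited ψ) {m : ℝ → ℂ} (hm : Continuous m) :
    MulDom m ψ := by
  obtain ⟨C, -, hC⟩ := h.exists_bound hm
  exact MemLp.of_le_mul (Lp.memLp _) (aestronglyMeasurable_mul_fourier hm ψ) hC

theorem BandLimited.fourierMul {ψ : L2} (h : BandLimited ψ) {m : ℝ → ℂ} (hm : Continuous m) :
    BandLimited (fourierMul m ψ) := by
  have := h.mulDom hm
  obtain ⟨N, hN⟩ := h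
  refine ⟨N, ?_⟩
  filter_upwards [hN, fourier_fourierMul_ae this] with η h1 h2 h3
  rw [h2, h1 h3, mul_zero]

theorem BandLimited.integrable {ψ : L2} (h : BandLimited ψ) : Integrable (𝓕 ψ : L2) := by
  obtain ⟨N, hN⟩ := h
  have h1 : IntegrableOn (𝓕 ψ : L2) (Icc (-N) N) :=
    ((Lp.memLp (𝓕 ψ : L2)).mono_measure Measure.restrict_le_self).integrable (by norm_num)
  have h2 := h1.integrable_indicator measurableSet_Icc
  refine h2.congr ?_
  filter_upwards [hN] with η hη
  by_cases h3 : η ∈ Icc (-N) N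
  · rw [indicator_of_mem h3]
  · rw [indicator_of_notMem h3, hη]
    rw [mem_Icc, ← abs_le] at h3
    exact not_le.1 h3

/-- The truncation of a square-integrable frequency profile is band-limited. -/
theorem exists_bandLimited {g : ℝ → ℂ} {N : ℝ} (hg : MemLp (indicator (Icc (-N) N) g) 2 volume) :
    ∃ ψ : L2, BandLimited ψ ∧ (𝓕 ψ : L2) =ᵐ[volume] indicator (Icc (-N) N) g := by
  have h : (𝓕 (𝓕⁻ (hg.toLp _) : L2) : L2) =ᵐ[volume] indicator (Icc (-N) N) g := by
    rw [fourier_fourierInv]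
    exact hg.coeFn_toLp
  refine ⟨𝓕⁻ (hg.toLp _), ⟨N, ?_⟩, h⟩
  filter_upwards [h] with η h1 h2
  rw [h1, indicator_of_notMem]
  rw [mem_Icc, ← abs_le]
  exact not_le.2 h2

/-! ### Bessel potentials and the spaces `H^s` -/

/-- The Japanese bracket `(1 + x²)^{1/2}`. -/
def jb (x : ℝ) : ℝ := Real.sqrt (1 + x ^ 2)

theorem jb_sq (x : ℝ) : jb x ^ 2 = 1 + x ^ 2 := Real.sq_sqrt (by positivity)

theorem one_le_jb (x : ℝ) : 1 ≤ jb x := by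
  rw [jb, Real.one_le_sqrt]
  nlinarith [sq_nonneg x]

theorem jb_pos (x : ℝ) : 0 < jb x := lt_of_lt_of_le one_pos (one_le_jb x)

theorem abs_le_jb (x : ℝ) : |x| ≤ jb x := Real.abs_le_sqrt (by linarith)

theorem continuous_jb : Continuous jb := by unfold jb; fun_prop

/-- The symbol `⟨ξ⟩^s` of the Bessel potential `J^s`. -/
def jsym (s : ℕ) (ξ : ℝ) : ℂ := ((jb ξ ^ s : ℝ) : ℂ)

theorem continuous_jsym (s : ℕ) : Continuous (jsym s) := by
  unfold jsym
  have := continuous_jb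
  fun_prop

theorem norm_jsym (s : ℕ) (ξ : ℝ) : ‖jsym s ξ‖ = jb ξ ^ s := by
  rw [jsym, Complex.norm_real, Real.norm_of_nonneg (pow_nonneg (jb_pos ξ).le s)]

/-- The Bessel potential `J^s = (1 - d²/dx²)^{s/2}`. -/
def bessel (s : ℕ) (f : L2) : L2 := fourierMul (jsym s) f

theorem sobDensity_eq (s : ℕ) (f : L2) (η : ℝ) :
    sobDensity s f η = ‖jsym s (2 * Real.pi * η) * (𝓕 f : L2) η‖ ^ 2 := by
  rw [sobDensity, norm_mul, norm_jsym, mul_pow (jb _ ^ s), ← pow_mul, mul_comm s 2, pow_mul, jb_sq]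

theorem memHs_iff {s : ℕ} {f : L2} : MemHs s f ↔ MulDom (jsym s) f := by
  unfold MemHs MulDom
  rw [memLp_two_iff_integrable_sq_norm (aestronglyMeasurable_mul_fourier (continuous_jsym s) f)]
  simp_rw [funext (sobDensity_eq s f)]

theorem hsNorm_eq {s : ℕ} {f : L2} (h : MemHs s f) : hsNorm s f = ‖bessel s f‖ := by
  have h' := memHs_iff.1 h
  rw [hsNorm, bessel, norm_fourierMul, Real.sqrt_eq_iff_mul_self_eq
    (integral_nonneg fun η => by rw [sobDensity_eq]; positivity) (norm_nonneg _), ← pow_two]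
  rw [← inner_self_eq_norm_sq (𝕜 := ℂ), L2.inner_def, ← integral_re (L2.integrable_inner _ _)]
  refine integral_congr_ae ?_
  filter_upwards [toL2_ae h'] with η hη
  rw [hη, sobDensity_eq, inner_self_eq_norm_sq (𝕜 := ℂ)]

theorem hsNorm_nonneg (s : ℕ) (f : L2) : 0 ≤ hsNorm s f := Real.sqrt_nonneg _

theorem MemHs.add {s : ℕ} {f g : L2} (hf : MemHs s f) (hg : MemHs s g) : MemHs s (f + g) :=
  memHs_iff.2 ((memHs_iff.1 hf).add (memHs_iff.1 hg))

theorem MemHs.sub {s : ℕ} {f g : L2} (hf : MemHs s f) (hg : MemHs s g) : MemHs s (f - g) :=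
  memHs_iff.2 ((memHs_iff.1 hf).sub (memHs_iff.1 hg))

theorem MemHs.smul {s : ℕ} {f : L2} (hf : MemHs s f) (c : ℂ) : MemHs s (c • f) :=
  memHs_iff.2 ((memHs_iff.1 hf).smul c)

theorem bessel_add {s : ℕ} {f g : L2} (hf : MemHs s f) (hg : MemHs s g) :
    bessel s (f + g) = bessel s f + bessel s g :=
  fourierMul_add (memHs_iff.1 hf) (memHs_iff.1 hg)

theorem bessel_sub {s : ℕ} {f g : L2} (hf : MemHs s f) (hg : MemHs s g) :
    bessel s (f - g) = bessel s f - bessel s g :=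
  fourierMul_sub (memHs_iff.1 hf) (memHs_iff.1 hg)

theorem bessel_smul {s : ℕ} {f : L2} (hf : MemHs s f) (c : ℂ) :
    bessel s (c • f) = c • bessel s f :=
  fourierMul_smul (memHs_iff.1 hf) c

theorem hsNorm_add_le {s : ℕ} {f g : L2} (hf : MemHs s f) (hg : MemHs s g) :
    hsNorm s (f + g) ≤ hsNorm s f + hsNorm s g := by
  rw [hsNorm_eq hf, hsNorm_eq hg, hsNorm_eq (hf.add hg), bessel_add hf hg]
  exact norm_add_le _ _

theorem hsNorm_sub_le {s : ℕ} {f g : L2} (hf : MemHs s f) (hg : MemHs s g) :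
    hsNorm s (f - g) ≤ hsNorm s f + hsNorm s g := by
  rw [hsNorm_eq hf, hsNorm_eq hg, hsNorm_eq (hf.sub hg), bessel_sub hf hg]
  exact norm_sub_le _ _

theorem hsNorm_smul {s : ℕ} {f : L2} (hf : MemHs s f) (c : ℂ) :
    hsNorm s (c • f) = ‖c‖ * hsNorm s f := by
  rw [hsNorm_eq hf, hsNorm_eq (hf.smul c), bessel_smul hf, norm_smul]

theorem MemHs.zero (s : ℕ) : MemHs s 0 := by
  unfold MemHs
  refine (integrable_zero ℝ ℝ volume).congr ?_
  filter_upwards with η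
  simp [sobDensity]

theorem hsNorm_zero (s : ℕ) : hsNorm s 0 = 0 := by
  have := hsNorm_smul (MemHs.zero s) 0
  simpa using this

theorem MemHs.mulDom {s : ℕ} {f : L2} (hf : MemHs s f) {m : ℝ → ℂ} (hm : Continuous m) {C : ℝ}
    (hle : ∀ ξ, ‖m ξ‖ ≤ C * jb ξ ^ s) : MulDom m f :=
  (memHs_iff.1 hf).of_le hm (C := C) (by simpa only [norm_jsym] using hle)

theorem MemHs.norm_fourierMul_le {s : ℕ} {f : L2} (hf : MemHs s f) {m : ℝ → ℂ} (hm : Continuous m)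
    {C : ℝ} (hle : ∀ ξ, ‖m ξ‖ ≤ C * jb ξ ^ s) : ‖fourierMul m f‖ ≤ C * hsNorm s f := by
  rw [hsNorm_eq hf, bessel]
  exact CombinedKdV.norm_fourierMul_le hm (memHs_iff.1 hf) (by simpa only [norm_jsym] using hle)

theorem MemHs.mono {s r : ℕ} (h : r ≤ s) {f : L2} (hf : MemHs s f) : MemHs r f := by
  refine memHs_iff.2 (hf.mulDom (continuous_jsym r) (C := 1) fun ξ => ?_)
  rw [norm_jsym, one_mul]
  exact pow_le_pow_right₀ (one_le_jb ξ) h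

theorem hsNorm_mono {s r : ℕ} (h : r ≤ s) {f : L2} (hf : MemHs s f) : hsNorm r f ≤ hsNorm s f := by
  rw [hsNorm_eq (hf.mono h), bessel, ← one_mul (hsNorm s f)]
  refine hf.norm_fourierMul_le (continuous_jsym r) (C := 1) fun ξ => ?_
  rw [norm_jsym, one_mul]
  exact pow_le_pow_right₀ (one_le_jb ξ) h

theorem norm_le_hsNorm {s : ℕ} {f : L2} (hf : MemHs s f) : ‖f‖ ≤ hsNorm s f := by
  have := hf.norm_fourierMul_le (m := fun _ => 1) continuous_const (C := 1) fun ξ => by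
    simpa using one_le_pow₀ (one_le_jb ξ)
  rwa [fourierMul_one, one_mul] at this

/-- Interpolation: `‖f‖_1² ≤ ‖f‖_0 ‖f‖_2`. -/
theorem hsNorm_one_sq_le {f : L2} (hf : MemHs 2 f) : hsNorm 1 f ^ 2 ≤ ‖f‖ * hsNorm 2 f := by
  have h1 := hf.mono one_le_two
  have e := inner_fourierMul_fourierMul (memHs_iff.1 h1) (memHs_iff.1 h1) (mulDom_one f)
    (memHs_iff.1 hf) fun ξ => by
      simp only [jsym, Complex.conj_ofReal, map_one, one_mul, ← Complex.ofReal_mul]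
      congr 1; ring
  rw [fourierMul_one] at e
  rw [hsNorm_eq h1, hsNorm_eq hf, ← inner_self_eq_norm_sq (𝕜 := ℂ), bessel, e]
  exact re_inner_le_norm _ _

/-- Duality characterization of `H^s` and its norm, with band-limited test functions. -/
theorem memHs_of_inner_le {s : ℕ} {f : L2} {C : ℝ} (hC : 0 ≤ C)
    (h : ∀ ψ : L2, BandLimited ψ → ‖⟪bessel s ψ, f⟫_ℂ‖ ≤ C * ‖ψ‖) :
    MemHs s f ∧ hsNorm s f ≤ C := by
  have meas : AEStronglyMeasurable (fun η => jsym s (2 * Real.pi * η) * (𝓕 f : L2) η) volume :=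
    aestronglyMeasurable_mul_fourier (continuous_jsym s) f
  have key : ∀ N : ℕ, ∫⁻ η in Icc (-(N : ℝ)) N,
      ‖jsym s (2 * Real.pi * η) * (𝓕 f : L2) η‖ₑ ^ 2 ≤ ENNReal.ofReal (C ^ 2) := by
    intro N
    set g : ℝ → ℂ := fun η => jsym s (2 * Real.pi * η) * (𝓕 f : L2) η with hg
    have hmem : MemLp (indicator (Icc (-(N : ℝ)) N) g) 2 volume := by
      have hc : Continuous fun η : ℝ => jsym s (2 * Real.pi * η) := by
        have := continuous_jsym s
        fun_prop
      obtain ⟨B, hB⟩ := (isCompact_Icc (a := -(N : ℝ)) (b := N)).exists_bound_of_continuousOn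
        hc.continuousOn
      refine MemLp.of_le_mul (c := max B 0) (Lp.memLp (𝓕 f : L2))
        (meas.indicator measurableSet_Icc) (Filter.Eventually.of_forall fun η => ?_)
      by_cases hη : η ∈ Icc (-(N : ℝ)) N
      · rw [indicator_of_mem hη, hg, norm_mul]
        gcongr
        exact (hB η hη).trans (le_max_left _ _)
      · rw [indicator_of_notMem hη, norm_zero]
        positivity
    -- The extremal test function has transform `⟨ξ⟩^s f̂` cut off to `[-N, N]`. Its pairing equals
    -- `‖ψ‖²`, so `‖ψ‖ ≤ C` uniformly in `N`, and `N → ∞` follows by monotone convergence.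
    obtain ⟨ψ, hψ, hψe⟩ := exists_bandLimited hmem
    have e1 : ⟪bessel s ψ, f⟫_ℂ = ⟪ψ, ψ⟫_ℂ := by
      rw [inner_eq_integral_fourier, inner_eq_integral_fourier]
      refine integral_congr_ae ?_
      filter_upwards [fourier_fourierMul_ae (hψ.mulDom (continuous_jsym s)), hψe] with η h1 h2
      rw [bessel, h1, h2]
      by_cases hη : η ∈ Icc (-(N : ℝ)) N
      · rw [indicator_of_mem hη, hg]
        simp only [map_mul, jsym, Complex.conj_ofReal]
        ring
      · rw [indicator_of_notMem hη]
        simp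
    have e2 : ‖ψ‖ ≤ C := by
      have h3 := h ψ hψ
      rw [e1, inner_self_eq_norm_sq_to_K, norm_pow] at h3
      simp only [Complex.coe_algebraMap, Complex.norm_real,
        norm_norm] at h3
      by_contra hlt
      push Not at hlt
      nlinarith [norm_nonneg ψ]
    calc ∫⁻ η in Icc (-(N : ℝ)) N, ‖g η‖ₑ ^ 2 = ∫⁻ η, ‖(𝓕 ψ : L2) η‖ₑ ^ 2 := by
          rw [← lintegral_indicator measurableSet_Icc]
          refine lintegral_congr_ae ?_
          filter_upwards [hψe] with η h2
          rw [h2]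
          by_cases hη : η ∈ Icc (-(N : ℝ)) N
          · rw [indicator_of_mem hη, indicator_of_mem hη]
          · rw [indicator_of_notMem hη, indicator_of_notMem hη]
            simp
      _ = ENNReal.ofReal (‖ψ‖ ^ 2) := by rw [lintegral_enorm_sq, norm_fourier]
      _ ≤ _ := ENNReal.ofReal_le_ofReal (by gcongr)
  have tot : ∫⁻ η, ‖jsym s (2 * Real.pi * η) * (𝓕 f : L2) η‖ₑ ^ 2 ≤ ENNReal.ofReal (C ^ 2) := by
    have hU : (⋃ N : ℕ, Icc (-(N : ℝ)) N) = univ := by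
      refine eq_univ_of_forall fun x => ?_
      obtain ⟨N, hN⟩ := exists_nat_ge |x|
      exact mem_iUnion.2 ⟨N, abs_le.1 hN⟩
    rw [← setLIntegral_univ, ← hU, setLIntegral_iUnion_of_directed]
    · exact iSup_le key
    · refine Monotone.directed_le fun a b hab => Icc_subset_Icc ?_ ?_
      · simpa using hab
      · simpa using hab
  have hdom : MulDom (jsym s) f := by
    refine ⟨meas, ?_⟩
    have h5 : eLpNorm (fun η => jsym s (2 * Real.pi * η) * (𝓕 f : L2) η) 2 volume ^ 2 < ⊤ := by
      rw [eLpNorm_two_sq]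
      exact tot.trans_lt ENNReal.ofReal_lt_top
    exact (ENNReal.pow_lt_top_iff.1 h5).resolve_right (by norm_num)
  have hm := memHs_iff.2 hdom
  refine ⟨hm, ?_⟩
  rw [hsNorm_eq hm]
  have h6 := lintegral_enorm_sq (𝓕 (bessel s f) : L2)
  rw [lintegral_congr_ae (g := fun η => ‖jsym s (2 * Real.pi * η) * (𝓕 f : L2) η‖ₑ ^ 2)
    ((fourier_fourierMul_ae hdom).mono fun η hη => by rw [bessel, hη]), norm_fourier] at h6
  rw [h6] at tot
  have h7 := (ENNReal.ofReal_le_ofReal_iff (by positivity)).1 tot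
  exact (pow_le_pow_iff_left₀ (norm_nonneg _) hC two_ne_zero).1 h7

theorem inner_bessel_left {s : ℕ} {f ψ : L2} (hf : MemHs s f) (hψ : BandLimited ψ) :
    ⟪bessel s ψ, f⟫_ℂ = ⟪ψ, bessel s f⟫_ℂ := by
  have := inner_fourierMul_fourierMul (hψ.mulDom (continuous_jsym s)) (mulDom_one f)
    (mulDom_one ψ) (memHs_iff.1 hf) fun ξ => by simp [jsym]
  rwa [fourierMul_one, fourierMul_one] at this

/-- Balls of `H^s` are closed in `L²`. -/
theorem memHs_of_tendsto {s : ℕ} {f : ℕ → L2} {g : L2} {C : ℝ}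
    (hf : ∀ᶠ k in Filter.atTop, MemHs s (f k) ∧ hsNorm s (f k) ≤ C)
    (hlim : Filter.Tendsto f Filter.atTop (nhds g)) : MemHs s g ∧ hsNorm s g ≤ C := by
  obtain ⟨k, hk⟩ := hf.exists
  refine memHs_of_inner_le ((hsNorm_nonneg s _).trans hk.2) fun ψ hψ => ?_
  have ht : Filter.Tendsto (fun k => ‖⟪bessel s ψ, f k⟫_ℂ‖) Filter.atTop
      (nhds ‖⟪bessel s ψ, g⟫_ℂ‖) := (tendsto_const_nhds.inner hlim).norm
  refine le_of_tendsto ht ?_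
  filter_upwards [hf] with k hk
  rw [inner_bessel_left hk.1 hψ]
  refine (norm_inner_le_norm _ _).trans ?_
  rw [mul_comm, ← hsNorm_eq hk.1]
  gcongr
  exact hk.2

/-! ### Sobolev embedding and bilinear estimates in frequency -/

/-- The weight `⟨2πη⟩^{-2}`, of total mass `1/2`. -/
def wt (η : ℝ) : ℝ := (1 + (2 * Real.pi * η) ^ 2)⁻¹

theorem wt_nonneg (η : ℝ) : 0 ≤ wt η := by unfold wt; positivity

theorem continuous_wt : Continuous wt := by
  unfold wt
  exact Continuous.inv₀ (by fun_prop) fun η => by positivity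

theorem integrable_wt : Integrable wt :=
  integrable_inv_one_add_sq.comp_mul_left' (R := 2 * Real.pi) (by positivity)

theorem lintegral_wt : ∫⁻ η, ENNReal.ofReal (wt η) = ENNReal.ofReal (1 / 2) := by
  rw [← ofReal_integral_eq_lintegral_ofReal integrable_wt (Filter.Eventually.of_forall wt_nonneg)]
  congr 1
  unfold wt
  rw [Measure.integral_comp_mul_left (fun x : ℝ => (1 + x ^ 2)⁻¹) (2 * Real.pi),
    integral_univ_inv_one_add_sq, abs_of_pos (by positivity), smul_eq_mul]
  field_simp

theorem sqrt_wt (η : ℝ) : Real.sqrt (wt η) = (jb (2 * Real.pi * η))⁻¹ := by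
  rw [wt, Real.sqrt_inv, jb]

theorem lintegral_mul_sq_le {μ : Measure ℝ} {f g : ℝ → ℝ≥0∞} (hf : AEMeasurable f μ)
    (hg : AEMeasurable g μ) :
    (∫⁻ x, f x * g x ∂μ) ^ 2 ≤ (∫⁻ x, f x ^ 2 ∂μ) * ∫⁻ x, g x ^ 2 ∂μ := by
  have h := ENNReal.lintegral_mul_le_Lp_mul_Lq μ Real.HolderConjugate.two_two hf hg
  simp only [Pi.mul_apply, ENNReal.rpow_two] at h
  calc (∫⁻ x, f x * g x ∂μ) ^ 2
      ≤ ((∫⁻ x, f x ^ 2 ∂μ) ^ (1 / (2 : ℝ)) * (∫⁻ x, g x ^ 2 ∂μ) ^ (1 / (2 : ℝ))) ^ 2 := by gcongr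
    _ = _ := by
      rw [mul_pow, ← ENNReal.rpow_two, ← ENNReal.rpow_two, ← ENNReal.rpow_mul, ← ENNReal.rpow_mul]
      norm_num

theorem enorm_fourier_eq {s : ℕ} {f : L2} (hf : MemHs s f) : ∀ᵐ η : ℝ,
    ‖(𝓕 (bessel s f) : L2) η‖ₑ = ENNReal.ofReal (jb (2 * Real.pi * η) ^ s) * ‖(𝓕 f : L2) η‖ₑ := by
  filter_upwards [fourier_fourierMul_ae (memHs_iff.1 hf)] with η h
  rw [bessel, h, enorm_mul, ← ofReal_norm (jsym _ _), norm_jsym]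

/-- Cauchy–Schwarz for `⟨ξ⟩^{-1} · ⟨ξ⟩ f̂`. Since `wt` has mass 1/2, the constant is below 1. -/
theorem lintegral_enorm_fourier_le {f : L2} (hf : MemHs 1 f) :
    ∫⁻ η, ‖(𝓕 f : L2) η‖ₑ ≤ ENNReal.ofReal (hsNorm 1 f) := by
  have e : ∫⁻ η, ‖(𝓕 f : L2) η‖ₑ
      = ∫⁻ η, ENNReal.ofReal (Real.sqrt (wt η)) * ‖(𝓕 (bessel 1 f) : L2) η‖ₑ := by
    refine lintegral_congr_ae ?_
    filter_upwards [enorm_fourier_eq hf] with η h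
    have hj := jb_pos (2 * Real.pi * η)
    rw [h, ← mul_assoc, ← ENNReal.ofReal_mul (Real.sqrt_nonneg _), sqrt_wt, pow_one,
      inv_mul_cancel₀ hj.ne', ENNReal.ofReal_one, one_mul]
  have h2 := lintegral_mul_sq_le (f := fun η => ENNReal.ofReal (Real.sqrt (wt η)))
    (g := fun η => ‖(𝓕 (bessel 1 f) : L2) η‖ₑ)
    (ENNReal.measurable_ofReal.comp (Real.continuous_sqrt.comp continuous_wt).measurable).aemeasurable
    (Lp.aestronglyMeasurable _).enorm
  rw [← e, lintegral_enorm_sq, norm_fourier, ← hsNorm_eq hf] at h2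
  have h3 : ∫⁻ η, ENNReal.ofReal (Real.sqrt (wt η)) ^ 2 = ENNReal.ofReal (1 / 2) := by
    rw [← lintegral_wt]
    refine lintegral_congr fun η => ?_
    rw [← ENNReal.ofReal_pow (Real.sqrt_nonneg _), Real.sq_sqrt (wt_nonneg η)]
  rw [h3, ← ENNReal.ofReal_mul (by norm_num)] at h2
  refine (ENNReal.pow_le_pow_left_iff two_ne_zero).1 (h2.trans ?_)
  rw [← ENNReal.ofReal_pow (hsNorm_nonneg _ _)]
  apply ENNReal.ofReal_le_ofReal
  nlinarith [sq_nonneg (hsNorm 1 f)]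

theorem MemHs.integrable_fourier {f : L2} (hf : MemHs 1 f) : Integrable (𝓕 f : L2) :=
  ⟨Lp.aestronglyMeasurable _,
    (lintegral_enorm_fourier_le hf).trans_lt ENNReal.ofReal_lt_top⟩

/-- Sobolev embedding `H¹ ⊂ L^∞`. -/
theorem ae_norm_le_hsNorm_one {f : L2} (hf : MemHs 1 f) : ∀ᵐ x : ℝ, ‖f x‖ ≤ hsNorm 1 f := by
  have h1 := fourierInv_ae_eq hf.integrable_fourier
  rw [fourierInv_fourier] at h1
  filter_upwards [h1] with x hx
  rw [hx, Real.fourierInv_eq]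
  rw [← ENNReal.ofReal_le_ofReal_iff (hsNorm_nonneg _ _), ofReal_norm]
  refine (enorm_integral_le_lintegral_enorm _).trans ((le_of_eq ?_).trans
    (lintegral_enorm_fourier_le hf))
  refine lintegral_congr fun η => ?_
  rw [Circle.smul_def, enorm_smul, ← ofReal_norm ((Real.fourierChar _ : ℂ)), Circle.norm_coe]
  simp

/-- Pointwise multiplication (meaningful when the product is in `L²`). -/
def mulL2 (g h : L2) : L2 := toL2 fun x => g x * h x

theorem memLp_mul {g : L2} (hg : MemHs 1 g) (h : L2) : MemLp (fun x => g x * h x) 2 volume := by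
  refine MemLp.of_le_mul (c := hsNorm 1 g) (Lp.memLp h)
    ((Lp.aestronglyMeasurable g).mul (Lp.aestronglyMeasurable h)) ?_
  filter_upwards [ae_norm_le_hsNorm_one hg] with x hx
  rw [norm_mul]
  gcongr

theorem mulL2_ae {g : L2} (hg : MemHs 1 g) (h : L2) :
    (mulL2 g h : ℝ → ℂ) =ᵐ[volume] fun x => g x * h x := toL2_ae (memLp_mul hg h)

theorem fourier_mulL2_ae {g : L2} (hg : MemHs 1 g) (h : L2) : (𝓕 (mulL2 g h) : L2) =ᵐ[volume]
    fun η => ∫ y, (𝓕 g : L2) y * (𝓕 h : L2) (η - y) := by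
  have h1 := mulL2_ae hg h
  have h2 : Integrable (mulL2 g h) := (integrable_mul g h).congr h1.symm
  filter_upwards [fourier_ae_eq h2] with η hη
  rw [hη, ← fourier_mul_eq_convolution, Real.fourier_eq, Real.fourier_eq]
  refine integral_congr_ae ?_
  filter_upwards [h1] with x hx
  rw [hx]

/-- Cauchy–Schwarz in `y` at fixed `η`: the squared kernel integrates to exactly `c²`, as each of
`wt y` and `wt (η - y)` has mass 1/2. Tonelli and translation invariance then separate `a` from `b`.
-/
theorem lintegral_kernel_sq_le (a b : L2) {c : ℝ} (hc : 0 ≤ c) :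
    ∫⁻ η, (∫⁻ y, ENNReal.ofReal (c * Real.sqrt (wt y + wt (η - y))) * (‖a y‖ₑ * ‖b (η - y)‖ₑ)) ^ 2
      ≤ ENNReal.ofReal ((c * (‖a‖ * ‖b‖)) ^ 2) := by
  have ma : Measurable fun y => ‖a y‖ₑ := (Lp.stronglyMeasurable a).enorm
  have mb : Measurable fun y => ‖b y‖ₑ := (Lp.stronglyMeasurable b).enorm
  have hk : ∀ η : ℝ, ∫⁻ y, ENNReal.ofReal (c * Real.sqrt (wt y + wt (η - y))) ^ 2
      = ENNReal.ofReal (c ^ 2) := by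
    intro η
    have e : ∀ y, ENNReal.ofReal (c * Real.sqrt (wt y + wt (η - y))) ^ 2
        = ENNReal.ofReal (c ^ 2) * (ENNReal.ofReal (wt y) + ENNReal.ofReal (wt (η - y))) := by
      intro y
      have h1 := wt_nonneg y
      have h2 := wt_nonneg (η - y)
      rw [← ENNReal.ofReal_pow (by positivity), mul_pow, Real.sq_sqrt (by positivity),
        ENNReal.ofReal_mul (by positivity), ENNReal.ofReal_add h1 h2]
    have mw' : Measurable wt := continuous_wt.measurable
    have mw : Measurable fun y => ENNReal.ofReal (wt y) :=
      ENNReal.measurable_ofReal.comp continuous_wt.measurable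
    simp_rw [e]
    rw [lintegral_const_mul _ (by fun_prop),
      lintegral_add_left mw, lintegral_sub_left_eq_self (fun y => ENNReal.ofReal (wt y)),
      lintegral_wt, ← ENNReal.ofReal_add (by norm_num) (by norm_num)]
    norm_num
  have hm : ∀ η : ℝ, Measurable fun y => ENNReal.ofReal (c * Real.sqrt (wt y + wt (η - y))) := by
    intro η
    have := continuous_wt
    exact ENNReal.measurable_ofReal.comp (Continuous.measurable (by fun_prop))
  calc _ ≤ ∫⁻ η, ENNReal.ofReal (c ^ 2) * ∫⁻ y, ‖a y‖ₑ ^ 2 * ‖b (η - y)‖ₑ ^ 2 := by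
        refine lintegral_mono fun η => ?_
        refine (lintegral_mul_sq_le (hm η).aemeasurable
          (ma.mul (mb.comp (measurable_const.sub measurable_id))).aemeasurable).trans ?_
        rw [hk]
        exact le_of_eq (by simp only [Pi.mul_apply, mul_pow]; rfl)
    _ = ENNReal.ofReal (c ^ 2) * ∫⁻ η, ∫⁻ y, ‖a y‖ₑ ^ 2 * ‖b (η - y)‖ₑ ^ 2 := by
        rw [lintegral_const_mul]
        exact Measurable.lintegral_prod_right'
          (f := fun p : ℝ × ℝ => ‖a p.2‖ₑ ^ 2 * ‖b (p.1 - p.2)‖ₑ ^ 2) (by fun_prop)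
    _ = ENNReal.ofReal (c ^ 2) * ∫⁻ y, ∫⁻ η, ‖a y‖ₑ ^ 2 * ‖b (η - y)‖ₑ ^ 2 := by
        rw [lintegral_lintegral_swap]
        exact Measurable.aemeasurable (by unfold Function.uncurry; fun_prop)
    _ = ENNReal.ofReal (c ^ 2) * ∫⁻ y, ‖a y‖ₑ ^ 2 * ENNReal.ofReal (‖b‖ ^ 2) := by
        congr 1
        refine lintegral_congr fun y => ?_
        rw [lintegral_const_mul _ (by fun_prop),
          lintegral_sub_right_eq_self (fun η => ‖b η‖ₑ ^ 2), lintegral_enorm_sq]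
    _ = _ := by
        rw [lintegral_mul_const _ (by fun_prop), lintegral_enorm_sq,
          ← ENNReal.ofReal_mul (by positivity), ← ENNReal.ofReal_mul (by positivity)]
        congr 1
        ring

/-- A bilinear Fourier operator, applied to `g, h ∈ H^s`, is bounded on `L²` when its symbol is at
most `c (⟨ξ₁⟩^{-2} + ⟨ξ₂⟩^{-2})^{1/2} ⟨ξ₁⟩^s ⟨ξ₂⟩^s`. -/
theorem memLp_bilinear_fourier {s : ℕ} {g h : L2} (hg : MemHs s g) (hh : MemHs s h) {F : ℝ → ℂ}
    (hF : AEStronglyMeasurable F volume) {c : ℝ} (hc : 0 ≤ c) {σ : ℝ → ℝ → ℂ}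
    (hσ : ∀ y z, ‖σ y z‖ ≤ c * Real.sqrt (wt y + wt z) *
      (jb (2 * Real.pi * y) ^ s * jb (2 * Real.pi * z) ^ s))
    (h1 : ∀ᵐ η : ℝ, F η = ∫ y, σ y (η - y) * ((𝓕 g : L2) y * (𝓕 h : L2) (η - y))) :
    MemLp F 2 volume ∧ eLpNorm F 2 volume ≤ ENNReal.ofReal (c * (hsNorm s g * hsNorm s h)) := by
  have hpt : ∀ᵐ η : ℝ, ‖F η‖ₑ ≤ ∫⁻ y, ENNReal.ofReal (c * Real.sqrt (wt y + wt (η - y))) *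
      (‖(𝓕 (bessel s g) : L2) y‖ₑ * ‖(𝓕 (bessel s h) : L2) (η - y)‖ₑ) := by
    filter_upwards [h1] with η hη
    rw [hη]
    refine (enorm_integral_le_lintegral_enorm _).trans (lintegral_mono_ae ?_)
    filter_upwards [enorm_fourier_eq hg,
      (Measure.measurePreserving_sub_left volume η).quasiMeasurePreserving.ae
        (enorm_fourier_eq hh)] with y e1 e2
    rw [e1, e2, enorm_mul, enorm_mul]
    calc _ ≤ ENNReal.ofReal (c * Real.sqrt (wt y + wt (η - y)) *
          (jb (2 * Real.pi * y) ^ s * jb (2 * Real.pi * (η - y)) ^ s)) *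
          (‖(𝓕 g : L2) y‖ₑ * ‖(𝓕 h : L2) (η - y)‖ₑ) := by
          gcongr
          rw [← ofReal_norm]
          exact ENNReal.ofReal_le_ofReal (hσ _ _)
      _ = _ := by
          have j1 := (jb_pos (2 * Real.pi * y)).le
          have j2 := (jb_pos (2 * Real.pi * (η - y))).le
          rw [ENNReal.ofReal_mul (by positivity), ENNReal.ofReal_mul (q := jb _ ^ s) (by positivity)]
          ring
  have hle : eLpNorm F 2 volume ≤ ENNReal.ofReal (c * (hsNorm s g * hsNorm s h)) := by
    have n1 := hsNorm_nonneg s g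
    have n2 := hsNorm_nonneg s h
    refine (ENNReal.pow_le_pow_left_iff two_ne_zero).1 ?_
    rw [eLpNorm_two_sq, ← ENNReal.ofReal_pow (by positivity)]
    refine (lintegral_mono_ae (hpt.mono fun η h => pow_le_pow_left' h 2)).trans ?_
    refine (lintegral_kernel_sq_le _ _ hc).trans ?_
    rw [norm_fourier, norm_fourier, ← hsNorm_eq hg, ← hsNorm_eq hh]
  exact ⟨⟨hF, hle.trans_lt ENNReal.ofReal_lt_top⟩, hle⟩

theorem norm_toL2_le {F : ℝ → ℂ} (hF : MemLp F 2 volume) {C : ℝ} (hC : 0 ≤ C)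
    (h : eLpNorm F 2 volume ≤ ENNReal.ofReal C) : ‖toL2 F‖ ≤ C := by
  rw [Lp.norm_def, eLpNorm_congr_ae (toL2_ae hF)]
  exact ENNReal.toReal_le_of_le_ofReal hC h

/-! ### Inequalities for the symbol `⟨ξ⟩^s` -/

/-- After squaring, the difference of the two sides is `((2xy - 1)² + (x - y)²) / 3`, so 4/3 is
optimal. Sharpness matters: with `√2` for `√(4/3)` the product `comC s * algC s` would grow like `s
2^s`, beyond the `√s 2^s` of `alpha`. -/
theorem jb_add_le (x y : ℝ) : jb (x + y) ≤ Real.sqrt (4 / 3) * (jb x * jb y) := by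
  unfold jb
  rw [← Real.sqrt_mul (by positivity), ← Real.sqrt_mul (by norm_num)]
  apply Real.sqrt_le_sqrt
  nlinarith [sq_nonneg (2 * x * y - 1), sq_nonneg (x - y)]

theorem jb_le_two_mul {x y : ℝ} (h : |x| ≤ |y|) : jb (x + y) ≤ 2 * jb y := by
  have h1 := sq_le_sq.2 h
  refine abs_le_of_sq_le_sq' (a := jb (x + y)) (b := 2 * jb y) ?_
    (by linarith [one_le_jb y]) |>.2
  rw [mul_pow, jb_sq, jb_sq]
  nlinarith [sq_nonneg (x - y)]

theorem jb_mono {x y : ℝ} (h : |x| ≤ |y|) : jb x ≤ jb y := by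
  unfold jb
  have h1 := sq_le_sq.2 h
  gcongr Real.sqrt (1 + ?_)

theorem abs_jb_sub_le (x y : ℝ) : |jb (x + y) - jb y| ≤ |x| := by
  have h1 := jb_sq (x + y)
  have h2 := jb_sq y
  have h3 := abs_le_jb (x + y)
  have h4 := abs_le_jb y
  have h5 := jb_pos y
  have h6 := jb_pos (x + y)
  have e : (jb (x + y) - jb y) * (jb (x + y) + jb y) = x * ((x + y) + y) := by nlinarith
  have h7 : |jb (x + y) - jb y| * (jb (x + y) + jb y) = |x| * |(x + y) + y| := by
    rw [← abs_mul, ← e, abs_mul, abs_of_pos (add_pos h6 h5)]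
  have h8 : |x| * |(x + y) + y| ≤ |x| * (jb (x + y) + jb y) := by
    gcongr
    exact (abs_add_le _ _).trans (add_le_add h3 h4)
  rw [← h7] at h8
  exact le_of_mul_le_mul_right h8 (add_pos h6 h5)

theorem wt_eq (y : ℝ) : wt y = (jb (2 * Real.pi * y) ^ 2)⁻¹ := by rw [wt, jb_sq]

/-- The constant of the algebra property of `H^s`. -/
def algC (s : ℕ) : ℝ := Real.sqrt 2 * Real.sqrt (4 / 3) ^ (s - 1)

theorem algC_nonneg (s : ℕ) : 0 ≤ algC s := by unfold algC; positivity

/-- This is `⟨x + y⟩² ≤ 2(⟨x⟩² + ⟨y⟩²)` with `⟨x⟩²⟨y⟩²` factored out, in the shape that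
`memLp_bilinear_fourier` requires. In `alg_symbol_le` one factor `⟨x + y⟩` is spent on it and the
other `s - 1` on `jb_add_le`. -/
theorem jb_add_le_sqrt (x y : ℝ) :
    jb (x + y) ≤ Real.sqrt 2 * Real.sqrt ((jb x ^ 2)⁻¹ + (jb y ^ 2)⁻¹) * (jb x * jb y) := by
  have hx := jb_pos x
  have hy := jb_pos y
  have e : Real.sqrt 2 * Real.sqrt ((jb x ^ 2)⁻¹ + (jb y ^ 2)⁻¹) * (jb x * jb y)
      = Real.sqrt (2 * (jb x ^ 2 + jb y ^ 2)) := by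
    rw [← Real.sqrt_sq (mul_pos hx hy).le, ← Real.sqrt_mul (by norm_num),
      ← Real.sqrt_mul (by positivity)]
    congr 1
    field_simp
    ring
  rw [e, jb_sq, jb_sq, jb]
  apply Real.sqrt_le_sqrt
  nlinarith [sq_nonneg (x - y)]

theorem alg_symbol_le {s : ℕ} (hs : 1 ≤ s) (x y : ℝ) :
    jb (x + y) ^ s ≤ algC s * Real.sqrt ((jb x ^ 2)⁻¹ + (jb y ^ 2)⁻¹) * (jb x ^ s * jb y ^ s) := by
  obtain ⟨r, rfl⟩ := Nat.exists_eq_add_of_le' hs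
  have h0 := (jb_pos (x + y)).le
  have hx := (jb_pos x).le
  have hy := (jb_pos y).le
  calc jb (x + y) ^ (r + 1) = jb (x + y) ^ r * jb (x + y) := pow_succ _ _
    _ ≤ (Real.sqrt (4 / 3) * (jb x * jb y)) ^ r *
        (Real.sqrt 2 * Real.sqrt ((jb x ^ 2)⁻¹ + (jb y ^ 2)⁻¹) * (jb x * jb y)) := by
        gcongr
        · exact jb_add_le x y
        · exact jb_add_le_sqrt x y
    _ = _ := by
        rw [algC, Nat.add_sub_cancel]
        ring

/-- The constant of the commutator estimate. -/
def comC (s : ℕ) : ℝ := 4 * s * Real.sqrt (4 / 3) ^ (s - 2) + 2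

theorem comC_nonneg (s : ℕ) : 0 ≤ comC s := by unfold comC; positivity

theorem abs_pow_sub_le {a b : ℝ} (ha : 0 ≤ a) (hb : 0 ≤ b) (s : ℕ) :
    |a ^ s - b ^ s| ≤ s * |a - b| * max a b ^ (s - 1) := by
  have := abs_pow_sub_pow_le a b s
  rw [abs_of_nonneg ha, abs_of_nonneg hb] at this
  linarith [mul_comm (|a - b|) (s : ℝ), this, mul_assoc (|a-b|) (s:ℝ) (max a b ^ (s-1))]

/-- The larger frequency `y` absorbs the derivatives. With `M = max ⟨x + y⟩ ⟨y⟩`, the mean value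
inequality bounds `⟨x + y⟩ |⟨x + y⟩^s - ⟨y⟩^s|` by `s ⟨x⟩ M^s`; two factors `M` are at most `2⟨y⟩`
(whence the 4 in `comC`), the other `s - 2` at most `√(4/3) ⟨x⟩⟨y⟩`. The leftover `⟨x + y⟩⟨x⟩^s`
gives the summand 2, using `⟨x⟩⟨y⟩ ≤ ⟨y⟩^s`, which needs `s ≥ 2`. -/
theorem com_symbol_le_of_abs_le {s : ℕ} (hs : 2 ≤ s) {x y : ℝ} (hxy : |x| ≤ |y|) :
    jb (x + y) * |jb (x + y) ^ s - jb x ^ s - jb y ^ s| ≤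
      comC s * (jb x)⁻¹ * (jb x ^ s * jb y ^ s) := by
  obtain ⟨r, rfl⟩ := Nat.exists_eq_add_of_le' hs
  have h0 := jb_pos (x + y)
  have hx := jb_pos x
  have hy := jb_pos y
  have hx1 := one_le_jb x
  have hy1 := one_le_jb y
  set M := max (jb (x + y)) (jb y) with hM
  have hM0 : 0 < M := lt_max_of_lt_left h0
  have hρ : 1 ≤ Real.sqrt (4 / 3) := by rw [Real.one_le_sqrt]; norm_num
  have m1 : M ≤ Real.sqrt (4 / 3) * (jb x * jb y) := by
    refine max_le (jb_add_le x y) ?_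
    nlinarith [mul_le_mul hρ hx1 zero_le_one (by positivity)]
  have m2 : M ≤ 2 * jb y := max_le (jb_le_two_mul hxy) (by linarith)
  have a1 : |jb (x + y) ^ (r + 2) - jb y ^ (r + 2)| ≤ (r + 2 : ℕ) * jb x * M ^ (r + 1) := by
    refine (abs_pow_sub_le h0.le hy.le _).trans ?_
    rw [← hM]
    gcongr ?_ * ?_ * ?_
    · exact (abs_jb_sub_le x y).trans (abs_le_jb x)
    · exact le_rfl
  have a2 : M ^ (r + 2) ≤ (Real.sqrt (4 / 3) * (jb x * jb y)) ^ r * (2 * jb y) ^ 2 := by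
    rw [pow_add]
    gcongr
  have a3 : jb (x + y) * |jb (x + y) ^ (r + 2) - jb y ^ (r + 2)| ≤ (r + 2 : ℕ) * jb x *
      ((Real.sqrt (4 / 3) * (jb x * jb y)) ^ r * (2 * jb y) ^ 2) := by
    calc _ ≤ M * ((r + 2 : ℕ) * jb x * M ^ (r + 1)) := by
          gcongr
          exact le_max_left _ _
      _ = (r + 2 : ℕ) * jb x * M ^ (r + 2) := by ring
      _ ≤ _ := by gcongr
  have a4 : jb (x + y) * jb x ^ (r + 2) ≤ 2 * (jb x)⁻¹ * (jb x ^ (r + 2) * jb y ^ (r + 2)) := by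
    have b1 : jb x * jb y ≤ jb y ^ (r + 2) := by
      calc jb x * jb y ≤ jb y * jb y := by gcongr; exact jb_mono hxy
        _ = jb y ^ 2 := by ring
        _ ≤ jb y ^ (r + 2) := pow_le_pow_right₀ hy1 (by omega)
    calc jb (x + y) * jb x ^ (r + 2) ≤ 2 * jb y * jb x ^ (r + 2) := by
          gcongr
          exact jb_le_two_mul hxy
      _ = 2 * (jb x)⁻¹ * (jb x ^ (r + 2) * (jb x * jb y)) := by field_simp
      _ ≤ _ := by gcongr
  calc _ ≤ jb (x + y) * (|jb (x + y) ^ (r + 2) - jb y ^ (r + 2)| + jb x ^ (r + 2)) := by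
        gcongr
        calc _ = |(jb (x + y) ^ (r + 2) - jb y ^ (r + 2)) - jb x ^ (r + 2)| := by ring_nf
          _ ≤ |jb (x + y) ^ (r + 2) - jb y ^ (r + 2)| + |jb x ^ (r + 2)| := abs_sub _ _
          _ = _ := by rw [abs_of_nonneg (pow_nonneg hx.le _)]
    _ ≤ (r + 2 : ℕ) * jb x * ((Real.sqrt (4 / 3) * (jb x * jb y)) ^ r * (2 * jb y) ^ 2) +
        2 * (jb x)⁻¹ * (jb x ^ (r + 2) * jb y ^ (r + 2)) := by
        rw [mul_add]
        exact add_le_add a3 a4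
    _ = _ := by
        rw [comC, Nat.add_sub_cancel]
        field_simp
        ring

theorem com_symbol_le {s : ℕ} (hs : 2 ≤ s) (x y : ℝ) :
    jb (x + y) * |jb (x + y) ^ s - jb x ^ s - jb y ^ s| ≤
      comC s * Real.sqrt ((jb x ^ 2)⁻¹ + (jb y ^ 2)⁻¹) * (jb x ^ s * jb y ^ s) := by
  have hx := jb_pos x
  have hy := jb_pos y
  have hc := comC_nonneg s
  rcases le_total |x| |y| with h | h
  · refine (com_symbol_le_of_abs_le hs h).trans ?_
    gcongr
    apply Real.le_sqrt_of_sq_le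
    rw [inv_pow]
    have : 0 ≤ (jb y ^ 2)⁻¹ := by positivity
    linarith
  · have h1 := com_symbol_le_of_abs_le hs h
    rw [add_comm y x, mul_comm (jb y ^ s)] at h1
    rw [show jb (x + y) ^ s - jb x ^ s - jb y ^ s = jb (x + y) ^ s - jb y ^ s - jb x ^ s by ring]
    refine h1.trans ?_
    gcongr
    apply Real.le_sqrt_of_sq_le
    rw [inv_pow]
    have : 0 ≤ (jb x ^ 2)⁻¹ := by positivity
    linarith

/-! ### The algebra property and the Leibniz rule for `J^s` -/

/-- `H^s` is an algebra for `s ≥ 1`. -/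
theorem MemHs.mul {s : ℕ} (hs : 1 ≤ s) {g h : L2} (hg : MemHs s g) (hh : MemHs s h) :
    MemHs s (mulL2 g h) ∧ hsNorm s (mulL2 g h) ≤ algC s * (hsNorm s g * hsNorm s h) := by
  have hg1 := hg.mono hs
  obtain ⟨h1, h2⟩ := memLp_bilinear_fourier hg hh
    (aestronglyMeasurable_mul_fourier (continuous_jsym s) (mulL2 g h)) (algC_nonneg s)
    (σ := fun y z => jsym s (2 * Real.pi * (y + z))) (fun y z => by
      rw [norm_jsym, wt_eq, wt_eq, mul_add]
      exact alg_symbol_le hs _ _) (by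
      filter_upwards [fourier_mulL2_ae hg1 h] with η hη
      rw [hη, ← integral_const_mul]
      simp)
  have hm := memHs_iff.2 h1
  refine ⟨hm, ?_⟩
  rw [hsNorm_eq hm, bessel, norm_fourierMul]
  have := algC_nonneg s
  have := hsNorm_nonneg s g
  have := hsNorm_nonneg s h
  exact norm_toL2_le h1 (by positivity) h2

/-- The remainder `J^s(gh) - g J^s h - h J^s g`. -/
def leibnizRem (s : ℕ) (g h : L2) : L2 :=
  bessel s (mulL2 g h) - mulL2 g (bessel s h) - mulL2 h (bessel s g)

/-- All three terms transform into convolutions; swapping the factors in the last one puts them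
under a single integral with a symbol in `(y, η - y)`. -/
theorem fourier_leibnizRem_ae {s : ℕ} (hs : 1 ≤ s) {g h : L2} (hg : MemHs s g) (hh : MemHs s h) :
    ∀ᵐ η : ℝ, (𝓕 (leibnizRem s g h) : L2) η = ∫ y, (jsym s (2 * Real.pi * (y + (η - y))) -
      jsym s (2 * Real.pi * y) - jsym s (2 * Real.pi * (η - y))) *
        ((𝓕 g : L2) y * (𝓕 h : L2) (η - y)) := by
  have hg1 := hg.mono hs
  have hh1 := hh.mono hs
  filter_upwards [fourier_sub_ae (bessel s (mulL2 g h) - mulL2 g (bessel s h))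
      (mulL2 h (bessel s g)), fourier_sub_ae (bessel s (mulL2 g h)) (mulL2 g (bessel s h)),
    fourier_fourierMul_ae (memHs_iff.1 (hg.mul hs hh).1), fourier_mulL2_ae hg1 h,
    fourier_mulL2_ae hg1 (bessel s h), fourier_mulL2_ae hh1 (bessel s g)] with η e1 e2 e3 e4 e5 e6
  have b1 := fourier_fourierMul_ae (memHs_iff.1 hg)
  have b2 := (Measure.measurePreserving_sub_left volume η).quasiMeasurePreserving.ae
    (fourier_fourierMul_ae (memHs_iff.1 hh))
  have hi : Integrable fun y => jsym s (2 * Real.pi * η) * ((𝓕 g : L2) y * (𝓕 h : L2) (η - y)) -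
      (𝓕 g : L2) y * (𝓕 (bessel s h) : L2) (η - y) :=
    ((integrable_convolution _ _ η).const_mul _).sub (integrable_convolution _ _ η)
  rw [leibnizRem, e1, e2, e5, e6, bessel, e3, e4, convolution_symm (𝓕 h : L2), ← integral_const_mul,
    ← integral_sub ((integrable_convolution _ _ η).const_mul _) (integrable_convolution _ _ η),
    ← integral_sub hi (integrable_convolution _ _ η)]
  refine integral_congr_ae ?_
  filter_upwards [b1, b2] with y h1 h2
  rw [add_sub_cancel, bessel, bessel, h1, h2]
  ring

/-- Leibniz rule for `J^s` with a remainder in `H¹`. -/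
theorem memHs_leibnizRem {s : ℕ} (hs : 2 ≤ s) {g h : L2} (hg : MemHs s g) (hh : MemHs s h) :
    MemHs 1 (leibnizRem s g h) ∧
      hsNorm 1 (leibnizRem s g h) ≤ comC s * (hsNorm s g * hsNorm s h) := by
  obtain ⟨h1, h2⟩ := memLp_bilinear_fourier hg hh
    (aestronglyMeasurable_mul_fourier (continuous_jsym 1) (leibnizRem s g h)) (comC_nonneg s)
    (σ := fun y z => jsym 1 (2 * Real.pi * (y + z)) * (jsym s (2 * Real.pi * (y + z)) -
      jsym s (2 * Real.pi * y) - jsym s (2 * Real.pi * z))) (fun y z => by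
      rw [norm_mul, norm_jsym, pow_one, wt_eq, wt_eq]
      simp only [jsym]
      rw [← Complex.ofReal_sub, ← Complex.ofReal_sub, Complex.norm_real, Real.norm_eq_abs, mul_add]
      exact com_symbol_le hs _ _) (by
      filter_upwards [fourier_leibnizRem_ae (by omega) hg hh] with η hη
      rw [hη, ← integral_const_mul]
      simp only [add_sub_cancel, mul_assoc])
  have hm := memHs_iff.2 h1
  refine ⟨hm, ?_⟩
  rw [hsNorm_eq hm, bessel, norm_fourierMul]
  have := comC_nonneg s
  have := hsNorm_nonneg s g
  have := hsNorm_nonneg s h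
  exact norm_toL2_le h1 (by positivity) h2

/-! ### Local smoothing -/

/-- For `ξ = 2πη` one has `ξ³τ = 2π(4π²η³)τ`, so `4π²η³` is the frequency dual to time. It is a
global coordinate on the line. -/
theorem cubic_homeo : ∃ e : ℝ ≃ₜ ℝ, ∀ η, e η = 4 * Real.pi ^ 2 * η ^ 3 := by
  have hp : 0 < 4 * Real.pi ^ 2 := by positivity
  have hm : StrictMono fun η : ℝ => 4 * Real.pi ^ 2 * η ^ 3 := by
    intro a b hab
    have : a ^ 3 < b ^ 3 := Odd.strictMono_pow (by decide) hab
    exact mul_lt_mul_of_pos_left this hp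
  have hs : Function.Surjective fun η : ℝ => 4 * Real.pi ^ 2 * η ^ 3 := by
    refine Continuous.surjective (by fun_prop) ?_ ?_
    · exact (Filter.tendsto_pow_atTop (by norm_num)).const_mul_atTop hp
    · have : Filter.Tendsto (fun η : ℝ => η ^ 3) Filter.atBot Filter.atBot :=
        (Odd.strictMono_pow (n := 3) (by decide)).monotone.tendsto_atBot_atBot fun b => by
          -- For `y ≤ -1` one has `y³ ≤ y`.
          refine ⟨min b (-1), ?_⟩
          have h1 := min_le_left b (-1)
          have h2 := min_le_right b (-1)
          nlinarith [sq_nonneg (min b (-1)), mul_nonneg (sub_nonneg.2 h2) (sq_nonneg (min b (-1)))]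
      exact this.const_mul_atBot hp
  exact ⟨(hm.orderIsoOfSurjective _ hs).toHomeomorph, fun η => rfl⟩

/-- Plancherel's theorem in time for a superposition of the oscillations `e^{iξ³τ}`, `ξ = 2πη`. -/
theorem lintegral_cubic_oscillation_le {k : ℝ → ℂ} (hk : Integrable k) (p : L2)
    (hkp : ∀ᵐ η : ℝ, ‖k η‖ₑ ≤ ENNReal.ofReal (2 * Real.pi * |η|) * ‖p η‖ₑ) :
    ∫⁻ τ, ‖∫ η, (Real.fourierChar (4 * Real.pi ^ 2 * η ^ 3 * τ) : ℂ) * k η‖ₑ ^ 2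
      ≤ ENNReal.ofReal (‖p‖ ^ 2) := by
  obtain ⟨e, he⟩ := cubic_homeo
  have hpi := Real.pi_pos
  set d : ℝ → ℝ := fun η => 12 * Real.pi ^ 2 * η ^ 2 with hd
  have hder : ∀ η ∈ (univ : Set ℝ), HasDerivWithinAt e (d η) univ η := by
    intro η _
    have e1 : 4 * Real.pi ^ 2 * (((3 : ℕ) : ℝ) * η ^ (3 - 1)) = d η := by
      simp only [hd]
      push_cast
      ring
    have h1 := (hasDerivAt_pow 3 η).const_mul (4 * Real.pi ^ 2)
    rw [e1] at h1
    rw [← funext he] at h1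
    exact h1.hasDerivWithinAt
  have himg : e '' univ = univ := by rw [image_univ]; exact e.surjective.range_eq
  have habs : ∀ η, |d η| = d η := fun η => abs_of_nonneg (by simp only [hd]; positivity)
  -- The density in the time frequency `ζ`: `k` divided by the Jacobian `d`, which vanishes only at
  -- `η = 0`. The superposition is then the inverse Fourier transform of `h` at `τ`.
  set h : ℝ → ℂ := fun ζ => ((d (e.symm ζ) : ℝ) : ℂ)⁻¹ * k (e.symm ζ) with hh
  have hhe : ∀ η, h (e η) = ((d η : ℝ) : ℂ)⁻¹ * k η := fun η => by simp [hh]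
  have hne : ∀ᵐ η : ℝ, η ≠ 0 := by simp [ae_iff]
  have hcancel : ∀ᵐ η : ℝ, |d η| • h (e η) = k η := by
    filter_upwards [hne] with η hη
    have : (d η : ℂ) ≠ 0 := by
      rw [Complex.ofReal_ne_zero]
      simp only [hd]
      positivity
    rw [habs, hhe, Complex.real_smul, mul_inv_cancel_left₀ this]
  have hint : Integrable h := by
    rw [← integrableOn_univ, ← himg,
      integrableOn_image_iff_integrableOn_abs_deriv_smul MeasurableSet.univ hder e.injective.injOn,
      integrableOn_univ]
    exact hk.congr (hcancel.mono fun η h => h.symm)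
  have hsq : ∫⁻ ζ, ‖h ζ‖ₑ ^ 2 ≤ ENNReal.ofReal (‖p‖ ^ 2) := by
    rw [← setLIntegral_univ, ← himg,
      lintegral_image_eq_lintegral_abs_deriv_mul MeasurableSet.univ hder e.injective.injOn,
      setLIntegral_univ, ← lintegral_enorm_sq]
    refine lintegral_mono_ae ?_
    filter_upwards [hne, hkp] with η hη h1
    have hd0 : 0 < d η := by simp only [hd]; positivity
    rw [habs, hhe, enorm_mul, ← ofReal_norm (_⁻¹), norm_inv, Complex.norm_real,
      Real.norm_of_nonneg hd0.le]
    calc ENNReal.ofReal (d η) * (ENNReal.ofReal (d η)⁻¹ * ‖k η‖ₑ) ^ 2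
        ≤ ENNReal.ofReal (d η) * (ENNReal.ofReal (d η)⁻¹ *
          (ENNReal.ofReal (2 * Real.pi * |η|) * ‖p η‖ₑ)) ^ 2 := by gcongr
      _ = ENNReal.ofReal (d η * ((d η)⁻¹ * (2 * Real.pi * |η|)) ^ 2) * ‖p η‖ₑ ^ 2 := by
          rw [ENNReal.ofReal_mul hd0.le, ENNReal.ofReal_pow (by positivity),
            ENNReal.ofReal_mul (p := (d η)⁻¹) (by positivity)]
          ring
      _ ≤ ENNReal.ofReal 1 * ‖p η‖ₑ ^ 2 := by
          gcongr
          -- The gain of one derivative: the squared weight `4π²η²` is a third of the Jacobian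
          -- `12π²η²`.
          have : d η * ((d η)⁻¹ * (2 * Real.pi * |η|)) ^ 2 = 1 / 3 := by
            rw [mul_pow, mul_pow, sq_abs]
            simp only [hd]
            field_simp
            norm_num
          rw [this]
          norm_num
      _ = _ := by simp
  have hmem : MemLp h 2 volume := by
    refine ⟨hint.aestronglyMeasurable, ?_⟩
    have h5 : eLpNorm h 2 volume ^ 2 < ⊤ := by
      rw [eLpNorm_two_sq]
      exact hsq.trans_lt ENNReal.ofReal_lt_top
    exact (ENNReal.pow_lt_top_iff.1 h5).resolve_right (by norm_num)
  have hF : ∀ τ, ∫ η, (Real.fourierChar (4 * Real.pi ^ 2 * η ^ 3 * τ) : ℂ) * k η = 𝓕⁻ h τ := by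
    intro τ
    rw [Real.fourierInv_eq]
    have := integral_image_eq_integral_abs_deriv_smul MeasurableSet.univ hder e.injective.injOn
      (fun ζ => Real.fourierChar (inner ℝ ζ τ) • h ζ)
    rw [himg, setIntegral_univ, setIntegral_univ] at this
    rw [this]
    refine integral_congr_ae ?_
    filter_upwards [hcancel] with η hη
    rw [smul_comm, hη, he, Circle.smul_def, smul_eq_mul]
    congr 3
    simp [mul_comm]
  simp_rw [hF]
  rw [← eLpNorm_two_sq, eLpNorm_fourierInv_eq hint hmem, eLpNorm_two_sq]
  exact hsq

/-- The symbol `e^{iξ³t}` of the Airy group. -/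
def airySym (t ξ : ℝ) : ℂ := Complex.exp (Complex.I * ((ξ ^ 3 * t : ℝ) : ℂ))

theorem airy_def (t : ℝ) (f : L2) : airy t f = fourierMul (airySym t) f := rfl

theorem ddx_def (f : L2) : ddx f = fourierMul (fun ξ => Complex.I * (ξ : ℂ)) f := rfl

theorem norm_airySym (t ξ : ℝ) : ‖airySym t ξ‖ = 1 := by
  rw [airySym, mul_comm]
  exact Complex.norm_exp_ofReal_mul_I _

theorem continuous_airySym (t : ℝ) : Continuous (airySym t) := by
  unfold airySym
  fun_prop

/-- The symbol of the adjoint of `W(t - τ) d/dx`. -/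
def katoSym (t τ ξ : ℝ) : ℂ := conj (airySym (t - τ) ξ * (Complex.I * ξ))

theorem continuous_katoSym (t τ : ℝ) : Continuous (katoSym t τ) := by
  have := continuous_airySym (t - τ)
  unfold katoSym
  fun_prop

theorem norm_katoSym (t τ ξ : ℝ) : ‖katoSym t τ ξ‖ = |ξ| := by
  simp [katoSym, norm_airySym]

/-- The conjugation in the adjoint makes `τ` enter with a plus sign and only through a character. At
fixed `x` the representative is thus a superposition as in `lintegral_cubic_oscillation_le`. -/
theorem katoSym_eq (t τ η : ℝ) : katoSym t τ (2 * Real.pi * η) =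
    (Real.fourierChar (4 * Real.pi ^ 2 * η ^ 3 * τ) : ℂ) * katoSym t 0 (2 * Real.pi * η) := by
  simp only [katoSym, airySym, map_mul, ← Complex.exp_conj, Complex.conj_I, Complex.conj_ofReal]
  have key : Complex.exp (-Complex.I * (((2 * Real.pi * η) ^ 3 * (t - τ) : ℝ) : ℂ)) =
      Complex.exp (((2 * Real.pi * (4 * Real.pi ^ 2 * η ^ 3 * τ) : ℝ) : ℂ) * Complex.I) *
        Complex.exp (-Complex.I * (((2 * Real.pi * η) ^ 3 * (t - 0) : ℝ) : ℂ)) := by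
    rw [← Complex.exp_add]
    congr 1
    push_cast
    ring
  rw [Real.fourierChar_apply, key, mul_assoc]

/-- A pointwise representative of `(W(t - τ) d/dx)* ψ`. -/
def katoRep (ψ : L2) (t τ x : ℝ) : ℂ :=
  ∫ η, (Real.fourierChar (η * x) : ℂ) * (katoSym t τ (2 * Real.pi * η) * (𝓕 ψ : L2) η)

/-- Local smoothing is an estimate at each fixed `x`, so an `L²` class does not suffice. For
band-limited `ψ` the inversion integral converges absolutely and supplies a representative defined
everywhere. -/
theorem fourierMul_katoSym_ae {ψ : L2} (hψ : BandLimited ψ) (t τ : ℝ) :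
    (fourierMul (katoSym t τ) ψ : ℝ → ℂ) =ᵐ[volume] katoRep ψ t τ := by
  have hm := continuous_katoSym t τ
  have h1 := fourierInv_ae_eq (hψ.fourierMul hm).integrable
  rw [fourierInv_fourier] at h1
  filter_upwards [h1] with x hx
  rw [hx, Real.fourierInv_eq, katoRep]
  refine integral_congr_ae ?_
  filter_upwards [fourier_fourierMul_ae (hψ.mulDom hm)] with η hη
  rw [hη, Circle.smul_def, smul_eq_mul]
  simp [mul_comm]

theorem measurable_katoRep (ψ : L2) (t : ℝ) :
    Measurable fun p : ℝ × ℝ => katoRep ψ t p.1 p.2 := by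
  have h1 : Continuous fun q : (ℝ × ℝ) × ℝ => (Real.fourierChar (q.2 * q.1.2) : ℂ) *
      katoSym t q.1.1 (2 * Real.pi * q.2) := by
    unfold katoSym airySym
    fun_prop
  have h2 : StronglyMeasurable fun q : (ℝ × ℝ) × ℝ => (Real.fourierChar (q.2 * q.1.2) : ℂ) *
      katoSym t q.1.1 (2 * Real.pi * q.2) * (𝓕 ψ : L2) q.2 :=
    h1.stronglyMeasurable.mul ((Lp.stronglyMeasurable (𝓕 ψ : L2)).comp_measurable measurable_snd)
  have h3 := h2.integral_prod_right' (ν := (volume : Measure ℝ))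
  convert h3.measurable using 3 with p
  simp only [katoRep, mul_assoc]

/-- Kato's local smoothing effect: a gain of one derivative, uniformly in `x`, in `L²` in time. -/
theorem lintegral_katoRep_sq_le {ψ : L2} (hψ : BandLimited ψ) (t x : ℝ) :
    ∫⁻ τ, ‖katoRep ψ t τ x‖ₑ ^ 2 ≤ ENNReal.ofReal (‖ψ‖ ^ 2) := by
  have hm := continuous_katoSym t 0
  have hi : Integrable fun η => katoSym t 0 (2 * Real.pi * η) * (𝓕 ψ : L2) η :=
    (hψ.fourierMul hm).integrable.congr (fourier_fourierMul_ae (hψ.mulDom hm))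
  have hc : Continuous fun η : ℝ => (Real.fourierChar (η * x) : ℂ) := by fun_prop
  have hk : Integrable fun η => (Real.fourierChar (η * x) : ℂ) *
      (katoSym t 0 (2 * Real.pi * η) * (𝓕 ψ : L2) η) :=
    hi.bdd_mul hc.aestronglyMeasurable (c := 1)
      (Filter.Eventually.of_forall fun η => (Circle.norm_coe _).le)
  have := lintegral_cubic_oscillation_le hk (𝓕 ψ : L2) (Filter.Eventually.of_forall fun η => by
    rw [enorm_mul, enorm_mul, ← ofReal_norm (Real.fourierChar _ : ℂ), Circle.norm_coe,
      ENNReal.ofReal_one, one_mul, ← ofReal_norm (katoSym _ _ _), norm_katoSym, abs_mul,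
      abs_of_pos Real.two_pi_pos])
  rw [norm_fourier] at this
  refine le_trans (le_of_eq ?_) this
  refine lintegral_congr fun τ => ?_
  congr 2
  refine integral_congr_ae (Filter.Eventually.of_forall fun η => ?_)
  simp only
  rw [katoSym_eq]
  ring

/-- The forcing `Y` is admissible for the local smoothing estimate on `[0, T]`, with constant `B`:
`∫₀ᵗ |⟨(W(t - τ) d/dx)* ψ, Y(τ)⟩| dτ ≤ B ‖ψ‖`. -/
def KatoBdd (T : ℝ) (Y : ℝ → L2) (B : ℝ) : Prop :=
  0 ≤ B ∧ ∀ ψ : L2, BandLimited ψ → ∀ t ∈ Icc (0 : ℝ) T, ∃ β : ℝ → ℝ≥0∞, Measurable β ∧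
    (∀ τ ∈ Icc (0 : ℝ) t, ‖⟪fourierMul (katoSym t τ) ψ, Y τ⟫_ℂ‖ₑ ≤ β τ) ∧
    ∫⁻ τ in Icc (0 : ℝ) t, β τ ≤ ENNReal.ofReal (B * ‖ψ‖)

/-- Additivity of the time integrals uses measurability of the majorants `β` alone; none is required
of `τ ↦ ⟪fourierMul (katoSym t τ) ψ, Y τ⟫`. -/
theorem KatoBdd.add {T : ℝ} {Y Z : ℝ → L2} {B C : ℝ} (hY : KatoBdd T Y B) (hZ : KatoBdd T Z C) :
    KatoBdd T (fun τ => Y τ + Z τ) (B + C) := by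
  have hB := hY.1
  have hC := hZ.1
  refine ⟨add_nonneg hB hC, fun ψ hψ t ht => ?_⟩
  obtain ⟨β, hβ, b1, b2⟩ := hY.2 ψ hψ t ht
  obtain ⟨γ, hγ, c1, c2⟩ := hZ.2 ψ hψ t ht
  refine ⟨fun τ => β τ + γ τ, hβ.add hγ, fun τ hτ => ?_, ?_⟩
  · rw [inner_add_right]
    exact (enorm_add_le _ _).trans (add_le_add (b1 τ hτ) (c1 τ hτ))
  · rw [lintegral_add_left hβ, add_mul, ENNReal.ofReal_add (by positivity) (by positivity)]
    exact add_le_add b2 c2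

theorem KatoBdd.smul {T : ℝ} {Y : ℝ → L2} {B : ℝ} (hY : KatoBdd T Y B) (c : ℂ) :
    KatoBdd T (fun τ => c • Y τ) (‖c‖ * B) := by
  have hB := hY.1
  refine ⟨by positivity, fun ψ hψ t ht => ?_⟩
  obtain ⟨β, hβ, b1, b2⟩ := hY.2 ψ hψ t ht
  refine ⟨fun τ => ‖c‖ₑ * β τ, hβ.const_mul _, fun τ hτ => ?_, ?_⟩
  · rw [inner_smul_right, enorm_mul]
    exact mul_le_mul' le_rfl (b1 τ hτ)
  · rw [lintegral_const_mul _ hβ, mul_assoc, ENNReal.ofReal_mul (norm_nonneg _), ofReal_norm]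
    exact mul_le_mul' le_rfl b2

theorem KatoBdd.mono {T : ℝ} {Y : ℝ → L2} {B C : ℝ} (hY : KatoBdd T Y B) (h : B ≤ C) :
    KatoBdd T Y C := by
  refine ⟨hY.1.trans h, fun ψ hψ t ht => ?_⟩
  obtain ⟨β, hβ, b1, b2⟩ := hY.2 ψ hψ t ht
  exact ⟨β, hβ, b1, b2.trans (ENNReal.ofReal_le_ofReal (by gcongr))⟩

theorem KatoBdd.congr {T : ℝ} {Y Z : ℝ → L2} {B : ℝ} (hY : KatoBdd T Y B)
    (h : ∀ τ ∈ Icc (0 : ℝ) T, Z τ = Y τ) : KatoBdd T Z B := by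
  refine ⟨hY.1, fun ψ hψ t ht => ?_⟩
  obtain ⟨β, hβ, b1, b2⟩ := hY.2 ψ hψ t ht
  exact ⟨β, hβ, fun τ hτ => by rw [h τ ⟨hτ.1, hτ.2.trans ht.2⟩]; exact b1 τ hτ, b2⟩

/-- No smoothing is needed for a forcing in `H¹`: the derivative is moved back onto `Y`, the group
symbol has modulus one, and time integration costs a factor `T`. -/
theorem katoBdd_of_memHs_one {T : ℝ} (hT : 0 ≤ T) {Y : ℝ → L2} {r : ℝ} (hr : 0 ≤ r)
    (hY : ∀ τ ∈ Icc (0 : ℝ) T, MemHs 1 (Y τ) ∧ hsNorm 1 (Y τ) ≤ r) : KatoBdd T Y (T * r) := by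
  refine ⟨by positivity, fun ψ hψ t ht => ⟨fun _ => ENNReal.ofReal (r * ‖ψ‖), measurable_const,
    fun τ hτ => ?_, ?_⟩⟩
  · obtain ⟨h1, h2⟩ := hY τ ⟨hτ.1, hτ.2.trans ht.2⟩
    have hm : Continuous fun ξ : ℝ => airySym (t - τ) ξ * (Complex.I * (ξ : ℂ)) := by
      have := continuous_airySym (t - τ)
      fun_prop
    have hle : ∀ ξ : ℝ, ‖airySym (t - τ) ξ * (Complex.I * (ξ : ℂ))‖ ≤ 1 * jb ξ ^ 1 := by
      intro ξ
      simpa [norm_airySym] using abs_le_jb ξ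
    have e := inner_fourierMul_fourierMul (hψ.mulDom (continuous_katoSym t τ)) (mulDom_one (Y τ))
      (mulDom_one ψ) (h1.mulDom hm hle) fun ξ => by simp [katoSym]
    rw [fourierMul_one, fourierMul_one] at e
    rw [e, ← ofReal_norm]
    apply ENNReal.ofReal_le_ofReal
    refine (norm_inner_le_norm _ _).trans ?_
    rw [mul_comm]
    gcongr
    have := h1.norm_fourierMul_le hm hle
    linarith
  · rw [setLIntegral_const, Real.volume_Icc, ← ENNReal.ofReal_mul (by positivity)]
    apply ENNReal.ofReal_le_ofReal
    have h2 := ht.2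
    have h3 := norm_nonneg ψ
    calc r * ‖ψ‖ * (t - 0) ≤ r * ‖ψ‖ * T := by gcongr; linarith
      _ = _ := by ring

theorem enorm_inner_le_lintegral (f g : L2) : ‖⟪f, g⟫_ℂ‖ₑ ≤ ∫⁻ x, ‖f x‖ₑ * ‖g x‖ₑ := by
  rw [L2.inner_def]
  refine (enorm_integral_le_lintegral_enorm _).trans (lintegral_mono fun x => ?_)
  rw [← ofReal_norm, ← ofReal_norm, ← ofReal_norm, ← ENNReal.ofReal_mul (norm_nonneg _)]
  exact ENNReal.ofReal_le_ofReal (norm_inner_le_norm _ _)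

/-- The `L²(G² dx)` norm of `(W(t - τ) d/dx)* ψ`, squared. -/
def katoEnergy (ψ : L2) (t : ℝ) (G : ℝ → ℝ≥0∞) (τ : ℝ) : ℝ≥0∞ :=
  ∫⁻ x, ‖katoRep ψ t τ x‖ₑ ^ 2 * G x ^ 2

theorem measurable_enorm_katoRep (ψ : L2) (t : ℝ) :
    Measurable fun p : ℝ × ℝ => ‖katoRep ψ t p.1 p.2‖ₑ := (measurable_katoRep ψ t).enorm

theorem measurable_enorm_katoRep_time (ψ : L2) (t x : ℝ) :
    Measurable fun τ => ‖katoRep ψ t τ x‖ₑ :=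
  Measurable.of_uncurry_right (f := fun τ x => ‖katoRep ψ t τ x‖ₑ) (measurable_enorm_katoRep ψ t)

theorem measurable_enorm_katoRep_space (ψ : L2) (t τ : ℝ) :
    Measurable fun x => ‖katoRep ψ t τ x‖ₑ :=
  Measurable.of_uncurry_left (f := fun τ x => ‖katoRep ψ t τ x‖ₑ) (measurable_enorm_katoRep ψ t)

theorem measurable_katoIntegrand (ψ : L2) (t : ℝ) {G : ℝ → ℝ≥0∞} (hG : Measurable G) :
    Measurable fun p : ℝ × ℝ => ‖katoRep ψ t p.1 p.2‖ₑ ^ 2 * G p.2 ^ 2 :=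
  ((measurable_enorm_katoRep ψ t).pow_const 2).mul ((hG.comp measurable_snd).pow_const 2)

theorem measurable_katoEnergy (ψ : L2) (t : ℝ) {G : ℝ → ℝ≥0∞} (hG : Measurable G) :
    Measurable (katoEnergy ψ t G) :=
  (measurable_katoIntegrand ψ t hG).lintegral_prod_right'

/-- With the `x` integral outermost (Tonelli), local smoothing bounds the time integral by `‖ψ‖²`
uniformly in `x`, leaving `∫ G²`. This is why `G` must not depend on time. -/
theorem lintegral_katoEnergy_le {ψ : L2} (hψ : BandLimited ψ) (t : ℝ)
    {G : ℝ → ℝ≥0∞} (hG : Measurable G) :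
    ∫⁻ τ, katoEnergy ψ t G τ ≤ ENNReal.ofReal (‖ψ‖ ^ 2) * ∫⁻ x, G x ^ 2 := by
  have e : ∫⁻ τ, katoEnergy ψ t G τ = ∫⁻ x, ∫⁻ τ, ‖katoRep ψ t τ x‖ₑ ^ 2 * G x ^ 2 :=
    lintegral_lintegral_swap (f := fun τ x => ‖katoRep ψ t τ x‖ₑ ^ 2 * G x ^ 2)
      (measurable_katoIntegrand ψ t hG).aemeasurable
  rw [e, ← lintegral_const_mul _ (hG.pow_const 2)]
  refine lintegral_mono fun x => ?_
  have mKt := measurable_enorm_katoRep_time ψ t x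
  rw [lintegral_mul_const _ (mKt.pow_const 2)]
  exact mul_le_mul' (lintegral_katoRep_sq_le hψ t x) le_rfl

theorem rpow_half_sq (z : ℝ≥0∞) : (z ^ (1 / 2 : ℝ)) ^ 2 = z := by
  rw [← ENNReal.rpow_two, ← ENNReal.rpow_mul]
  norm_num

/-- Cauchy–Schwarz in `x` with the majorant `G` grouped with the Kato kernel, leaving `H` in plain
`L²`. -/
theorem enorm_inner_le_katoEnergy {ψ : L2} (hψ : BandLimited ψ) (t τ : ℝ)
    {G : ℝ → ℝ≥0∞} (hG : Measurable G) {Y H : L2} (hY : ∀ᵐ x : ℝ, ‖Y x‖ₑ ≤ G x * ‖H x‖ₑ) :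
    ‖⟪fourierMul (katoSym t τ) ψ, Y⟫_ℂ‖ₑ ≤
      ENNReal.ofReal ‖H‖ * katoEnergy ψ t G τ ^ (1 / 2 : ℝ) := by
  refine (enorm_inner_le_lintegral _ _).trans ?_
  have s1 : ∫⁻ x, ‖fourierMul (katoSym t τ) ψ x‖ₑ * ‖Y x‖ₑ
      ≤ ∫⁻ x, (‖katoRep ψ t τ x‖ₑ * G x) * ‖H x‖ₑ := by
    refine lintegral_mono_ae ?_
    filter_upwards [fourierMul_katoSym_ae hψ t τ, hY] with x h1 h2
    rw [h1, mul_assoc]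
    exact mul_le_mul' le_rfl h2
  refine s1.trans ((ENNReal.pow_le_pow_left_iff two_ne_zero).1 ?_)
  have mKx := measurable_enorm_katoRep_space ψ t τ
  have h2 := lintegral_mul_sq_le (μ := volume) (f := fun x => ‖katoRep ψ t τ x‖ₑ * G x)
    (g := fun x => ‖H x‖ₑ) (mKx.mul hG).aemeasurable (Lp.aestronglyMeasurable H).enorm
  refine h2.trans ?_
  rw [lintegral_enorm_sq, mul_pow, rpow_half_sq, mul_comm, ← ENNReal.ofReal_pow (norm_nonneg _)]
  refine mul_le_mul' le_rfl (le_of_eq ?_)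
  simp only [katoEnergy, mul_pow]

/-- Cauchy–Schwarz in `τ` against the constant 1, the source of the factor `√T`. -/
theorem lintegral_katoEnergy_sqrt_le {ψ : L2} (hψ : BandLimited ψ) {t T : ℝ} (h0 : 0 ≤ T)
    (htT : t ≤ T) {G : ℝ → ℝ≥0∞} (hG : Measurable G) {m : ℝ} (hm : 0 ≤ m)
    (hGm : ∫⁻ x, G x ^ 2 ≤ ENNReal.ofReal (m ^ 2)) :
    ∫⁻ τ in Icc (0 : ℝ) t, katoEnergy ψ t G τ ^ (1 / 2 : ℝ)
      ≤ ENNReal.ofReal (m * Real.sqrt T * ‖ψ‖) := by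
  have h1 := lintegral_mul_sq_le (μ := volume.restrict (Icc (0 : ℝ) t))
    ((measurable_katoEnergy ψ t hG).pow_const (1 / 2 : ℝ)).aemeasurable
    (measurable_const (a := (1 : ℝ≥0∞))).aemeasurable
  simp only [mul_one, rpow_half_sq, one_pow, setLIntegral_const, Real.volume_Icc, one_mul] at h1
  have h3 := (setLIntegral_le_lintegral (Icc (0 : ℝ) t) (katoEnergy ψ t G)).trans
    ((lintegral_katoEnergy_le hψ t hG).trans (mul_le_mul' le_rfl hGm))
  rw [← ENNReal.pow_le_pow_left_iff two_ne_zero, ← ENNReal.ofReal_pow (by positivity)]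
  refine h1.trans ((mul_le_mul' h3 (ENNReal.ofReal_le_ofReal (q := T) (by linarith))).trans ?_)
  rw [← ENNReal.ofReal_mul (by positivity), ← ENNReal.ofReal_mul (by positivity)]
  apply ENNReal.ofReal_le_ofReal
  rw [mul_pow, mul_pow, Real.sq_sqrt h0]
  linarith

/-- Local smoothing estimate for a product with a factor in `L²_x L^∞_t`. -/
theorem katoBdd_of_le_mul {T : ℝ} (hT : 0 ≤ T) {Y H : ℝ → L2} {a : ℝ} (ha : 0 ≤ a)
    {G : ℝ → ℝ≥0∞} (hG : Measurable G) {m : ℝ} (hm : 0 ≤ m)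
    (hGm : ∫⁻ x, G x ^ 2 ≤ ENNReal.ofReal (m ^ 2)) (hY : ∀ τ ∈ Icc (0 : ℝ) T, ∀ᵐ x : ℝ,
      ‖Y τ x‖ₑ ≤ G x * ‖H τ x‖ₑ) (hH : ∀ τ ∈ Icc (0 : ℝ) T, ‖H τ‖ ≤ a) :
    KatoBdd T Y (m * a * Real.sqrt T) := by
  refine ⟨by positivity, fun ψ hψ t ht => ?_⟩
  have mI := (measurable_katoEnergy ψ t hG).pow_const (1 / 2 : ℝ)
  refine ⟨fun τ => ENNReal.ofReal a * katoEnergy ψ t G τ ^ (1 / 2 : ℝ), mI.const_mul _,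
    fun τ hτ => ?_, ?_⟩
  · have hτ' : τ ∈ Icc (0 : ℝ) T := ⟨hτ.1, hτ.2.trans ht.2⟩
    exact (enorm_inner_le_katoEnergy hψ t τ hG (hY τ hτ')).trans
      (mul_le_mul' (ENNReal.ofReal_le_ofReal (hH τ hτ')) le_rfl)
  · rw [lintegral_const_mul _ mI]
    refine (mul_le_mul' le_rfl (lintegral_katoEnergy_sqrt_le hψ hT ht.2 hG hm hGm)).trans
      (le_of_eq ?_)
    rw [← ENNReal.ofReal_mul ha]
    congr 1
    ring

/-! ### The Airy group -/

theorem mulDom_airySym (t : ℝ) (f : L2) : MulDom (airySym t) f :=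
  mulDom_of_bounded (continuous_airySym t) (C := 1) (fun ξ => (norm_airySym t ξ).le) f

theorem airy_add_right (t : ℝ) (f g : L2) : airy t (f + g) = airy t f + airy t g :=
  fourierMul_add (mulDom_airySym t f) (mulDom_airySym t g)

theorem airy_sub_right (t : ℝ) (f g : L2) : airy t (f - g) = airy t f - airy t g :=
  fourierMul_sub (mulDom_airySym t f) (mulDom_airySym t g)

theorem airy_smul_right (t : ℝ) (c : ℂ) (f : L2) : airy t (c • f) = c • airy t f :=
  fourierMul_smul (mulDom_airySym t f) c

theorem airy_airy (t r : ℝ) (f : L2) : airy t (airy r f) = airy (t + r) f := by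
  rw [airy_def, airy_def, airy_def, fourierMul_fourierMul (mulDom_airySym r f)]
  congr 1
  funext ξ
  rw [airySym, airySym, airySym, ← Complex.exp_add]
  congr 1
  push_cast
  ring

theorem airy_zero_left (f : L2) : airy 0 f = f := by
  have : airySym 0 = fun _ => 1 := by
    funext ξ
    simp [airySym]
  rw [airy_def, this, fourierMul_one]

theorem norm_airy (t : ℝ) (f : L2) : ‖airy t f‖ = ‖f‖ := by
  have h : ∀ (t : ℝ) (f : L2), ‖airy t f‖ ≤ ‖f‖ := by
    intro t f
    have := norm_fourierMul_le_of_bounded (continuous_airySym t) (C := 1)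
      (fun ξ => (norm_airySym t ξ).le) f
    rwa [one_mul] at this
  refine le_antisymm (h t f) ?_
  have := h (-t) (airy t f)
  rwa [airy_airy, neg_add_cancel, airy_zero_left] at this

/-- The Airy group as a family of bounded operators. -/
def airyCLM (t : ℝ) : L2 →L[ℂ] L2 :=
  LinearMap.mkContinuous
    { toFun := airy t, map_add' := airy_add_right t, map_smul' := airy_smul_right t } 1
    fun f => by simpa using (norm_airy t f).le

theorem airyCLM_apply (t : ℝ) (f : L2) : airyCLM t f = airy t f := rfl

theorem inner_airy_airy (t : ℝ) (f g : L2) : ⟪airy t f, airy t g⟫_ℂ = ⟪f, g⟫_ℂ := by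
  have h1 : ∀ ξ, conj (airySym t ξ) * airySym t ξ = 1 := by
    intro ξ
    rw [mul_comm, Complex.mul_conj, Complex.normSq_eq_norm_sq, norm_airySym]
    simp
  have := inner_fourierMul_fourierMul (mulDom_airySym t f) (mulDom_airySym t g) (mulDom_one f)
    (mulDom_one g) fun ξ => by simpa using h1 ξ
  rwa [fourierMul_one, fourierMul_one] at this

theorem MemHs.airy {s : ℕ} {f : L2} (hf : MemHs s f) (t : ℝ) :
    MemHs s (airy t f) ∧ hsNorm s (CombinedKdV.airy t f) = hsNorm s f := by
  have hd : ∀ (t : ℝ) {f : L2}, MemHs s f →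
      MemHs s (CombinedKdV.airy t f) ∧ hsNorm s (CombinedKdV.airy t f) ≤ hsNorm s f := by
    intro t f hf
    have hc : Continuous fun ξ => jsym s ξ * airySym t ξ :=
      (continuous_jsym s).mul (continuous_airySym t)
    have hle : ∀ ξ, ‖jsym s ξ * airySym t ξ‖ ≤ 1 * jb ξ ^ s := fun ξ => by
      rw [norm_mul, norm_jsym, norm_airySym, mul_one, one_mul]
    have hm : MemHs s (CombinedKdV.airy t f) :=
      memHs_iff.2 ((mulDom_airySym t f).fourierMul_iff.2 (hf.mulDom hc hle))
    refine ⟨hm, ?_⟩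
    rw [hsNorm_eq hm, bessel, airy_def, fourierMul_fourierMul (mulDom_airySym t f)]
    simpa using hf.norm_fourierMul_le hc hle
  refine ⟨(hd t hf).1, le_antisymm (hd t hf).2 ?_⟩
  have := (hd (-t) (hd t hf).1).2
  rwa [airy_airy, neg_add_cancel, airy_zero_left] at this

theorem exists_bandLimited_norm_sub_lt (f : L2) {ε : ℝ} (hε : 0 < ε) :
    ∃ ψ : L2, BandLimited ψ ∧ ‖f - ψ‖ < ε := by
  obtain ⟨g, hg, hle, hgc, hgm⟩ := (Lp.memLp (𝓕 f : L2)).exists_hasCompactSupport_eLpNorm_sub_le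
    (by norm_num) (ε := ENNReal.ofReal (ε / 2)) (by simpa using hε)
  have hF : (𝓕 (𝓕⁻ (hgm.toLp g) : L2) : L2) = hgm.toLp g := fourier_fourierInv _
  refine ⟨𝓕⁻ (hgm.toLp g), ?_, ?_⟩
  · obtain ⟨N, hN⟩ := hg.isCompact.isBounded.subset_closedBall 0
    refine ⟨N, ?_⟩
    rw [hF]
    filter_upwards [hgm.coeFn_toLp] with η h1 h2
    rw [h1]
    refine image_eq_zero_of_notMem_tsupport fun h3 => ?_
    have := hN h3
    rw [mem_closedBall_zero_iff, Real.norm_eq_abs] at this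
    linarith
  · rw [← norm_fourier, show (𝓕 (f - 𝓕⁻ (hgm.toLp g)) : L2) = 𝓕 f - 𝓕 (𝓕⁻ (hgm.toLp g) : L2) from
      (Lp.fourierTransformₗᵢ ℝ ℂ).map_sub _ _, hF, Lp.norm_def]
    have h1 : eLpNorm ((𝓕 f : L2) - hgm.toLp g : L2) 2 volume ≤ ENNReal.ofReal (ε / 2) := by
      refine le_trans (le_of_eq (eLpNorm_congr_ae ?_)) hle
      filter_upwards [hgm.coeFn_toLp, Lp.coeFn_sub (𝓕 f : L2) (hgm.toLp g)] with η h1 h2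
      rw [h2, Pi.sub_apply, Pi.sub_apply, h1]
    exact (ENNReal.toReal_le_of_le_ofReal (by positivity) h1).trans_lt (by linarith)

/-- Taylor expansion for `|x| ≤ 1`; for `|x| > 1` the trivial bound `2 + |x|` is below `3x²`. -/
theorem norm_exp_I_mul_sub_le (x : ℝ) :
    ‖Complex.exp (Complex.I * (x : ℂ)) - 1 - Complex.I * x‖ ≤ 3 * x ^ 2 := by
  have hn : ‖Complex.I * (x : ℂ)‖ = |x| := by simp
  rcases le_or_gt |x| 1 with h | h
  · have := Complex.norm_exp_sub_one_sub_id_le (x := Complex.I * x) (by rw [hn]; exact h)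
    rw [hn, sq_abs] at this
    nlinarith [sq_nonneg x]
  · have h1 : ‖Complex.exp (Complex.I * (x : ℂ))‖ = 1 := by
      rw [mul_comm]
      exact Complex.norm_exp_ofReal_mul_I x
    calc _ ≤ ‖Complex.exp (Complex.I * (x : ℂ))‖ + ‖(1 : ℂ)‖ + ‖Complex.I * (x : ℂ)‖ :=
          (norm_sub_le _ _).trans (by gcongr; exact norm_sub_le _ _)
      _ = 2 + |x| := by rw [h1, hn, norm_one]; ring
      _ ≤ _ := by
        rw [← sq_abs]
        nlinarith

/-- The symbol of the generator of the Airy group. -/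
def genSym (ξ : ℝ) : ℂ := Complex.I * ((ξ ^ 3 : ℝ) : ℂ)

theorem continuous_genSym : Continuous genSym := by
  unfold genSym
  fun_prop

theorem norm_airy_sub_sub_le {ψ : L2} (hψ : BandLimited ψ) (h : ℝ) :
    ‖airy h ψ - ψ - (h : ℂ) • fourierMul genSym ψ‖ ≤
      3 * h ^ 2 * ‖fourierMul (fun ξ => ((ξ ^ 6 : ℝ) : ℂ)) ψ‖ := by
  have hg := hψ.mulDom continuous_genSym
  have hc : Continuous fun ξ => airySym h ξ - 1 - (h : ℂ) * genSym ξ :=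
    ((continuous_airySym h).sub continuous_const).sub (continuous_const.mul continuous_genSym)
  have e : airy h ψ - ψ - (h : ℂ) • fourierMul genSym ψ
      = fourierMul (fun ξ => airySym h ξ - 1 - (h : ℂ) * genSym ξ) ψ := by
    apply fourier_injective
    filter_upwards [fourier_sub_ae (airy h ψ - ψ) ((h : ℂ) • fourierMul genSym ψ),
      fourier_sub_ae (airy h ψ) ψ, fourier_smul_ae (h : ℂ) (fourierMul genSym ψ),
      fourier_fourierMul_ae hg, fourier_fourierMul_ae (mulDom_airySym h ψ),
      fourier_fourierMul_ae (hψ.mulDom hc)] with η e1 e2 e3 e4 e5 e6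
    rw [e1, e2, e3, e4, airy_def, e5, e6]
    ring
  rw [e]
  refine norm_fourierMul_le hc (hψ.mulDom (by fun_prop)) fun ξ => ?_
  have := norm_exp_I_mul_sub_le (ξ ^ 3 * h)
  have e2 : airySym h ξ - 1 - (h : ℂ) * genSym ξ
      = Complex.exp (Complex.I * ((ξ ^ 3 * h : ℝ) : ℂ)) - 1 - Complex.I * ((ξ ^ 3 * h : ℝ) : ℂ) := by
    rw [airySym, genSym]
    push_cast
    ring
  rw [e2]
  refine this.trans (le_of_eq ?_)
  rw [Complex.norm_real, Real.norm_of_nonneg (by positivity)]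
  ring

/-- The group law and isometry reduce the claim to time 0, where the Taylor remainder is `O(h²)`
because the multiplier `ξ⁶` is defined on band-limited functions. -/
theorem hasDerivAt_airy {ψ : L2} (hψ : BandLimited ψ) (t : ℝ) :
    HasDerivAt (fun t => airy t ψ) (airy t (fourierMul genSym ψ)) t := by
  rw [hasDerivAt_iff_isLittleO_nhds_zero]
  have h1 : (fun h : ℝ => airy (t + h) ψ - airy t ψ - h • airy t (fourierMul genSym ψ))
      =O[nhds 0] fun h : ℝ => h ^ 2 := by
    refine Asymptotics.IsBigO.of_bound (3 * ‖fourierMul (fun ξ => ((ξ ^ 6 : ℝ) : ℂ)) ψ‖)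
      (Filter.Eventually.of_forall fun h => ?_)
    have e : airy (t + h) ψ - airy t ψ - h • airy t (fourierMul genSym ψ)
        = airy t (airy h ψ - ψ - (h : ℂ) • fourierMul genSym ψ) := by
      rw [airy_sub_right, airy_sub_right, airy_airy, airy_smul_right]
      rfl
    rw [e, norm_airy, Real.norm_of_nonneg (sq_nonneg h)]
    refine (norm_airy_sub_sub_le hψ h).trans (le_of_eq ?_)
    ring
  exact h1.trans_isLittleO (Asymptotics.isLittleO_pow_id one_lt_two)

/-- The operators are isometries, so orbits of band-limited approximants converge uniformly in time.
-/
theorem continuous_airy_left (f : L2) : Continuous fun t => airy t f := by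
  refine continuous_of_uniform_approx_of_continuous fun u hu => ?_
  obtain ⟨ε, hε, h⟩ := Metric.mem_uniformity_dist.1 hu
  obtain ⟨ψ, hψ, hlt⟩ := exists_bandLimited_norm_sub_lt f hε
  refine ⟨fun t => airy t ψ,
    continuous_iff_continuousAt.2 fun t => (hasDerivAt_airy hψ t).continuousAt, fun t => h ?_⟩
  rwa [dist_eq_norm, ← airy_sub_right, norm_airy]

theorem continuous_airy : Continuous fun p : ℝ × L2 => airy p.1 p.2 := by
  rw [continuous_iff_continuousAt]
  rintro ⟨t, f⟩
  rw [ContinuousAt, tendsto_iff_norm_sub_tendsto_zero]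
  have h1 : Filter.Tendsto (fun p : ℝ × L2 => ‖p.2 - f‖ + ‖airy p.1 f - airy t f‖) (nhds (t, f))
      (nhds (‖f - f‖ + ‖airy t f - airy t f‖)) := by
    have hc := continuous_airy_left f
    exact Continuous.tendsto (by fun_prop) (t, f)
  simp only [sub_self, norm_zero, add_zero] at h1
  refine squeeze_zero (fun p => norm_nonneg _) (fun p => ?_) h1
  calc ‖airy p.1 p.2 - airy t f‖ = ‖airy p.1 (p.2 - f) + (airy p.1 f - airy t f)‖ := by
        rw [airy_sub_right]
        congr 1
        abel
    _ ≤ _ := by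
        refine (norm_add_le _ _).trans ?_
        rw [norm_airy]

/-! ### Duhamel integrals -/

/-- Local smoothing for the Duhamel integral. -/
theorem memHs_duhamel {s : ℕ} (hs : 1 ≤ s) {T B : ℝ} {P : ℝ → L2}
    (hP : ∀ τ ∈ Icc (0 : ℝ) T, MemHs s (P τ)) (hK : KatoBdd T (fun τ => bessel s (P τ)) B)
    {t : ℝ} (ht : t ∈ Icc (0 : ℝ) T)
    (hi : IntervalIntegrable (fun τ => airy (t - τ) (ddx (P τ))) volume 0 t) :
    MemHs s (∫ τ in (0 : ℝ)..t, airy (t - τ) (ddx (P τ))) ∧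
      hsNorm s (∫ τ in (0 : ℝ)..t, airy (t - τ) (ddx (P τ))) ≤ B := by
  refine memHs_of_inner_le hK.1 fun ψ hψ => ?_
  obtain ⟨β, -, b1, b2⟩ := hK.2 ψ hψ t ht
  have e := ((innerSL ℂ (bessel s ψ)).intervalIntegral_comp_comm hi).symm
  simp only [innerSL_apply_apply] at e
  rw [e, intervalIntegral.integral_of_le ht.1]
  have hB : 0 ≤ B * ‖ψ‖ := mul_nonneg hK.1 (norm_nonneg _)
  rw [← ENNReal.ofReal_le_ofReal_iff hB, ofReal_norm]
  refine (enorm_integral_le_lintegral_enorm _).trans ?_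
  refine (lintegral_mono_set (μ := volume) Ioc_subset_Icc_self).trans ?_
  refine (setLIntegral_mono' measurableSet_Icc fun τ hτ => ?_).trans b2
  have hm := hP τ ⟨hτ.1, hτ.2.trans ht.2⟩
  have hI : Continuous fun ξ : ℝ => Complex.I * (ξ : ℂ) := by fun_prop
  have hA := continuous_airySym (t - τ)
  have hm1 := hm.mono hs
  have hd : MulDom (fun ξ : ℝ => Complex.I * (ξ : ℂ)) (P τ) :=
    hm1.mulDom hI (C := 1) fun ξ => by simpa using abs_le_jb ξ
  have hd2 : MulDom (fun ξ : ℝ => airySym (t - τ) ξ * (Complex.I * (ξ : ℂ))) (P τ) :=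
    hm1.mulDom (by fun_prop) (C := 1) fun ξ => by simpa [norm_airySym] using abs_le_jb ξ
  -- `J^s` passes from the test function to `P τ`, while the derivative and the group pass to the
  -- test function. No derivative of `J^s (P τ)` is taken.
  have e2 := inner_fourierMul_fourierMul (hψ.mulDom (continuous_jsym s)) hd2
    (hψ.mulDom (continuous_katoSym t τ)) (memHs_iff.1 hm) fun ξ => by
      simp only [jsym, katoSym, Complex.conj_ofReal, Complex.conj_conj]
      ring
  rw [airy_def, ddx_def, fourierMul_fourierMul hd, bessel, e2]
  exact b1 τ hτ

theorem norm_le_of_inner_le {f : L2} {C : ℝ} (hC : 0 ≤ C)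
    (h : ∀ ψ : L2, BandLimited ψ → ‖⟪ψ, f⟫_ℂ‖ ≤ C * ‖ψ‖) : ‖f‖ ≤ C := by
  have h0 : ∀ ψ, bessel 0 ψ = ψ := fun ψ => by
    rw [bessel, show jsym 0 = fun _ => 1 by funext ξ; simp [jsym], fourierMul_one]
  obtain ⟨h1, h2⟩ := memHs_of_inner_le (s := 0) hC fun ψ hψ => by rw [h0]; exact h ψ hψ
  exact (norm_le_hsNorm h1).trans h2

theorem continuous_airy_comp {F : ℝ → L2} (hF : Continuous F) (t : ℝ) :
    Continuous fun τ => airy (t - τ) (F τ) := by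
  have h : Continuous fun τ : ℝ => (t - τ, F τ) := by fun_prop
  have h2 := continuous_airy.comp h
  simpa only [Function.comp_def] using h2

/-- The group law frees the integrand of `t`, so continuity and differentiation in `t` reduce to a
primitive acted on by the group. -/
theorem duhamel_eq {F : ℝ → L2} (hF : Continuous F) (t : ℝ) :
    ∫ τ in (0 : ℝ)..t, airy (t - τ) (F τ) = airy t (∫ τ in (0 : ℝ)..t, airy (0 - τ) (F τ)) := by
  rw [← airyCLM_apply, ← ContinuousLinearMap.intervalIntegral_comp_comm _
    ((continuous_airy_comp hF 0).intervalIntegrable 0 t)]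
  refine intervalIntegral.integral_congr fun τ _ => ?_
  simp only [airyCLM_apply, airy_airy]
  congr 1
  ring

theorem continuous_duhamel {F : ℝ → L2} (hF : Continuous F) :
    Continuous fun t => ∫ τ in (0 : ℝ)..t, airy (t - τ) (F τ) := by
  have h1 : Continuous fun t => ∫ τ in (0 : ℝ)..t, airy (0 - τ) (F τ) :=
    intervalIntegral.continuous_primitive
      (fun a b => (continuous_airy_comp hF 0).intervalIntegrable a b) 0
  refine (continuous_airy.comp (continuous_id.prodMk h1)).congr fun t => ?_
  rw [duhamel_eq hF]
  rfl

/-- A mild solution which is bounded in `H³` is Lipschitz in `L²`. -/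
theorem lipschitz_mild {F : ℝ → L2} (hF : Continuous F) (φ : L2) {T K a : ℝ}
    {v : ℝ → L2} (hv : ∀ t, v t = airy t φ - ∫ τ in (0 : ℝ)..t, airy (t - τ) (F τ))
    (hm : ∀ t ∈ Icc (0 : ℝ) T, MemHs 3 (v t) ∧ hsNorm 3 (v t) ≤ a)
    (hK : ∀ t ∈ Icc (0 : ℝ) T, ‖F t‖ ≤ K) {t r : ℝ} (ht : t ∈ Icc (0 : ℝ) T)
    (hr : r ∈ Icc (0 : ℝ) T) : ‖v t - v r‖ ≤ (a + K) * |t - r| := by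
  have ha : 0 ≤ a := (hsNorm_nonneg 3 _).trans (hm t ht).2
  have hK0 : 0 ≤ K := (norm_nonneg _).trans (hK t ht)
  refine norm_le_of_inner_le (by positivity) fun ψ hψ => ?_
  -- The interaction picture `f t = W(-t) v(t)`, which is differentiable with derivative `-W(-t)
  -- F(t)`. In the pairing with `ψ` the group acts on the band-limited side, where it is
  -- differentiable too.
  set f : ℝ → L2 := fun t => φ - ∫ τ in (0 : ℝ)..t, airy (0 - τ) (F τ) with hf
  have hvf : ∀ t, v t = airy t (f t) := fun t => by
    rw [hv, duhamel_eq hF, hf, airy_sub_right]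
  have hfd : ∀ t, HasDerivAt f (-airy (0 - t) (F t)) t := fun t =>
    (intervalIntegral.integral_hasDerivAt_right
      ((continuous_airy_comp hF 0).intervalIntegrable 0 t)
      (continuous_airy_comp hF 0).stronglyMeasurable.stronglyMeasurableAtFilter
      (continuous_airy_comp hF 0).continuousAt).const_sub φ
  have had : ∀ t, HasDerivAt (fun t => airy (-t) ψ) (-airy (-t) (fourierMul genSym ψ)) t := by
    intro t
    have := (hasDerivAt_airy hψ (-t)).scomp t (hasDerivAt_neg t)
    rw [neg_one_smul] at this
    exact this
  have hpe : ∀ t, ⟪ψ, v t⟫_ℂ = ⟪airy (-t) ψ, f t⟫_ℂ := fun t => by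
    rw [← inner_airy_airy (-t), hvf, airy_airy, neg_add_cancel, airy_zero_left]
  have hder : ∀ t ∈ Icc (0 : ℝ) T, HasDerivWithinAt (fun t => ⟪ψ, v t⟫_ℂ)
      (⟪airy (-t) ψ, -airy (0 - t) (F t)⟫_ℂ + ⟪-airy (-t) (fourierMul genSym ψ), f t⟫_ℂ)
      (Icc 0 T) t := by
    intro t _
    rw [funext hpe]
    exact ((had t).inner ℂ (hfd t)).hasDerivWithinAt
  have hbd : ∀ t ∈ Icc (0 : ℝ) T,
      ‖⟪airy (-t) ψ, -airy (0 - t) (F t)⟫_ℂ + ⟪-airy (-t) (fourierMul genSym ψ), f t⟫_ℂ‖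
        ≤ (a + K) * ‖ψ‖ := by
    intro t ht
    have hgc : Continuous fun ξ => -genSym ξ := continuous_genSym.neg
    have hle : ∀ ξ : ℝ, ‖-genSym ξ‖ ≤ 1 * jb ξ ^ 3 := by
      intro ξ
      rw [norm_neg, genSym, norm_mul, Complex.norm_I, Complex.norm_real, Real.norm_eq_abs, abs_pow]
      gcongr
      exact abs_le_jb ξ
    obtain ⟨m1, m2⟩ := hm t ht
    have hd := m1.mulDom hgc hle
    -- The generator, of symbol `iξ³`, returns to `v t`, where the `H³` bound pays for it
    -- independently of the frequency support of `ψ`.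
    have e1 : ⟪airy (-t) (fourierMul genSym ψ), f t⟫_ℂ = ⟪ψ, fourierMul (fun ξ => -genSym ξ) (v t)⟫_ℂ := by
      have e2 : f t = airy (-t) (v t) := by rw [hvf, airy_airy, neg_add_cancel, airy_zero_left]
      rw [e2, inner_airy_airy]
      have := inner_fourierMul_fourierMul (hψ.mulDom continuous_genSym) (mulDom_one (v t))
        (mulDom_one ψ) hd fun ξ => by simp [genSym]
      rwa [fourierMul_one, fourierMul_one] at this
    rw [zero_sub, inner_neg_right, inner_neg_left, inner_airy_airy, e1]
    have n1 := m1.norm_fourierMul_le hgc hle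
    calc _ ≤ ‖⟪ψ, F t⟫_ℂ‖ + ‖⟪ψ, fourierMul (fun ξ => -genSym ξ) (v t)⟫_ℂ‖ := by
          refine (norm_add_le _ _).trans ?_
          rw [norm_neg, norm_neg]
      _ ≤ ‖ψ‖ * K + ‖ψ‖ * a := by
          gcongr
          · exact (norm_inner_le_norm _ _).trans (by gcongr; exact hK t ht)
          · refine (norm_inner_le_norm _ _).trans ?_
            gcongr
            linarith
      _ = _ := by ring
  have := (convex_Icc (0 : ℝ) T).norm_image_sub_le_of_norm_hasDerivWithin_le hder hbd hr ht
  rw [inner_sub_right]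
  refine this.trans (le_of_eq ?_)
  rw [Real.norm_eq_abs]
  ring

/-! ### Maximal functions -/

/-- The maximal function `sup_{t ∈ [0, T]} |u(t, x)|` has `L²` norm at most `m`. -/
def HasMaj (T : ℝ) (u : ℝ → L2) (m : ℝ) : Prop :=
  0 ≤ m ∧ ∃ G : ℝ → ℝ≥0∞, Measurable G ∧ ∫⁻ x, G x ^ 2 ≤ ENNReal.ofReal (m ^ 2) ∧
    ∀ t ∈ Icc (0 : ℝ) T, ∀ᵐ x : ℝ, ‖u t x‖ₑ ≤ G x

theorem HasMaj.mono {T m m' : ℝ} {u : ℝ → L2} (h : HasMaj T u m) (hm : m ≤ m') : HasMaj T u m' := by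
  obtain ⟨h0, G, h1, h2, h3⟩ := h
  exact ⟨h0.trans hm, G, h1, h2.trans (ENNReal.ofReal_le_ofReal (by gcongr)), h3⟩

theorem HasMaj.congr {T m : ℝ} {u v : ℝ → L2} (h : HasMaj T u m)
    (huv : ∀ t ∈ Icc (0 : ℝ) T, v t = u t) : HasMaj T v m := by
  obtain ⟨h0, G, h1, h2, h3⟩ := h
  exact ⟨h0, G, h1, h2, fun t ht => by rw [huv t ht]; exact h3 t ht⟩

theorem HasMaj.add {T m m' : ℝ} {u v : ℝ → L2} (hu : HasMaj T u m) (hv : HasMaj T v m') :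
    HasMaj T (fun t => u t + v t) (m + m') := by
  obtain ⟨h0, G, h1, h2, h3⟩ := hu
  obtain ⟨k0, H, k1, k2, k3⟩ := hv
  refine ⟨add_nonneg h0 k0, fun x => G x + H x, h1.add k1, ?_, fun t ht => ?_⟩
  · have h := ENNReal.lintegral_Lp_add_le (μ := volume) (p := 2) h1.aemeasurable k1.aemeasurable
      one_le_two
    simp only [ENNReal.rpow_two, Pi.add_apply] at h
    have r1 : ∀ {z : ℝ≥0∞} {m : ℝ}, 0 ≤ m → z ≤ ENNReal.ofReal (m ^ 2) →
        z ^ (1 / 2 : ℝ) ≤ ENNReal.ofReal m := by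
      intro z m hm hz
      rw [← ENNReal.pow_le_pow_left_iff two_ne_zero, rpow_half_sq, ← ENNReal.ofReal_pow hm]
      exact hz
    have h4 := h.trans (add_le_add (r1 h0 h2) (r1 k0 k2))
    rw [← ENNReal.ofReal_add h0 k0] at h4
    have h5 := pow_le_pow_left' h4 2
    rwa [rpow_half_sq, ← ENNReal.ofReal_pow (add_nonneg h0 k0)] at h5
  · filter_upwards [h3 t ht, k3 t ht, Lp.coeFn_add (u t) (v t)] with x e1 e2 e3
    rw [e3, Pi.add_apply]
    exact (enorm_add_le _ _).trans (add_le_add e1 e2)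

theorem HasMaj.zero (T : ℝ) : HasMaj T (fun _ => 0) 0 := by
  refine ⟨le_rfl, fun _ => 0, measurable_const, by simp, fun t _ => ?_⟩
  filter_upwards [Lp.coeFn_zero ℂ 2 (volume : Measure ℝ)] with x hx
  rw [hx]
  simp

/-- The sum of `|v(0)|` and the increments of `v` along the dyadic partition of `[0, T]`. -/
def dyadicVar (T : ℝ) (v : ℝ → L2) (n : ℕ) (x : ℝ) : ℝ :=
  ‖v 0 x‖ + ∑ i ∈ Finset.range (2 ^ n),
    ‖(v ((i + 1 : ℕ) * (T / 2 ^ n)) - v (i * (T / 2 ^ n)) : L2) x‖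

theorem measurable_dyadicVar (T : ℝ) (v : ℝ → L2) (n : ℕ) : Measurable (dyadicVar T v n) := by
  unfold dyadicVar
  refine (Lp.stronglyMeasurable _).norm.measurable.add (Finset.measurable_sum _ fun i _ => ?_)
  exact (Lp.stronglyMeasurable _).norm.measurable

theorem dyadic_mem_Icc {T : ℝ} (hT : 0 ≤ T) {n i : ℕ} (hi : i ≤ 2 ^ n) :
    (i : ℝ) * (T / 2 ^ n) ∈ Icc (0 : ℝ) T := by
  refine ⟨by positivity, ?_⟩
  have : (i : ℝ) ≤ 2 ^ n := by exact_mod_cast hi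
  calc (i : ℝ) * (T / 2 ^ n) ≤ 2 ^ n * (T / 2 ^ n) := by gcongr
    _ = T := by field_simp

/-- Minkowski: the `2^n` increments have `L²` norm at most `K T / 2^n` each, so the total does not
depend on `n`. -/
theorem lintegral_dyadicVar_le {T K : ℝ} (hT : 0 ≤ T) (hK : 0 ≤ K) {v : ℝ → L2}
    (hv : ∀ t ∈ Icc (0 : ℝ) T, ∀ r ∈ Icc (0 : ℝ) T, ‖v t - v r‖ ≤ K * |t - r|) (n : ℕ) :
    ∫⁻ x, ‖dyadicVar T v n x‖ₑ ^ 2 ≤ ENNReal.ofReal ((‖v 0‖ + K * T) ^ 2) := by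
  rw [← eLpNorm_two_sq, ENNReal.ofReal_pow (by positivity)]
  gcongr
  have m1 : ∀ f : L2, AEStronglyMeasurable (fun x => ‖f x‖) volume :=
    fun f => (Lp.aestronglyMeasurable f).norm
  have n1 : ∀ f : L2, eLpNorm (fun x => ‖f x‖) 2 volume = ENNReal.ofReal ‖f‖ := by
    intro f
    rw [eLpNorm_norm, Lp.norm_def, ENNReal.ofReal_toReal (Lp.eLpNorm_ne_top _)]
  set g : ℕ → ℝ → ℝ := fun i x =>
    ‖(v ((i + 1 : ℕ) * (T / 2 ^ n)) - v (i * (T / 2 ^ n)) : L2) x‖ with hg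
  have e : dyadicVar T v n = (fun x => ‖v 0 x‖) + ∑ i ∈ Finset.range (2 ^ n), g i := by
    funext x
    simp only [dyadicVar, Pi.add_apply, Finset.sum_apply, hg]
  rw [e]
  refine (eLpNorm_add_le (m1 _) (Finset.aestronglyMeasurable_sum _ fun i _ => m1 _)
    one_le_two).trans ?_
  rw [n1, ENNReal.ofReal_add (norm_nonneg _) (by positivity)]
  gcongr
  refine (eLpNorm_sum_le (fun i _ => m1 _) one_le_two).trans ?_
  calc ∑ i ∈ Finset.range (2 ^ n), eLpNorm (g i) 2 volume
      ≤ ∑ i ∈ Finset.range (2 ^ n), ENNReal.ofReal (K * (T / 2 ^ n)) := by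
        refine Finset.sum_le_sum fun i hi => ?_
        rw [Finset.mem_range] at hi
        simp only [hg]
        rw [n1]
        apply ENNReal.ofReal_le_ofReal
        refine (hv _ (dyadic_mem_Icc hT hi) _ (dyadic_mem_Icc hT hi.le)).trans (le_of_eq ?_)
        rw [Nat.cast_succ, ← sub_mul, add_sub_cancel_left, one_mul,
          abs_of_nonneg (by positivity)]
    _ = ENNReal.ofReal (K * T) := by
        rw [Finset.sum_const, Finset.card_range, nsmul_eq_mul, ← ENNReal.ofReal_natCast,
          ← ENNReal.ofReal_mul (by positivity)]
        congr 1
        push_cast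
        field_simp

theorem norm_le_dyadicVar (T : ℝ) (v : ℝ → L2) {n i : ℕ} (hi : i ≤ 2 ^ n) :
    ∀ᵐ x : ℝ, ‖v (i * (T / 2 ^ n)) x‖ ≤ dyadicVar T v n x := by
  have h : ∀ᵐ x : ℝ, ∀ j : ℕ, (v ((j + 1 : ℕ) * (T / 2 ^ n)) - v (j * (T / 2 ^ n)) : L2) x
      = v ((j + 1 : ℕ) * (T / 2 ^ n)) x - v (j * (T / 2 ^ n)) x :=
    ae_all_iff.2 fun j => Lp.coeFn_sub _ _
  filter_upwards [h] with x hx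
  have h1 : ∀ j : ℕ, ‖v (j * (T / 2 ^ n)) x‖ ≤ ‖v 0 x‖ + ∑ i ∈ Finset.range j,
      ‖(v ((i + 1 : ℕ) * (T / 2 ^ n)) - v (i * (T / 2 ^ n)) : L2) x‖ := by
    intro j
    induction j with
    | zero => simp
    | succ j ih =>
      rw [Finset.sum_range_succ, hx j, ← add_assoc]
      refine le_trans ?_ (add_le_add ih le_rfl)
      have := norm_add_le (v (j * (T / 2 ^ n)) x)
        (v ((j + 1 : ℕ) * (T / 2 ^ n)) x - v (j * (T / 2 ^ n)) x)
      rwa [add_sub_cancel] at this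
  refine (h1 i).trans ?_
  unfold dyadicVar
  gcongr

/-- A Lipschitz path in `L²` has a square-integrable maximal function. -/
theorem hasMaj_of_lipschitz {T K : ℝ} (hT : 0 < T) (hK : 0 ≤ K) {v : ℝ → L2}
    (hv : ∀ t ∈ Icc (0 : ℝ) T, ∀ r ∈ Icc (0 : ℝ) T, ‖v t - v r‖ ≤ K * |t - r|) :
    HasMaj T v (‖v 0‖ + K * T) := by
  have hmeas : ∀ n, Measurable fun x => ‖dyadicVar T v n x‖ₑ :=
    fun n => (measurable_dyadicVar T v n).enorm
  -- The majorant is the lower limit of the dyadic variations; Fatou transfers their uniform bound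
  -- to it.
  refine ⟨by positivity, fun x => Filter.liminf (fun n => ‖dyadicVar T v n x‖ₑ) Filter.atTop,
    Measurable.liminf hmeas, ?_, fun t ht => ?_⟩
  · have e : ∀ x, (Filter.liminf (fun n => ‖dyadicVar T v n x‖ₑ) Filter.atTop) ^ 2
        ≤ Filter.liminf (fun n => ‖dyadicVar T v n x‖ₑ ^ 2) Filter.atTop := by
      intro x
      have hmono : Monotone fun z : ℝ≥0∞ => z ^ 2 := fun a b h => pow_le_pow_left' h 2
      exact (hmono.map_liminf_of_continuousAt (fun n => ‖dyadicVar T v n x‖ₑ)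
        (ENNReal.continuous_pow 2).continuousAt).le
    refine (lintegral_mono e).trans ((lintegral_liminf_le fun n => (hmeas n).pow_const 2).trans ?_)
    refine Filter.liminf_le_of_le (by isBoundedDefault) fun b hb => ?_
    obtain ⟨n, hn⟩ := hb.exists
    exact hn.trans (lintegral_dyadicVar_le hT.le hK hv n)
  · have hdy : ∀ m i : ℕ, i ≤ 2 ^ m → ∀ᵐ x : ℝ, ‖v (i * (T / 2 ^ m)) x‖ₑ ≤
        Filter.liminf (fun n => ‖dyadicVar T v n x‖ₑ) Filter.atTop := by
      intro m i hi
      have h1 : ∀ᵐ x : ℝ, ∀ k : ℕ, ‖v (i * (T / 2 ^ m)) x‖ ≤ dyadicVar T v (m + k) x := by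
        refine ae_all_iff.2 fun k => ?_
        -- A dyadic time of level `m` is one of every finer level, so all later variations dominate
        -- the path there, and so does their lower limit.
        have h2 : i * 2 ^ k ≤ 2 ^ (m + k) := by
          rw [pow_add]
          exact Nat.mul_le_mul_right _ hi
        have h3 := norm_le_dyadicVar T v h2
        have h4 : ((i * 2 ^ k : ℕ) : ℝ) * (T / 2 ^ (m + k)) = i * (T / 2 ^ m) := by
          push_cast
          rw [pow_add]
          field_simp
        rwa [h4] at h3
      filter_upwards [h1] with x hx
      refine Filter.le_liminf_of_le (by isBoundedDefault) ?_
      filter_upwards [Filter.eventually_ge_atTop m] with n hn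
      obtain ⟨k, rfl⟩ := Nat.exists_eq_add_of_le hn
      rw [enorm_le_iff_norm_le, Real.norm_eq_abs]
      exact (hx k).trans (le_abs_self _)
    set i : ℕ → ℕ := fun m => ⌊t / T * 2 ^ m⌋₊ with hi
    have htT : 0 ≤ t / T := div_nonneg ht.1 hT.le
    have htT1 : t / T ≤ 1 := (div_le_one hT).2 ht.2
    have hi2 : ∀ m, i m ≤ 2 ^ m := by
      intro m
      refine Nat.floor_le_of_le ?_
      push_cast
      nlinarith [pow_pos (two_pos (α := ℝ)) m]
    have hdist : ∀ m, |(i m : ℝ) * (T / 2 ^ m) - t| ≤ T * (1 / 2) ^ m := by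
      intro m
      have p2 := pow_pos (two_pos (α := ℝ)) m
      have f1 := Nat.floor_le (a := t / T * 2 ^ m) (by positivity)
      have f2 := Nat.lt_floor_add_one (t / T * 2 ^ m)
      have e1 : (i m : ℝ) * (T / 2 ^ m) - t = ((i m : ℝ) - t / T * 2 ^ m) * (T / 2 ^ m) := by
        field_simp
      have e2 : T * (1 / 2 : ℝ) ^ m = 1 * (T / 2 ^ m) := by
        rw [one_div, inv_pow]
        field_simp
      rw [e1, abs_mul, abs_of_nonneg (by positivity : 0 ≤ T / 2 ^ m), e2]
      gcongr
      rw [abs_le]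
      constructor <;> simp only [hi] <;> linarith
    have hlim : Filter.Tendsto (fun m => v (i m * (T / 2 ^ m))) Filter.atTop (nhds (v t)) := by
      rw [tendsto_iff_norm_sub_tendsto_zero]
      have hz : Filter.Tendsto (fun m : ℕ => K * (T * (1 / 2 : ℝ) ^ m)) Filter.atTop (nhds 0) := by
        have := ((tendsto_pow_atTop_nhds_zero_of_lt_one (by norm_num : (0 : ℝ) ≤ 1 / 2)
          (by norm_num)).const_mul T).const_mul K
        simpa using this
      refine squeeze_zero (fun m => norm_nonneg _) (fun m => ?_) hz
      refine (hv _ (dyadic_mem_Icc hT.le (hi2 m)) _ ht).trans ?_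
      gcongr
      exact hdist m
    -- For general `t`, the dyadic approximants `⌊2^m t/T⌋ T/2^m` give convergence in `L²`; along a
    -- subsequence it holds almost everywhere and the bound passes to the limit.
    obtain ⟨ns, -, hns⟩ := (tendstoInMeasure_of_tendsto_Lp hlim).exists_seq_tendsto_ae
    filter_upwards [hns, ae_all_iff.2 fun m => hdy m (i m) (hi2 m)] with x h1 h2
    exact le_of_tendsto h1.enorm (Filter.Eventually.of_forall fun k => h2 (ns k))

/-! ### Paths in the resolution space -/

/-- The paths `u : [0, T] → H^s` with `‖u(t)‖_s ≤ a`, continuous in `L²`, whose maximal function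
has `L²` norm at most `(1 + T) a`. -/
structure AdmPath (s : ℕ) (T : ℝ) (u : ℝ → L2) (a : ℝ) : Prop where
  memHs : ∀ t ∈ Icc (0 : ℝ) T, MemHs s (u t)
  le : ∀ t ∈ Icc (0 : ℝ) T, hsNorm s (u t) ≤ a
  cont : ContinuousOn u (Icc 0 T)
  maj : HasMaj T u ((1 + T) * a)

theorem AdmPath.congr {s : ℕ} {T a : ℝ} {u v : ℝ → L2} (h : AdmPath s T u a)
    (huv : ∀ t ∈ Icc (0 : ℝ) T, v t = u t) : AdmPath s T v a where
  memHs t ht := by rw [huv t ht]; exact h.memHs t ht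
  le t ht := by rw [huv t ht]; exact h.le t ht
  cont := h.cont.congr huv
  maj := h.maj.congr huv

theorem AdmPath.mono {s : ℕ} {T a b : ℝ} (hT : 0 < T) {u : ℝ → L2} (h : AdmPath s T u a)
    (hab : a ≤ b) : AdmPath s T u b where
  memHs := h.memHs
  le t ht := (h.le t ht).trans hab
  cont := h.cont
  maj := h.maj.mono (by gcongr)

theorem AdmPath.add {s : ℕ} {T a b : ℝ} {u v : ℝ → L2} (hu : AdmPath s T u a)
    (hv : AdmPath s T v b) : AdmPath s T (fun t => u t + v t) (a + b) where
  memHs t ht := (hu.memHs t ht).add (hv.memHs t ht)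
  le t ht := (hsNorm_add_le (hu.memHs t ht) (hv.memHs t ht)).trans
    (add_le_add (hu.le t ht) (hv.le t ht))
  cont := hu.cont.add hv.cont
  maj := by
    rw [mul_add]
    exact hu.maj.add hv.maj

theorem AdmPath.zero (s : ℕ) (T : ℝ) : AdmPath s T (fun _ => 0) 0 where
  memHs _ _ := MemHs.zero s
  le _ _ := (hsNorm_zero s).le
  cont := continuousOn_const
  maj := by
    rw [mul_zero]
    exact HasMaj.zero T

theorem AdmPath.nonneg {s : ℕ} {T a : ℝ} (hT : 0 ≤ T) {u : ℝ → L2} (h : AdmPath s T u a) : 0 ≤ a :=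
  (hsNorm_nonneg s _).trans (h.le 0 ⟨le_rfl, hT⟩)

/-! ### Products and local smoothing -/

/-- Local smoothing for `c g h` with a bounded factor `c` and `g` in `L²_x L^∞_t`. -/
theorem katoBdd_mul_of_hasMaj {T : ℝ} (hT : 0 ≤ T) {Y f g H : ℝ → L2} {c m b : ℝ} (hc : 0 ≤ c)
    (hb : 0 ≤ b) (hf : ∀ τ ∈ Icc (0 : ℝ) T, ∀ᵐ x : ℝ, ‖f τ x‖ ≤ c) (hg : HasMaj T g m)
    (hH : ∀ τ ∈ Icc (0 : ℝ) T, ‖H τ‖ ≤ b)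
    (hY : ∀ τ ∈ Icc (0 : ℝ) T, ∀ᵐ x : ℝ, Y τ x = f τ x * (g τ x * H τ x)) :
    KatoBdd T Y (Real.sqrt T * (c * (m * b))) := by
  obtain ⟨hm, G, h1, h2, h3⟩ := hg
  have h := katoBdd_of_le_mul hT hb (Y := Y) (H := H) (G := fun x => ENNReal.ofReal c * G x)
    (h1.const_mul _) (m := c * m) (by positivity) (by
      simp only [mul_pow]
      rw [lintegral_const_mul _ (h1.pow_const 2), ENNReal.ofReal_mul (by positivity),
        ← ENNReal.ofReal_pow hc]
      exact mul_le_mul' le_rfl h2) (fun τ hτ => by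
      filter_upwards [hf τ hτ, h3 τ hτ, hY τ hτ] with x e1 e2 e3
      rw [e3, enorm_mul, enorm_mul, mul_assoc]
      refine mul_le_mul' ?_ (mul_le_mul' e2 le_rfl)
      rw [← ofReal_norm]
      exact ENNReal.ofReal_le_ofReal e1) hH
  convert h using 1
  ring

theorem katoBdd_mul_left {T : ℝ} (hT : 0 ≤ T) {g H : ℝ → L2} {m b : ℝ} (hb : 0 ≤ b)
    (hg1 : ∀ τ ∈ Icc (0 : ℝ) T, MemHs 1 (g τ)) (hg : HasMaj T g m)
    (hH : ∀ τ ∈ Icc (0 : ℝ) T, ‖H τ‖ ≤ b) :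
    KatoBdd T (fun τ => mulL2 (g τ) (H τ)) (Real.sqrt T * (m * b)) := by
  obtain ⟨hm, G, h1, h2, h3⟩ := hg
  have h := katoBdd_of_le_mul hT hb (Y := fun τ => mulL2 (g τ) (H τ)) (H := H) h1 hm h2
    (fun τ hτ => by
      filter_upwards [h3 τ hτ, mulL2_ae (hg1 τ hτ) (H τ)] with x e2 e3
      rw [e3, enorm_mul]
      exact mul_le_mul' e2 le_rfl) hH
  convert h using 1
  ring

/-- The two Leibniz main terms go through local smoothing, at `√T (1 + T) ab` each; the `H¹`
remainder costs `T comC s · ab`. -/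
theorem katoBdd_bessel_mul {s : ℕ} (hs : 2 ≤ s) {T a b : ℝ} (hT : 0 ≤ T) {g h : ℝ → L2}
    (hg : AdmPath s T g a) (hh : AdmPath s T h b) :
    KatoBdd T (fun τ => bessel s (mulL2 (g τ) (h τ)))
      ((2 * (Real.sqrt T * (1 + T)) + T * comC s) * (a * b)) := by
  have ha := hg.nonneg hT
  have hb := hh.nonneg hT
  have h1 : 1 ≤ s := by omega
  have k1 := katoBdd_mul_left hT (H := fun τ => bessel s (h τ)) hb
    (fun τ hτ => (hg.memHs τ hτ).mono h1) hg.maj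
    (fun τ hτ => by rw [← hsNorm_eq (hh.memHs τ hτ)]; exact hh.le τ hτ)
  have k2 := katoBdd_mul_left hT (H := fun τ => bessel s (g τ)) ha
    (fun τ hτ => (hh.memHs τ hτ).mono h1) hh.maj
    (fun τ hτ => by rw [← hsNorm_eq (hg.memHs τ hτ)]; exact hg.le τ hτ)
  have hc := comC_nonneg s
  have k3 := katoBdd_of_memHs_one hT (Y := fun τ => leibnizRem s (g τ) (h τ))
    (r := comC s * (a * b)) (by positivity) (fun τ hτ => by
      obtain ⟨e1, e2⟩ := memHs_leibnizRem hs (hg.memHs τ hτ) (hh.memHs τ hτ)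
      refine ⟨e1, e2.trans ?_⟩
      have := hsNorm_nonneg s (h τ)
      gcongr
      · exact hg.le τ hτ
      · exact hh.le τ hτ)
  refine (((k1.add k2).add k3).mono (le_of_eq (by ring))).congr fun τ _ => ?_
  rw [leibnizRem]
  abel

theorem algC_one : algC 1 = Real.sqrt 2 := by simp [algC]

/-- Leibniz for `f · (gh)`, then for `gh`. Each of the three main terms has one factor under `J^s`,
one handled by its maximal function and one bounded by Sobolev embedding. The remainders are `f ·
leibnizRem s g h`, with the `H¹` algebra constant `√2`, and `leibnizRem s f (gh)`, with the `H^s`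
constant `algC s`. -/
theorem katoBdd_bessel_mul_mul {s : ℕ} (hs : 2 ≤ s) {T a b c : ℝ} (hT : 0 ≤ T) {f g h : ℝ → L2}
    (hf : AdmPath s T f a) (hg : AdmPath s T g b) (hh : AdmPath s T h c) :
    KatoBdd T (fun τ => bessel s (mulL2 (f τ) (mulL2 (g τ) (h τ))))
      ((3 * (Real.sqrt T * (1 + T)) + T * (comC s * (algC s + Real.sqrt 2))) * (a * b * c)) := by
  have ha := hf.nonneg hT
  have hb := hg.nonneg hT
  have hc := hh.nonneg hT
  have h1 : 1 ≤ s := by omega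
  have hC := comC_nonneg s
  have hA := algC_nonneg s
  have hf1 := fun τ hτ => (hf.memHs τ hτ).mono h1
  have hg1 := fun τ hτ => (hg.memHs τ hτ).mono h1
  have hh1 := fun τ hτ => (hh.memHs τ hτ).mono h1
  have bdd : ∀ {u : ℝ → L2} {d : ℝ}, AdmPath s T u d → ∀ τ ∈ Icc (0 : ℝ) T,
      ∀ᵐ x : ℝ, ‖u τ x‖ ≤ d := by
    intro u d hu τ hτ
    filter_upwards [ae_norm_le_hsNorm_one ((hu.memHs τ hτ).mono h1)] with x hx
    exact hx.trans ((hsNorm_mono h1 (hu.memHs τ hτ)).trans (hu.le τ hτ))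
  have nrm : ∀ {u : ℝ → L2} {d : ℝ}, AdmPath s T u d → ∀ τ ∈ Icc (0 : ℝ) T,
      ‖bessel s (u τ)‖ ≤ d := by
    intro u d hu τ hτ
    rw [← hsNorm_eq (hu.memHs τ hτ)]
    exact hu.le τ hτ
  have k1 := katoBdd_mul_of_hasMaj hT (f := f) (g := g) (H := fun τ => bessel s (h τ))
    (Y := fun τ => mulL2 (f τ) (mulL2 (g τ) (bessel s (h τ)))) ha hc (bdd hf) hg.maj (nrm hh)
    (fun τ hτ => by
      filter_upwards [mulL2_ae (hf1 τ hτ) (mulL2 (g τ) (bessel s (h τ))),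
        mulL2_ae (hg1 τ hτ) (bessel s (h τ))] with x e1 e2
      rw [e1, e2])
  have k2 := katoBdd_mul_of_hasMaj hT (f := f) (g := h) (H := fun τ => bessel s (g τ))
    (Y := fun τ => mulL2 (f τ) (mulL2 (h τ) (bessel s (g τ)))) ha hb (bdd hf) hh.maj (nrm hg)
    (fun τ hτ => by
      filter_upwards [mulL2_ae (hf1 τ hτ) (mulL2 (h τ) (bessel s (g τ))),
        mulL2_ae (hh1 τ hτ) (bessel s (g τ))] with x e1 e2
      rw [e1, e2])
  have k3 := katoBdd_mul_of_hasMaj hT (f := g) (g := h) (H := fun τ => bessel s (f τ))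
    (Y := fun τ => mulL2 (mulL2 (g τ) (h τ)) (bessel s (f τ))) hb ha (bdd hg) hh.maj (nrm hf)
    (fun τ hτ => by
      filter_upwards [mulL2_ae ((hg1 τ hτ).mul le_rfl (hh1 τ hτ)).1 (bessel s (f τ)),
        mulL2_ae (hg1 τ hτ) (h τ)] with x e1 e2
      rw [e1, e2, mul_assoc])
  have k4 := katoBdd_of_memHs_one hT (Y := fun τ => mulL2 (f τ) (leibnizRem s (g τ) (h τ)))
    (r := Real.sqrt 2 * (a * (comC s * (b * c)))) (by positivity) (fun τ hτ => by
      obtain ⟨e1, e2⟩ := memHs_leibnizRem hs (hg.memHs τ hτ) (hh.memHs τ hτ)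
      obtain ⟨e3, e4⟩ := (hf1 τ hτ).mul le_rfl e1
      refine ⟨e3, e4.trans ?_⟩
      rw [algC_one]
      have n1 := hsNorm_nonneg s (h τ)
      have n2 := hsNorm_nonneg 1 (leibnizRem s (g τ) (h τ))
      gcongr
      · exact (hsNorm_mono h1 (hf.memHs τ hτ)).trans (hf.le τ hτ)
      · refine e2.trans ?_
        gcongr
        · exact hg.le τ hτ
        · exact hh.le τ hτ)
  have k5 := katoBdd_of_memHs_one hT (Y := fun τ => leibnizRem s (f τ) (mulL2 (g τ) (h τ)))
    (r := comC s * (a * (algC s * (b * c)))) (by positivity) (fun τ hτ => by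
      obtain ⟨e1, e2⟩ := (hg.memHs τ hτ).mul h1 (hh.memHs τ hτ)
      obtain ⟨e3, e4⟩ := memHs_leibnizRem hs (hf.memHs τ hτ) e1
      refine ⟨e3, e4.trans ?_⟩
      have n1 := hsNorm_nonneg s (h τ)
      have n2 := hsNorm_nonneg s (mulL2 (g τ) (h τ))
      gcongr
      · exact hf.le τ hτ
      · refine e2.trans ?_
        gcongr
        · exact hg.le τ hτ
        · exact hh.le τ hτ)
  refine (((((k1.add k2).add k4).add k3).add k5).mono (le_of_eq (by ring))).congr fun τ hτ => ?_
  have e1 : mulL2 (f τ) (bessel s (mulL2 (g τ) (h τ))) =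
      mulL2 (f τ) (mulL2 (g τ) (bessel s (h τ))) + mulL2 (f τ) (mulL2 (h τ) (bessel s (g τ))) +
        mulL2 (f τ) (leibnizRem s (g τ) (h τ)) := by
    have e2 : bessel s (mulL2 (g τ) (h τ)) = mulL2 (g τ) (bessel s (h τ)) +
        mulL2 (h τ) (bessel s (g τ)) + leibnizRem s (g τ) (h τ) := by
      rw [leibnizRem]
      abel
    rw [e2]
    have hfm := hf1 τ hτ
    refine Lp.ext ?_
    filter_upwards [mulL2_ae hfm (mulL2 (g τ) (bessel s (h τ)) + mulL2 (h τ) (bessel s (g τ)) +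
        leibnizRem s (g τ) (h τ)), mulL2_ae hfm (mulL2 (g τ) (bessel s (h τ))),
      mulL2_ae hfm (mulL2 (h τ) (bessel s (g τ))), mulL2_ae hfm (leibnizRem s (g τ) (h τ)),
      Lp.coeFn_add (mulL2 (g τ) (bessel s (h τ)) + mulL2 (h τ) (bessel s (g τ)))
        (leibnizRem s (g τ) (h τ)),
      Lp.coeFn_add (mulL2 (g τ) (bessel s (h τ))) (mulL2 (h τ) (bessel s (g τ))),
      Lp.coeFn_add (mulL2 (f τ) (mulL2 (g τ) (bessel s (h τ))) +
        mulL2 (f τ) (mulL2 (h τ) (bessel s (g τ)))) (mulL2 (f τ) (leibnizRem s (g τ) (h τ))),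
      Lp.coeFn_add (mulL2 (f τ) (mulL2 (g τ) (bessel s (h τ))))
        (mulL2 (f τ) (mulL2 (h τ) (bessel s (g τ))))] with x a1 a2 a3 a4 a5 a6 a7 a8
    rw [a1, a7, Pi.add_apply, a8, Pi.add_apply, a5, Pi.add_apply, a6, Pi.add_apply, a2, a3, a4]
    ring
  have e3 : bessel s (mulL2 (f τ) (mulL2 (g τ) (h τ))) =
      mulL2 (f τ) (bessel s (mulL2 (g τ) (h τ))) + mulL2 (mulL2 (g τ) (h τ)) (bessel s (f τ)) +
        leibnizRem s (f τ) (mulL2 (g τ) (h τ)) := by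
    rw [leibnizRem]
    abel
  rw [e3, e1]

/-! ### The nonlinearity -/

theorem nonlin_ae {u : L2} (hu : MemHs 1 u) :
    (nonlin u : ℝ → ℂ) =ᵐ[volume] fun x => u x ^ 2 / 2 + u x ^ 3 / 3 := by
  have h2 := mulL2_ae hu u
  have h3 := mulL2_ae hu (mulL2 u u)
  have hm : MemLp (fun x => (2 : ℂ)⁻¹ * mulL2 u u x + (3 : ℂ)⁻¹ * mulL2 u (mulL2 u u) x) 2 volume :=
    ((Lp.memLp (mulL2 u u)).const_mul _).add ((Lp.memLp (mulL2 u (mulL2 u u))).const_mul _)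
  refine toL2_ae ((memLp_congr_ae ?_).1 hm)
  filter_upwards [h2, h3] with x e2 e3
  rw [e3, e2]
  ring

theorem nonlin_zero : nonlin 0 = 0 := by
  refine Lp.ext ?_
  filter_upwards [nonlin_ae (MemHs.zero 1), Lp.coeFn_zero ℂ 2 (volume : Measure ℝ)] with x h1 h2
  rw [h1, h2]
  simp

/-- The difference of two values of the nonlinearity, factored. -/
theorem nonlin_sub_nonlin {u w : L2} (hu : MemHs 1 u) (hw : MemHs 1 w) :
    nonlin u - nonlin w =
      (2⁻¹ : ℂ) • (mulL2 (u - w) u + mulL2 (u - w) w) +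
      (3⁻¹ : ℂ) • (mulL2 (u - w) (mulL2 u u) + mulL2 (u - w) (mulL2 u w) +
        mulL2 (u - w) (mulL2 w w)) := by
  have hd := hu.sub hw
  set d := u - w with hdef
  refine Lp.ext ?_
  filter_upwards [nonlin_ae hu, nonlin_ae hw, Lp.coeFn_sub (nonlin u) (nonlin w),
    (Lp.coeFn_sub u w : (d : ℝ → ℂ) =ᵐ[volume] _), mulL2_ae hd u, mulL2_ae hd w,
    mulL2_ae hd (mulL2 u u), mulL2_ae hd (mulL2 u w), mulL2_ae hd (mulL2 w w), mulL2_ae hu u,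
    mulL2_ae hu w, mulL2_ae hw w,
    Lp.coeFn_add ((2⁻¹ : ℂ) • (mulL2 d u + mulL2 d w))
      ((3⁻¹ : ℂ) • (mulL2 d (mulL2 u u) + mulL2 d (mulL2 u w) + mulL2 d (mulL2 w w))),
    Lp.coeFn_smul (2⁻¹ : ℂ) (mulL2 d u + mulL2 d w), Lp.coeFn_add (mulL2 d u) (mulL2 d w),
    Lp.coeFn_smul (3⁻¹ : ℂ) (mulL2 d (mulL2 u u) + mulL2 d (mulL2 u w) + mulL2 d (mulL2 w w)),
    Lp.coeFn_add (mulL2 d (mulL2 u u) + mulL2 d (mulL2 u w)) (mulL2 d (mulL2 w w)),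
    Lp.coeFn_add (mulL2 d (mulL2 u u)) (mulL2 d (mulL2 u w))]
    with x a1 a2 a3 a4 a5 a6 a7 a8 a9 b1 b2 b3 c1 c2 c3 c4 c5 c6
  rw [a3, c1]
  simp only [Pi.add_apply, Pi.sub_apply]
  rw [c2, c4]
  simp only [Pi.smul_apply, smul_eq_mul]
  rw [c3, c5]
  simp only [Pi.add_apply]
  rw [c6]
  simp only [Pi.add_apply]
  rw [a1, a2, a5, a6, a7, a8, a9, b1, b2, b3, a4]
  simp only [Pi.sub_apply]
  ring

theorem memHs_nonlin_sub {s : ℕ} (hs : 1 ≤ s) {u w : L2} (hu : MemHs s u) (hw : MemHs s w) :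
    MemHs s (nonlin u - nonlin w) := by
  rw [nonlin_sub_nonlin (hu.mono hs) (hw.mono hs)]
  have hd := hu.sub hw
  exact (((hd.mul hs hu).1.add (hd.mul hs hw).1).smul _).add
    ((((hd.mul hs (hu.mul hs hu).1).1.add (hd.mul hs (hu.mul hs hw).1).1).add
      (hd.mul hs (hw.mul hs hw).1).1).smul _)

theorem memHs_nonlin {s : ℕ} (hs : 1 ≤ s) {u : L2} (hu : MemHs s u) : MemHs s (nonlin u) := by
  have := memHs_nonlin_sub hs hu (MemHs.zero s)
  rwa [nonlin_zero, sub_zero] at this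

/-- The nonlinearity is locally Lipschitz in `H¹`. -/
theorem hsNorm_one_nonlin_sub_le {u w : L2} {R : ℝ} (hu : MemHs 1 u) (hw : MemHs 1 w)
    (huR : hsNorm 1 u ≤ R) (hwR : hsNorm 1 w ≤ R) :
    hsNorm 1 (nonlin u - nonlin w) ≤ (Real.sqrt 2 * R + 2 * R ^ 2) * hsNorm 1 (u - w) := by
  have hd := hu.sub hw
  have hR : 0 ≤ R := (hsNorm_nonneg 1 u).trans huR
  have h0 := hsNorm_nonneg 1 (u - w)
  have p1 : ∀ {z : L2}, MemHs 1 z → hsNorm 1 z ≤ R → MemHs 1 (mulL2 (u - w) z) ∧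
      hsNorm 1 (mulL2 (u - w) z) ≤ Real.sqrt 2 * R * hsNorm 1 (u - w) := by
    intro z hz hzR
    obtain ⟨e1, e2⟩ := hd.mul le_rfl hz
    refine ⟨e1, e2.trans ?_⟩
    rw [algC_one]
    calc _ ≤ Real.sqrt 2 * (hsNorm 1 (u - w) * R) := by gcongr
      _ = _ := by ring
  have p2 : ∀ {z y : L2}, MemHs 1 z → hsNorm 1 z ≤ R → MemHs 1 y → hsNorm 1 y ≤ R →
      MemHs 1 (mulL2 (u - w) (mulL2 z y)) ∧
      hsNorm 1 (mulL2 (u - w) (mulL2 z y)) ≤ 2 * R ^ 2 * hsNorm 1 (u - w) := by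
    intro z y hz hzR hy hyR
    obtain ⟨e1, e2⟩ := hz.mul le_rfl hy
    obtain ⟨e3, e4⟩ := hd.mul le_rfl e1
    refine ⟨e3, e4.trans ?_⟩
    rw [algC_one] at e2 ⊢
    have n1 := hsNorm_nonneg 1 y
    calc _ ≤ Real.sqrt 2 * (hsNorm 1 (u - w) * (Real.sqrt 2 * (R * R))) := by
          gcongr
          refine e2.trans ?_
          gcongr
      _ = Real.sqrt 2 ^ 2 * R ^ 2 * hsNorm 1 (u - w) := by ring
      _ = _ := by rw [Real.sq_sqrt zero_le_two]
  rw [nonlin_sub_nonlin hu hw]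
  obtain ⟨a1, b1⟩ := p1 hu huR
  obtain ⟨a2, b2⟩ := p1 hw hwR
  obtain ⟨a3, b3⟩ := p2 hu huR hu huR
  obtain ⟨a4, b4⟩ := p2 hu huR hw hwR
  obtain ⟨a5, b5⟩ := p2 hw hwR hw hwR
  have s1 := hsNorm_add_le a1 a2
  have s2 := hsNorm_add_le (a3.add a4) a5
  have s3 := hsNorm_add_le a3 a4
  refine (hsNorm_add_le ((a1.add a2).smul _) (((a3.add a4).add a5).smul _)).trans ?_
  rw [hsNorm_smul (a1.add a2), hsNorm_smul ((a3.add a4).add a5)]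
  have c2 : ‖(2⁻¹ : ℂ)‖ = 2⁻¹ := by simp
  have c3 : ‖(3⁻¹ : ℂ)‖ = 3⁻¹ := by simp
  rw [c2, c3]
  -- The constants are `1/2 · 2 · √2 R` from the quadratic part and `1/3 · 3 · (√2)² R²` from the
  -- cubic part.
  linarith

/-- Local smoothing for the difference of two values of the nonlinearity. -/
theorem katoBdd_nonlin_sub {s : ℕ} (hs : 2 ≤ s) {T R d : ℝ} (hT : 0 ≤ T) {u w : ℝ → L2}
    (hu : AdmPath s T u R) (hw : AdmPath s T w R) (hd : AdmPath s T (fun t => u t - w t) d) :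
    KatoBdd T (fun τ => bessel s (nonlin (u τ) - nonlin (w τ)))
      (((2 * (Real.sqrt T * (1 + T)) + T * comC s) * R +
        (3 * (Real.sqrt T * (1 + T)) + T * (comC s * (algC s + Real.sqrt 2))) * R ^ 2) * d) := by
  have h1 : 1 ≤ s := by omega
  have k := (((katoBdd_bessel_mul hs hT hd hu).add (katoBdd_bessel_mul hs hT hd hw)).smul
    (2⁻¹ : ℂ)).add ((((katoBdd_bessel_mul_mul hs hT hd hu hu).add
      (katoBdd_bessel_mul_mul hs hT hd hu hw)).add
      (katoBdd_bessel_mul_mul hs hT hd hw hw)).smul (3⁻¹ : ℂ))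
  have c2 : ‖(2⁻¹ : ℂ)‖ = 2⁻¹ := by simp
  have c3 : ‖(3⁻¹ : ℂ)‖ = 3⁻¹ := by simp
  rw [c2, c3] at k
  refine (k.mono (le_of_eq (by ring))).congr fun τ hτ => ?_
  have mu := hu.memHs τ hτ
  have mw := hw.memHs τ hτ
  have md := mu.sub mw
  rw [nonlin_sub_nonlin (mu.mono h1) (mw.mono h1)]
  have a1 := (md.mul h1 mu).1
  have a2 := (md.mul h1 mw).1
  have a3 := (md.mul h1 (mu.mul h1 mu).1).1
  have a4 := (md.mul h1 (mu.mul h1 mw).1).1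
  have a5 := (md.mul h1 (mw.mul h1 mw).1).1
  rw [bessel_add ((a1.add a2).smul _) (((a3.add a4).add a5).smul _), bessel_smul (a1.add a2),
    bessel_smul ((a3.add a4).add a5), bessel_add a1 a2, bessel_add (a3.add a4) a5,
    bessel_add a3 a4]

theorem norm_ddx_le {f : L2} (hf : MemHs 1 f) : ‖ddx f‖ ≤ hsNorm 1 f := by
  have := hf.norm_fourierMul_le (m := fun ξ : ℝ => Complex.I * (ξ : ℂ)) (by fun_prop) (C := 1)
    fun ξ => by simpa using abs_le_jb ξ
  rwa [one_mul] at this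

theorem ddx_sub {f g : L2} (hf : MemHs 1 f) (hg : MemHs 1 g) : ddx (f - g) = ddx f - ddx g := by
  have h : ∀ {f : L2}, MemHs 1 f → MulDom (fun ξ : ℝ => Complex.I * (ξ : ℂ)) f := fun hf =>
    hf.mulDom (by fun_prop) (C := 1) fun ξ => by simpa using abs_le_jb ξ
  exact fourierMul_sub (h hf) (h hg)

/-- An admissible path is continuous only in `L²`. Boundedness in `H²` and the interpolation `‖f‖_1²
≤ ‖f‖_0 ‖f‖_2` give continuity in `H¹`, enough for the derivative of the nonlinearity to be
continuous in `L²` and the integrand Bochner integrable. -/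
theorem continuousOn_ddx_nonlin {s : ℕ} (hs : 2 ≤ s) {T a : ℝ} {u : ℝ → L2}
    (hu : AdmPath s T u a) : ContinuousOn (fun τ => ddx (nonlin (u τ))) (Icc 0 T) := by
  have h1 : 1 ≤ s := by omega
  intro t ht
  have ha : 0 ≤ a := (hsNorm_nonneg s _).trans (hu.le t ht)
  rw [ContinuousWithinAt, tendsto_iff_norm_sub_tendsto_zero]
  have hlim : Filter.Tendsto (fun τ => (Real.sqrt 2 * a + 2 * a ^ 2) *
      Real.sqrt (‖u τ - u t‖ * (a + a))) (nhdsWithin t (Icc 0 T)) (nhds 0) := by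
    have h2 := tendsto_iff_norm_sub_tendsto_zero.1 (hu.cont t ht)
    have h3 := ((Real.continuous_sqrt.tendsto _).comp (h2.mul_const (a + a))).const_mul
      (Real.sqrt 2 * a + 2 * a ^ 2)
    simpa using h3
  refine squeeze_zero' (Filter.Eventually.of_forall fun τ => norm_nonneg _) ?_ hlim
  filter_upwards [self_mem_nhdsWithin] with τ hτ
  have mu := hu.memHs τ hτ
  have mt := hu.memHs t ht
  have mu1 := mu.mono h1
  have mt1 := mt.mono h1
  rw [← ddx_sub (memHs_nonlin le_rfl mu1) (memHs_nonlin le_rfl mt1)]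
  refine (norm_ddx_le (memHs_nonlin_sub le_rfl mu1 mt1)).trans ?_
  refine (hsNorm_one_nonlin_sub_le mu1 mt1 ((hsNorm_mono h1 mu).trans (hu.le τ hτ))
    ((hsNorm_mono h1 mt).trans (hu.le t ht))).trans ?_
  gcongr
  refine Real.le_sqrt_of_sq_le ((hsNorm_one_sq_le ((mu.sub mt).mono hs)).trans ?_)
  gcongr
  refine (hsNorm_mono hs (mu.sub mt)).trans ((hsNorm_sub_le mu mt).trans ?_)
  exact add_le_add (hu.le τ hτ) (hu.le t ht)

/-! ### The contraction estimate -/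

theorem uIcc_subset_Icc_of_mem {t T : ℝ} (ht : t ∈ Icc (0 : ℝ) T) : uIcc 0 t ⊆ Icc 0 T := by
  rw [uIcc_of_le ht.1]
  exact Icc_subset_Icc_right ht.2

theorem intervalIntegrable_duhamelIntegrand {s : ℕ} (hs : 2 ≤ s) {T a : ℝ} {u : ℝ → L2}
    (hu : AdmPath s T u a) {t : ℝ} (ht : t ∈ Icc (0 : ℝ) T) :
    IntervalIntegrable (duhamelIntegrand u t) volume 0 t := by
  apply ContinuousOn.intervalIntegrable
  have h1 : ContinuousOn (fun τ => (t - τ, ddx (nonlin (u τ)))) (uIcc 0 t) :=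
    ContinuousOn.prodMk (by fun_prop)
      ((continuousOn_ddx_nonlin hs hu).mono (uIcc_subset_Icc_of_mem ht))
  have h2 := continuous_airy.comp_continuousOn h1
  simp only [Function.comp_def] at h2
  exact h2

/-- The linear constant of the contraction estimate on the ball of radius `R`. -/
def contrB (s : ℕ) (T R : ℝ) : ℝ :=
  (2 * (Real.sqrt T * (1 + T)) + T * comC s) * R +
    (3 * (Real.sqrt T * (1 + T)) + T * (comC s * (algC s + Real.sqrt 2))) * R ^ 2

theorem contrB_nonneg {s : ℕ} {T R : ℝ} (hT : 0 ≤ T) (hR : 0 ≤ R) : 0 ≤ contrB s T R := by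
  have := comC_nonneg s
  have := algC_nonneg s
  unfold contrB
  positivity

/-- The difference is a mild solution with zero data. Local smoothing bounds it in `H^s` by `contrB
s T R * d`; this and the `L²` bound on the forcing give its Lipschitz constant, hence its maximal
function. The condition `hq` is chosen to halve both. -/
theorem admPath_Sbar_sub {s : ℕ} (hs : 3 ≤ s) {T R d : ℝ} (hT : 0 < T) {u w : ℝ → L2} (φ : L2)
    (hu : AdmPath s T u R) (hw : AdmPath s T w R) (hd : AdmPath s T (fun t => u t - w t) d)
    (hq : contrB s T R + T * (Real.sqrt 2 * R + 2 * R ^ 2) ≤ 1 / 2) :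
    AdmPath s T (fun t => Sbar u φ t - Sbar w φ t) (d / 2) := by
  have hs2 : 2 ≤ s := by omega
  have hs1 : 1 ≤ s := by omega
  have hR := hu.nonneg hT.le
  have hd0 := hd.nonneg hT.le
  have hB := contrB_nonneg (s := s) hT.le hR
  -- The forcing is continued by its endpoint values, since the Duhamel lemmas ask for continuity on
  -- the whole line; only times in `[0, T]` matter.
  set F : ℝ → L2 := IccExtend hT.le
    ((Icc 0 T).domRestrict fun τ => ddx (nonlin (u τ)) - ddx (nonlin (w τ))) with hF
  have hFc : Continuous F :=
    ((continuousOn_ddx_nonlin hs2 hu).sub (continuousOn_ddx_nonlin hs2 hw)).domRestrict.Icc_extend'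
  have hFs : ∀ τ ∈ Icc (0 : ℝ) T, F τ = ddx (nonlin (u τ)) - ddx (nonlin (w τ)) := fun τ hτ =>
    IccExtend_of_mem hT.le _ hτ
  have hFe : ∀ τ ∈ Icc (0 : ℝ) T, F τ = ddx (nonlin (u τ) - nonlin (w τ)) := by
    intro τ hτ
    rw [hFs τ hτ,
      ddx_sub (memHs_nonlin le_rfl ((hu.memHs τ hτ).mono hs1))
        (memHs_nonlin le_rfl ((hw.memHs τ hτ).mono hs1))]
  have hFK : ∀ τ ∈ Icc (0 : ℝ) T, ‖F τ‖ ≤ (Real.sqrt 2 * R + 2 * R ^ 2) * d := by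
    intro τ hτ
    have mu := hu.memHs τ hτ
    have mw := hw.memHs τ hτ
    rw [hFe τ hτ]
    refine (norm_ddx_le (memHs_nonlin_sub le_rfl (mu.mono hs1) (mw.mono hs1))).trans ?_
    refine (hsNorm_one_nonlin_sub_le (mu.mono hs1) (mw.mono hs1)
      ((hsNorm_mono hs1 mu).trans (hu.le τ hτ)) ((hsNorm_mono hs1 mw).trans (hw.le τ hτ))).trans ?_
    gcongr
    exact (hsNorm_mono hs1 (mu.sub mw)).trans (hd.le τ hτ)
  set v : ℝ → L2 := fun t => airy t 0 - ∫ τ in (0 : ℝ)..t, airy (t - τ) (F τ) with hv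
  have hairy0 : ∀ t, airy t (0 : L2) = 0 := fun t => fourierMul_zero _
  have hSv : ∀ t ∈ Icc (0 : ℝ) T, Sbar u φ t - Sbar w φ t = v t := by
    intro t ht
    have e : ∫ τ in (0 : ℝ)..t, airy (t - τ) (F τ)
        = (∫ τ in (0 : ℝ)..t, duhamelIntegrand u t τ) - ∫ τ in (0 : ℝ)..t, duhamelIntegrand w t τ := by
      rw [← intervalIntegral.integral_sub (intervalIntegrable_duhamelIntegrand hs2 hu ht)
        (intervalIntegrable_duhamelIntegrand hs2 hw ht)]
      refine intervalIntegral.integral_congr fun τ hτ => ?_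
      simp only [duhamelIntegrand]
      rw [hFs τ (uIcc_subset_Icc_of_mem ht hτ), airy_sub_right]
    simp only [Sbar, hv]
    rw [e, hairy0]
    abel
  have hvs : ∀ t ∈ Icc (0 : ℝ) T, MemHs s (v t) ∧ hsNorm s (v t) ≤ contrB s T R * d := by
    intro t ht
    have hcongr : ∀ τ ∈ uIcc 0 t,
        airy (t - τ) (F τ) = airy (t - τ) (ddx (nonlin (u τ) - nonlin (w τ))) :=
      fun τ hτ => by rw [hFe τ (uIcc_subset_Icc_of_mem ht hτ)]
    obtain ⟨e1, e2⟩ := memHs_duhamel hs1 (P := fun τ => nonlin (u τ) - nonlin (w τ))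
      (fun τ hτ => memHs_nonlin_sub hs1 (hu.memHs τ hτ) (hw.memHs τ hτ))
      (katoBdd_nonlin_sub hs2 hT.le hu hw hd) ht
      (((continuous_airy_comp hFc t).intervalIntegrable 0 t).congr
        fun τ hτ => hcongr τ (uIoc_subset_uIcc hτ))
    have e3 : v t = 0 - ∫ τ in (0 : ℝ)..t, airy (t - τ) (ddx (nonlin (u τ) - nonlin (w τ))) := by
      simp only [hv]
      rw [hairy0, intervalIntegral.integral_congr hcongr]
    rw [e3]
    refine ⟨(MemHs.zero s).sub e1, (hsNorm_sub_le (MemHs.zero s) e1).trans ?_⟩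
    rw [hsNorm_zero, zero_add]
    exact e2
  have hBq : contrB s T R * d ≤ d / 2 := by
    have : 0 ≤ T * (Real.sqrt 2 * R + 2 * R ^ 2) := by positivity
    nlinarith
  refine AdmPath.congr (u := v) ⟨fun t ht => (hvs t ht).1, fun t ht => (hvs t ht).2.trans hBq,
    ?_, ?_⟩ hSv
  · refine Continuous.continuousOn ?_
    simp only [hv, hairy0]
    exact continuous_const.sub (continuous_duhamel hFc)
  · have hlip := hasMaj_of_lipschitz (v := v)
      (K := contrB s T R * d + (Real.sqrt 2 * R + 2 * R ^ 2) * d) hT (by positivity)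
      fun t ht r hr => lipschitz_mild hFc 0 (fun _ => rfl) (fun t ht =>
        ⟨(hvs t ht).1.mono hs, (hsNorm_mono hs (hvs t ht).1).trans (hvs t ht).2⟩) hFK ht hr
    refine hlip.mono ?_
    have hv0 : v 0 = 0 := by simp [hv, hairy0]
    rw [hv0, norm_zero, zero_add]
    set K := Real.sqrt 2 * R + 2 * R ^ 2 with hKdef
    have hK0 : 0 ≤ K := by positivity
    have hTK : 0 ≤ T * K := by positivity
    have hTB : T * contrB s T R ≤ T / 2 - T * (T * K) := by nlinarith
    have hTTK : 0 ≤ T * (T * K) := by positivity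
    -- From `contrB + T K ≤ 1/2`: `T · contrB ≤ T/2` and `T K ≤ 1/2`.
    have : (contrB s T R + K) * T ≤ (1 + T) / 2 := by nlinarith
    calc (contrB s T R * d + K * d) * T = (contrB s T R + K) * T * d := by ring
      _ ≤ (1 + T) / 2 * d := by gcongr
      _ = _ := by ring

theorem admPath_airy {s : ℕ} (hs : 3 ≤ s) {T : ℝ} (hT : 0 < T) {φ : L2} (hφ : MemHs s φ) :
    AdmPath s T (fun t => airy t φ) (hsNorm s φ) where
  memHs t _ := (hφ.airy t).1
  le t _ := (hφ.airy t).2.le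
  cont := (continuous_airy_left φ).continuousOn
  maj := by
    have hz : ∀ t, airy t (0 : L2) = 0 := fun t => fourierMul_zero _
    have hlip := hasMaj_of_lipschitz (v := fun t => airy t φ) (K := hsNorm s φ + 0) hT
      (by have := hsNorm_nonneg s φ; positivity)
      fun t ht r hr => lipschitz_mild (F := fun _ => 0) continuous_const φ
        (fun t => by simp [hz]) (fun t _ => ⟨(hφ.airy t).1.mono hs,
          (hsNorm_mono hs (hφ.airy t).1).trans (hφ.airy t).2.le⟩) (K := 0) (by simp) ht hr
    refine hlip.mono ?_
    rw [norm_airy]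
    -- The initial value contributes `‖φ‖_s` and the Lipschitz constant `T ‖φ‖_s`: this is the
    -- origin of `1 + T` in `AdmPath`.
    nlinarith [norm_le_hsNorm hφ]

theorem Sbar_zero (φ : L2) (t : ℝ) : Sbar (fun _ => 0) φ t = airy t φ := by
  have h : ∀ t τ, duhamelIntegrand (fun _ => 0) t τ = 0 := by
    intro t τ
    rw [duhamelIntegrand, nonlin_zero, ddx_def, fourierMul_zero, airy_def, fourierMul_zero]
  simp [Sbar, h]

/-! ### Comparison of the constants -/

/-- Squared, this is `s ≤ 3 (4/3)^{s-3}`, an equality at 3 that persists because `(s + 1)/s ≤ 4/3`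
from there on. -/
theorem sqrt_natCast_le {s : ℕ} (hs : 3 ≤ s) :
    Real.sqrt s ≤ Real.sqrt 3 * Real.sqrt (4 / 3) ^ (s - 3) := by
  obtain ⟨k, rfl⟩ := Nat.exists_eq_add_of_le' hs
  rw [Nat.add_sub_cancel]
  apply Real.sqrt_le_iff.2 ⟨by positivity, ?_⟩
  rw [mul_pow, Real.sq_sqrt (by norm_num), ← pow_mul, mul_comm k 2, pow_mul,
    Real.sq_sqrt (by norm_num)]
  induction k with
  | zero => norm_num
  | succ k ih =>
    have h1 := ih (by omega)
    have h2 : (1 : ℝ) ≤ (4 / 3) ^ k := one_le_pow₀ (by norm_num)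
    rw [pow_succ]
    push_cast at h1 ⊢
    linarith

/-- Of the factor `s = √s √s` in `comC`, one root is traded for a power of `r = √(4/3)`. With `k = s
- 3` the product is then of order `√s r^{3k}`, and `r³ < 2`. -/
theorem comC_mul_le {s : ℕ} (hs : 3 ≤ s) :
    comC s * (algC s + Real.sqrt 2) + 2 ≤ 9 * (Real.sqrt s * 2 ^ s) := by
  have hz := sqrt_natCast_le hs
  obtain ⟨k, rfl⟩ := Nat.exists_eq_add_of_le' hs
  set z := Real.sqrt ((k + 3 : ℕ) : ℝ) with hzdef
  have hz2 : z * z = ((k + 3 : ℕ) : ℝ) := Real.mul_self_sqrt (by positivity)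
  have hz1 : 1.7 ≤ z := by
    apply Real.le_sqrt_of_sq_le
    push_cast
    have : (0 : ℝ) ≤ k := by positivity
    linarith
  set r := Real.sqrt (4 / 3) with hr
  have hr2 : r ^ 2 = 4 / 3 := Real.sq_sqrt (by norm_num)
  have hr0 : 0 ≤ r := Real.sqrt_nonneg _
  have hr1 : 1 ≤ r := by rw [hr, Real.one_le_sqrt]; norm_num
  have hr3 : r ≤ 1.16 := Real.sqrt_le_iff.2 (by norm_num)
  have h3 : Real.sqrt 3 ≤ 1.74 := Real.sqrt_le_iff.2 (by norm_num)
  have h2 : Real.sqrt 2 ≤ 1.42 := Real.sqrt_le_iff.2 (by norm_num)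
  have hp : 1 ≤ r ^ k := one_le_pow₀ hr1
  rw [Nat.add_sub_cancel] at hz
  have hz3 : z ≤ 1.74 * r ^ k := hz.trans (by gcongr)
  have e1 : r ^ (k + 3 - 2) = r ^ k * r := by
    rw [show k + 3 - 2 = k + 1 by omega, pow_succ]
  have e2 : r ^ (k + 3 - 1) = r ^ k * (4 / 3) := by
    rw [show k + 3 - 1 = k + 2 by omega, pow_add, hr2]
  have hC : comC (k + 3) ≤ 9.3 * z * (r ^ k * r ^ k) := by
    rw [comC, ← hr, e1, ← hz2]
    calc 4 * (z * z) * (r ^ k * r) + 2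
        ≤ 4 * (z * (1.74 * r ^ k)) * (r ^ k * 1.16) + 1.2 * z * (1 * 1) := by
          have : 4 * (z * z) * (r ^ k * r) ≤ 4 * (z * (1.74 * r ^ k)) * (r ^ k * 1.16) := by
            gcongr
          linarith
      _ ≤ 4 * (z * (1.74 * r ^ k)) * (r ^ k * 1.16) + 1.2 * z * (r ^ k * r ^ k) := by gcongr
      _ = (4 * 1.74 * 1.16 + 1.2) * (z * (r ^ k * r ^ k)) := by ring
      _ ≤ 9.3 * (z * (r ^ k * r ^ k)) := by
          gcongr
          norm_num
      _ = _ := by ring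
  have hA : algC (k + 3) + Real.sqrt 2 ≤ 3.5 * r ^ k := by
    rw [algC, ← hr, e2]
    nlinarith
  have hA0 : 0 ≤ algC (k + 3) + Real.sqrt 2 := by
    have := algC_nonneg (k + 3)
    positivity
  have hcube : r ^ k * r ^ k * r ^ k ≤ 2 ^ k := by
    rw [← mul_pow, ← mul_pow]
    gcongr
    nlinarith
  have hC0 := comC_nonneg (k + 3)
  have p1 : (1 : ℝ) ≤ 2 ^ k := one_le_pow₀ (by norm_num)
  have hzk : 1.7 ≤ z * 2 ^ k := by nlinarith
  calc comC (k + 3) * (algC (k + 3) + Real.sqrt 2) + 2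
      ≤ 9.3 * z * (r ^ k * r ^ k) * (3.5 * r ^ k) + 2 := by gcongr
    _ = 9.3 * 3.5 * (z * (r ^ k * r ^ k * r ^ k)) + 2 := by ring
    _ ≤ 9.3 * 3.5 * (z * 2 ^ k) + 2 := by gcongr
    -- Here `72 = 9 · 2³`, the cube restoring `2^s` from `2^k`.
    _ ≤ 72 * (z * 2 ^ k) := by linarith
    _ = _ := by rw [pow_add]; ring

theorem comC_le {s : ℕ} (hs : 3 ≤ s) : comC s + 2 ≤ 6 * (Real.sqrt s * 2 ^ s) := by
  have h := comC_mul_le hs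
  have h1 : 1 ≤ Real.sqrt 2 := by rw [Real.one_le_sqrt]; norm_num
  have hA : Real.sqrt 2 ≤ algC s := by
    rw [algC]
    have : (1 : ℝ) ≤ Real.sqrt (4 / 3) ^ (s - 1) :=
      one_le_pow₀ (by rw [Real.one_le_sqrt]; norm_num)
    nlinarith
  have hC := comC_nonneg s
  have h2 : comC s * 2 ≤ comC s * (algC s + Real.sqrt 2) := by
    gcongr
    linarith
  have h3 : (1 : ℝ) ≤ Real.sqrt s := by
    rw [Real.one_le_sqrt]
    exact_mod_cast (by omega : 1 ≤ s)
  have h4 : (1 : ℝ) ≤ Real.sqrt s * 2 ^ s := one_le_mul_of_one_le_of_one_le h3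
    (one_le_pow₀ (by norm_num))
  linarith

/-- The comparison is coefficientwise in `n` and `n²`. The summand 1 of `alpha` pays for the local
smoothing terms `√T (1 + T)`, and `√s 2^s √T` for the remainders of order `T`. The power `(3 +
T)^{3/2}` is used only through `√(3 + T) ≥ 1.5`. -/
theorem contraction_of_small {s : ℕ} (hs : 3 ≤ s) {T n : ℝ} (hT : 0 < T) (hn : 0 ≤ n)
    (h : alpha s T * T ^ (1 / 2 : ℝ) * (8 * (3 + T) ^ (3 / 2 : ℝ) * n ^ 2 + 4 * (3 + T) * n)
      ≤ 1 / 2) :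
    contrB s T (2 * n) + T * (Real.sqrt 2 * (2 * n) + 2 * (2 * n) ^ 2) ≤ 1 / 2 := by
  refine le_trans ?_ h
  have hr : T ^ (1 / 2 : ℝ) = Real.sqrt T := (Real.sqrt_eq_rpow T).symm
  have h32 : (3 + T) * 1.5 ≤ (3 + T) ^ (3 / 2 : ℝ) := by
    have e : (3 + T) ^ (3 / 2 : ℝ) = (3 + T) * Real.sqrt (3 + T) := by
      rw [Real.sqrt_eq_rpow, show (3 / 2 : ℝ) = 1 + 1 / 2 by norm_num,
        Real.rpow_add (by positivity), Real.rpow_one]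
    rw [e]
    gcongr
    apply Real.le_sqrt_of_sq_le
    linarith
  have hc1 := comC_le hs
  have hc2 := comC_mul_le hs
  have hs2 : Real.sqrt 2 ≤ 1.5 := Real.sqrt_le_iff.2 (by norm_num)
  rw [alpha, hr]
  set r := Real.sqrt T with hrdef
  have hr0 : 0 ≤ r := Real.sqrt_nonneg T
  have hrr : r * r = T := Real.mul_self_sqrt hT.le
  set σ := Real.sqrt s * 2 ^ s with hσ
  have hσ0 : 0 ≤ σ := by positivity
  set q := comC s * (algC s + Real.sqrt 2)
  set c := comC s
  calc contrB s T (2 * n) + T * (Real.sqrt 2 * (2 * n) + 2 * (2 * n) ^ 2)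
      = n * (4 * (r * (1 + T)) + T * (2 * c + 2 * Real.sqrt 2)) +
        n ^ 2 * (12 * (r * (1 + T)) + T * (4 * q + 8)) := by
        rw [contrB]
        ring
    _ ≤ n * (4 * (r * (3 + T)) + T * (4 * (3 + T) * σ)) +
        n ^ 2 * (12 * (r * (3 + T)) + T * (12 * (3 + T) * σ)) := by
        have t1 : 2 * c + 2 * Real.sqrt 2 ≤ 4 * (3 + T) * σ := by nlinarith
        have t3 : 4 * q + 8 ≤ 12 * (3 + T) * σ := by nlinarith
        gcongr <;> linarith
    _ = (σ * r + 1) * r * (8 * ((3 + T) * 1.5) * n ^ 2 + 4 * (3 + T) * n) := by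
        rw [← hrr]
        ring
    _ ≤ _ := by gcongr

/-! ### The Picard iteration -/

/-- The radius of the iterate and the size of the increment are carried together: `(2 - 2^{-j}) +
2^{-j}/2 = 2 - 2^{-(j+1)}`, so all iterates stay in the ball of radius `2‖φ‖_s`. The induction
starts from `v⁰ - 0`, of size `‖φ‖_s`. -/
theorem admPath_picard {s : ℕ} (hs : 3 ≤ s) {T : ℝ} (hT : 0 < T) {φ : L2} (hφ : MemHs s φ)
    (hq : contrB s T (2 * hsNorm s φ) + T * (Real.sqrt 2 * (2 * hsNorm s φ) +
      2 * (2 * hsNorm s φ) ^ 2) ≤ 1 / 2) (j : ℕ) :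
    AdmPath s T (picard φ j) ((2 - 2⁻¹ ^ j) * hsNorm s φ) ∧
      AdmPath s T (fun t => picard φ (j + 1) t - picard φ j t) (2⁻¹ ^ j * hsNorm s φ / 2) := by
  have hn := hsNorm_nonneg s φ
  have hpos : ∀ j : ℕ, (0 : ℝ) ≤ 2⁻¹ ^ j := fun j => by positivity
  have h2 : ∀ j : ℕ, (2 - 2⁻¹ ^ j) * hsNorm s φ ≤ 2 * hsNorm s φ := fun j => by
    have := mul_nonneg (hpos j) hn
    linarith
  induction j with
  | zero =>
    have h0 : AdmPath s T (picard φ 0) (hsNorm s φ) :=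
      (admPath_airy hs hT hφ).congr fun t _ => Sbar_zero φ t
    have hz : AdmPath s T (fun _ => (0 : L2)) (2 * hsNorm s φ) :=
      (AdmPath.zero s T).mono hT (by positivity)
    refine ⟨h0.mono hT (by norm_num), ?_⟩
    have h1 := admPath_Sbar_sub hs hT φ (h0.mono hT (by linarith)) hz
      (d := hsNorm s φ) (h0.congr fun t _ => sub_zero _) hq
    rw [pow_zero, one_mul]
    exact h1
  | succ j ih =>
    obtain ⟨i1, i2⟩ := ih
    have h1 : AdmPath s T (picard φ (j + 1)) ((2 - 2⁻¹ ^ (j + 1)) * hsNorm s φ) := by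
      refine ((i1.add i2).congr fun t _ => (add_sub_cancel _ _).symm).mono hT (le_of_eq ?_)
      rw [pow_succ]
      ring
    refine ⟨h1, ?_⟩
    have h3 := admPath_Sbar_sub hs hT φ (h1.mono hT (h2 _)) (i1.mono hT (h2 _)) i2 hq
    refine h3.mono hT (le_of_eq ?_)
    rw [pow_succ]
    ring

theorem hsNorm_picard_sub_le {s : ℕ} {φ : L2} {n t : ℝ}
    (hm : ∀ j, MemHs s (picard φ j t))
    (hd : ∀ j, hsNorm s (picard φ (j + 1) t - picard φ j t) ≤ 2⁻¹ ^ j * n / 2) (j k : ℕ) :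
    hsNorm s (picard φ j t - picard φ (j + k) t) ≤ (2⁻¹ ^ j - 2⁻¹ ^ (j + k)) * n := by
  induction k with
  | zero => simp [hsNorm_zero]
  | succ k ih =>
    have e : picard φ j t - picard φ (j + (k + 1)) t = (picard φ j t - picard φ (j + k) t) -
        (picard φ (j + k + 1) t - picard φ (j + k) t) := by
      rw [← add_assoc]
      abel
    rw [e]
    refine (hsNorm_sub_le ((hm _).sub (hm _)) ((hm _).sub (hm _))).trans ?_
    refine (add_le_add ih (hd (j + k))).trans (le_of_eq ?_)
    rw [← add_assoc, pow_succ (2⁻¹ : ℝ) (j + k)]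
    ring

/-- The limit is taken in `L²`, by completeness; since `H^s` balls are closed in `L²`, the tail
bounds put it in `H^s` with the same rate. -/
theorem exists_limit_picard {s : ℕ} {φ : L2} {n t : ℝ} (hn : 0 ≤ n)
    (hm : ∀ j, MemHs s (picard φ j t))
    (hd : ∀ j, hsNorm s (picard φ (j + 1) t - picard φ j t) ≤ 2⁻¹ ^ j * n / 2) :
    ∃ v : L2, MemHs s v ∧ ∀ j, hsNorm s (picard φ j t - v) ≤ 2⁻¹ ^ j * n := by
  have hc : CauchySeq fun j => picard φ j t := by
    refine cauchySeq_of_le_geometric (2⁻¹ : ℝ) (n / 2) (by norm_num) fun j => ?_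
    rw [dist_comm, dist_eq_norm]
    refine (norm_le_hsNorm ((hm _).sub (hm _))).trans ((hd j).trans (le_of_eq ?_))
    ring
  obtain ⟨v, hv⟩ := cauchySeq_tendsto_of_complete hc
  have key : ∀ j, MemHs s (picard φ j t - v) ∧ hsNorm s (picard φ j t - v) ≤ 2⁻¹ ^ j * n := by
    intro j
    refine memHs_of_tendsto (f := fun k => picard φ j t - picard φ (j + k) t)
      (Filter.Eventually.of_forall fun k => ⟨(hm _).sub (hm _), ?_⟩) ?_
    · refine (hsNorm_picard_sub_le hm hd j k).trans ?_
      gcongr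
      have : (0 : ℝ) ≤ 2⁻¹ ^ (j + k) := by positivity
      linarith
    · refine tendsto_const_nhds.sub ?_
      have := (Filter.tendsto_add_atTop_iff_nat j).2 hv
      simpa only [add_comm] using this
  refine ⟨v, ?_, fun j => (key j).2⟩
  have := (hm 0).sub (key 0).1
  rwa [sub_sub_cancel] at this

end CombinedKdV

end

theorem proposition2p2 (s : ℕ) (hs : 3 ≤ s) (T : ℝ) (hT : 0 < T)
    (φ : CombinedKdV.L2) (hφ : CombinedKdV.MemHs s φ)
    (hsmall : CombinedKdV.alpha s T * T ^ (1 / 2 : ℝ) *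
        (8 * (3 + T) ^ (3 / 2 : ℝ) * CombinedKdV.hsNorm s φ ^ 2
          + 4 * (3 + T) * CombinedKdV.hsNorm s φ) ≤ 1 / 2) :
    -- the iterates are well defined in `H^s` on `[0, T]`
    (∀ j : ℕ, ∀ t ∈ Set.Icc (0 : ℝ) T, CombinedKdV.MemHs s (CombinedKdV.picard φ j t)) ∧
    (∀ j : ℕ, ∀ t ∈ Set.Icc (0 : ℝ) T,
      IntervalIntegrable
        (CombinedKdV.duhamelIntegrand (CombinedKdV.picard φ j) t) volume 0 t) ∧
    -- the difference estimate
    (∀ j : ℕ, ∀ t ∈ Set.Icc (0 : ℝ) T,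
      CombinedKdV.hsNorm s (CombinedKdV.picard φ (j + 1) t - CombinedKdV.picard φ j t)
        ≤ (2 : ℝ)⁻¹ ^ j * (3 + T) ^ (1 / 2 : ℝ) * CombinedKdV.hsNorm s φ) ∧
    -- geometric convergence in `H^s`, uniformly on `[0, T]`
    (∃ v : ℝ → CombinedKdV.L2,
      (∀ t ∈ Set.Icc (0 : ℝ) T, CombinedKdV.MemHs s (v t)) ∧
      ∀ j : ℕ, ∀ t ∈ Set.Icc (0 : ℝ) T,
        CombinedKdV.hsNorm s (CombinedKdV.picard φ j t - v t)
          ≤ 2 * (2 : ℝ)⁻¹ ^ j * (3 + T) ^ (1 / 2 : ℝ) * CombinedKdV.hsNorm s φ) := by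
  classical
  have hn := CombinedKdV.hsNorm_nonneg s φ
  have hq := CombinedKdV.contraction_of_small hs hT hn hsmall
  have A := CombinedKdV.admPath_picard hs hT hφ hq
  -- The iteration yields the bounds without `(3 + T)^{1/2}`, so that factor enters only through
  -- being at least 1.
  have h3 : (1 : ℝ) ≤ (3 + T) ^ (1 / 2 : ℝ) :=
    Real.one_le_rpow (by linarith) (by norm_num)
  have hle : ∀ j : ℕ, (2 : ℝ)⁻¹ ^ j * CombinedKdV.hsNorm s φ
      ≤ (2 : ℝ)⁻¹ ^ j * (3 + T) ^ (1 / 2 : ℝ) * CombinedKdV.hsNorm s φ := fun j => by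
    gcongr
    exact le_mul_of_one_le_right (by positivity) h3
  have hpos : ∀ j : ℕ, 0 ≤ (2 : ℝ)⁻¹ ^ j * CombinedKdV.hsNorm s φ := fun j => by positivity
  refine ⟨fun j t ht => (A j).1.memHs t ht,
    fun j t ht => CombinedKdV.intervalIntegrable_duhamelIntegrand (by omega) (A j).1 ht,
    fun j t ht => ((A j).2.le t ht).trans ?_, ?_⟩
  · linarith [hle j, hpos j]
  · have hv : ∀ t ∈ Set.Icc (0 : ℝ) T, ∃ v : CombinedKdV.L2, CombinedKdV.MemHs s v ∧
        ∀ j, CombinedKdV.hsNorm s (CombinedKdV.picard φ j t - v)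
          ≤ (2 : ℝ)⁻¹ ^ j * CombinedKdV.hsNorm s φ := fun t ht =>
      CombinedKdV.exists_limit_picard hn (fun j => (A j).1.memHs t ht) fun j => (A j).2.le t ht
    choose! v hv1 hv2 using hv
    refine ⟨v, hv1, fun j t ht => (hv2 t ht j).trans ?_⟩
    linarith [hle j, hpos j]
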